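/- **Setting.** Let $n\ge 0$ and let $\Lambda_{2n}$ be the complex Grassmann algebra with anti-commuting generators $x_1,\dots,x_{2n}$ and ordered monomials $x_A$, $A\subseteq\{1,\dots,2n\}$. Put $$\theta^2=-\sum_{j=1}^n x_{2j-1}x_{2j},\qquad \nabla_f^2=-4\sum_{j=1}^n\partial_{x_{2j-1}}\partial_{x_{2j}},\qquad \mathbb E=\sum_{i=1}^{2n} x_i\partial_{x_i},\qquad \mathcal H_k=\ker\nabla_f^2\cap\Lambda_{2n}^k .$$ The Berezin integral is $\int_B=\pi^{-n}\partial_{x_{2n}}\cdots\partial_{x_1}$. The star map $*$ is the linear map with $*x_A=\pm2^{|A|-n}x_{A^c}$, the sign being such that $x_A(*x_A)=2^{|A|-n}x_1\cdots x_{2n}$. The inner product is $\langle f|g\rangle=\int_B f(*\bar g)$, where $\bar g$ has the complex conjugate coefficients. The map $f\mapsto\tilde f$ is the linear anti-automorphism with $\tilde x_{2j-1}=x_{2j}$, $\tilde x_{2j}=-x_{2j-1}$. Let $$L_j^{(a)}(t)=\sum_{i=0}^j\frac{(a+i+1)_{j-i}}{i!\,(j-i)!}(-t)^i,\qquad C_k^{(a)}(t)=\sum_{j=0}^{\lfloor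 k/2\rfloor}\frac{(-1)^j(a)_{k-j}}{j!\,(k-2j)!}(2t)^{k-2j},$$ with $(a)_m=a(a+1)\cdots(a+m-1)$, be the generalized Laguerre and Gegenbauer polynomials. Exponentials of nilpotent elements are the finite Taylor sums. For $0\le k\le n$ let $H_k^{(l)}$, $1\le l\le\dim\mathcal H_k$, be a basis of $\mathcal H_k$ with real coefficients such that $$\langle H_k^{(p)}e^{-\theta^2/2}\,|\,H_k^{(q)}e^{-\theta^2/2}\rangle=\frac{\delta_{pq}}{(n-k)!}.$$ For $0\le k\le n$, $0\le j\le n-k$ and $1\le l\le\dim\mathcal H_k$ put $$\varphi_{j,k,l}=(-\nabla_f^2-\theta^2+2\mathbb E-2n)^j\bigl(H_k^{(l)}e^{-\theta^2/2}\bigr),\qquad \gamma_{j,k}=\frac{4^{2j}j!}{(n-k-j)!},\qquad \phi_{j,k,l}=\varphi_{j,k,l}/\sqrt{\gamma_{j,k}} .$$ Let $\Lambda_{4n}$ be generated by $x_1,\dots,x_{2n},y_1,\dots,y_{2n}$, all mutually anti-commuting. Let $\theta_y^2$ be $\theta^2$ in the variables $y$, and put $$\langle x,y\rangle=-\tfrac12\sum_{j=1}^n(x_{2j-1}y_{2j}-x_{2j}y_{2j-1}),\qquad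 F_k(x,y)=\sum_l\tilde H_k^{(l)}(x)H_k^{(l)}(y).$$ **Theorem.** All sums below run over $0\le k\le n$, $0\le j\le n-k$ and, where $l$ occurs, $1\le l\le\dim\mathcal H_k$. 1. The $\phi_{j,k,l}$ are orthonormal. Moreover $\varphi_{j,k,l}=2^{2j}j!\,L_j^{(k-n-1)}(\theta^2)H_k^{(l)}e^{-\theta^2/2}$, and $$*\bigl(L_j^{(k-n-1)}(\theta^2)H_k^{(l)}e^{-\theta^2/2}\bigr)=(-1)^jL_j^{(k-n-1)}(\theta^2)\tilde H_k^{(l)}e^{-\theta^2/2}.$$ 2. For $0\le k\le n$, $$F_k(x,y)=\sum_{j=0}^{\lfloor k/2\rfloor}\frac{2^{k-2j}\pi^n(n+1-k)}{(k-2j)!\,j!\,(n+1+j-k)!}\langle x,y\rangle^{k-2j}\theta^{2j}\theta_y^{2j} =\pi^n(-1)^k\frac{n+1-k}{(n+1)!}\Bigl(\sqrt{\theta^2\theta_y^2}\Bigr)^kC_k^{(-n-1)}\Bigl(\frac{\langle x,y\rangle}{\sqrt{\theta^2\theta_y^2}}\Bigr),$$ where the last expression denotes the homogenized polynomial: each $t^{k-2j}$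 in $C_k^{(-n-1)}(t)$ is replaced by $\langle x,y\rangle^{k-2j}(\theta^2\theta_y^2)^j$. 3. (Mehler formula.) For every real $\alpha$ with $e^{2i\alpha}\ne1$, $$\sum_{j,k,l}(*\phi_{j,k,l})(x)\,e^{i\alpha(2j+k)}\phi_{j,k,l}(y)=\bigl(\pi(1-e^{2i\alpha})\bigr)^n\exp\frac{4e^{i\alpha}\langle x,y\rangle-(1+e^{2i\alpha})(\theta^2+\theta_y^2)}{2-2e^{2i\alpha}}.$$ The left-hand side equals $$\sum_{j,k,l}\frac{(-1)^j}{\gamma_{j,k}}4^{2j}(j!)^2e^{i\alpha(2j+k)}L_j^{(k-n-1)}(\theta^2)L_j^{(k-n-1)}(\theta_y^2)\tilde H_k^{(l)}(x)H_k^{(l)}(y)\exp\Bigl(-\frac{\theta^2+\theta_y^2}2\Bigr).$$ Moreover $$\sum_{j,k}(-1)^jj!\,(n-k-j)!\,e^{i\alpha(2j+k)}L_j^{(k-n-1)}(\theta^2)L_j^{(k-n-1)}(\theta_y^2)F_k(x,y)=\bigl(\pi(1-e^{2i\alpha})\bigr)^n\exp\frac{2e^{i\alpha}\langle x,y\rangle-e^{2i\alpha}(\theta^2+\theta_y^2)}{1-e^{2i\alpha}}.$$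 4. For $\alpha=\pm\pi/2$ this decomposes the kernel of the fermionic Fourier transform: $$\sum_{j,k,l}(*\phi_{j,k,l})(x)\,e^{\pm i\frac\pi2(2j+k)}\phi_{j,k,l}(y)=(2\pi)^n\exp(\pm i\langle x,y\rangle),$$ $$\sum_{j,k}j!\,(n-k-j)!\,(\pm i)^kL_j^{(k-n-1)}(\theta^2)L_j^{(k-n-1)}(\theta_y^2)F_k(x,y)\exp\Bigl(-\frac{\theta^2+\theta_y^2}2\Bigr)=(2\pi)^n\exp(\pm i\langle x,y\rangle).$$ 5. Let $A$ be a real $2n\times2n$ matrix with $A^TJA=J$, where $J$ is block diagonal with blocks $\begin{pmatrix}0&1\\-1&0\end{pmatrix}$. The simultaneous substitution $x\mapsto A^Tx$, $y\mapsto A^Ty$ fixes every product $L_j^{(k-n-1)}(\theta^2)L_j^{(k-n-1)}(\theta_y^2)F_k(x,y)$. It also fixes the left- and right-hand sides of the first and the third formula of part 3, for every real $\alpha$ with $e^{2i\alpha}\neq 1$. -/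

import Mathlib

open scoped Nat

namespace GrassmannMehler

noncomputable section

/-- The complex Grassmann algebra `Λ_{2n}`; the generators are indexed by `0, …, 2n - 1`. -/
abbrev Gr (n : ℕ) : Type := ExteriorAlgebra ℂ (Fin (2 * n) → ℂ)

/-- The Grassmann algebra `Λ_{4n}` generated by two mutually anti-commuting copies `x`, `y` of the
generators of `Λ_{2n}`. -/
abbrev Gr2 (n : ℕ) : Type :=
  ExteriorAlgebra ℂ ((Fin (2 * n) → ℂ) × (Fin (2 * n) → ℂ))

/-- The index of the first generator of the `j`-th pair (`2j - 1` when counting from one). -/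
def fstIdx {n : ℕ} (j : Fin n) : Fin (2 * n) := ⟨2 * j, by omega⟩

/-- The index of the second generator of the `j`-th pair (`2j` when counting from one). -/
def sndIdx {n : ℕ} (j : Fin n) : Fin (2 * n) := ⟨2 * j + 1, by omega⟩

/-- The generators of `Λ_{2n}`. -/
def gen {n : ℕ} (i : Fin (2 * n)) : Gr n := ExteriorAlgebra.ι ℂ (Pi.single i 1)

/-- The basis of ordered monomials `x_A`, `A ⊆ {0, …, 2n - 1}`. -/
def mono (n : ℕ) : Module.Basis (Finset (Fin (2 * n))) ℂ (Gr n) :=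
  (Pi.basisFun ℂ (Fin (2 * n))).ExteriorAlgebra

/-- The (left) partial derivative with respect to the `i`-th generator. -/
def pderiv {n : ℕ} (i : Fin (2 * n)) : Module.End ℂ (Gr n) :=
  CliffordAlgebra.contractLeft (Q := (0 : QuadraticForm ℂ (Fin (2 * n) → ℂ)))
    (LinearMap.proj i : (Fin (2 * n) → ℂ) →ₗ[ℂ] ℂ)

/-- `θ² = -∑ x_{2j-1} x_{2j}`. -/
def thetaSq (n : ℕ) : Gr n := -∑ j : Fin n, gen (fstIdx j) * gen (sndIdx j)

/-- The fermionic Laplace operator `-4 ∑ ∂_{2j-1} ∂_{2j}`. -/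
def laplace (n : ℕ) : Module.End ℂ (Gr n) :=
  (-4 : ℂ) • ∑ j : Fin n, pderiv (fstIdx j) * pderiv (sndIdx j)

/-- The fermionic Euler operator `∑ x_i ∂_i`. -/
def euler (n : ℕ) : Module.End ℂ (Gr n) :=
  ∑ i : Fin (2 * n), LinearMap.mulLeft ℂ (gen i) * pderiv i

/-- The fermionic spherical harmonics of degree `k`. -/
def harmonics (n k : ℕ) : Submodule ℂ (Gr n) :=
  LinearMap.ker (laplace n) ⊓ ⋀[ℂ]^k (Fin (2 * n) → ℂ)

/-- Complex conjugation of the coefficients with respect to the monomials. -/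
def conj {n : ℕ} (f : Gr n) : Gr n :=
  ∑ A : Finset (Fin (2 * n)), (starRingEnd ℂ) ((mono n).repr f A) • mono n A

/-- The Berezin integral `π^{-n} ∂_{2n} ⋯ ∂_1`; the value lies in the scalars and is read off
as a complex number. -/
def berezin {n : ℕ} (f : Gr n) : ℂ :=
  ((Real.pi : ℂ) ^ n)⁻¹ *
    ExteriorAlgebra.algebraMapInv
      ((List.ofFn (fun i : Fin (2 * n) => pderiv i)).reverse.prod f)

/-- The sign `±1` with `x_A x_{Aᶜ} = ± x_1 ⋯ x_{2n}`. -/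
def complSign {n : ℕ} (A : Finset (Fin (2 * n))) : ℂ :=
  (mono n).repr (mono n A * mono n Aᶜ) Finset.univ

/-- The star map: `x_A ↦ ± 2^{|A| - n} x_{Aᶜ}`, see `mono_mul_hodge` for the sign. -/
def hodge (n : ℕ) : Module.End ℂ (Gr n) :=
  (mono n).constr ℂ fun A => ((2 : ℂ) ^ ((A.card : ℤ) - n) * complSign A) • mono n Aᶜ

theorem mono_mul_mono_compl {n : ℕ} (A : Finset (Fin (2 * n))) :
    mono n A * mono n Aᶜ = complSign A • mono n Finset.univ ∧
      (complSign A = 1 ∨ complSign A = -1) := by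
  have hd : Disjoint (Set.powersetCard.ofCard (s := A) rfl).val
      (Set.powersetCard.ofCard (s := Aᶜ) rfl).val := disjoint_compl_right
  have h := ExteriorAlgebra.basis_mul_of_disjoint (Pi.basisFun ℂ (Fin (2 * n)))
    (Set.powersetCard.ofCard (s := A) rfl) (Set.powersetCard.ofCard (s := Aᶜ) rfl) hd
  have hu : ((Set.powersetCard.disjUnion hd : Set.powersetCard _ _) : Finset (Fin (2 * n)))
      = Finset.univ := by
    simp [Set.powersetCard.disjUnion, Set.powersetCard.ofCard]
  rw [hu] at h
  change mono n A * mono n Aᶜ = _ • mono n Finset.univ at h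
  unfold complSign
  rw [h]
  rcases Int.units_eq_one_or (Set.powersetCard.permOfDisjoint hd).sign with hs | hs <;>
    rw [hs] <;> simp [Units.smul_def]

/-- The sign in the star map is the one with `x_A (* x_A) = 2^{|A| - n} x_1 ⋯ x_{2n}`. -/
theorem mono_mul_hodge {n : ℕ} (A : Finset (Fin (2 * n))) :
    mono n A * hodge n (mono n A) = (2 : ℂ) ^ ((A.card : ℤ) - n) • mono n Finset.univ := by
  obtain ⟨h, hs⟩ := mono_mul_mono_compl A
  rw [hodge, Module.Basis.constr_basis, mul_smul_comm, h, smul_smul]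
  rcases hs with hs | hs <;> simp [hs]

/-- `⟨f | g⟩ = ∫_B f (* conj g)`. -/
def ip {n : ℕ} (f g : Gr n) : ℂ := berezin (f * hodge n (conj g))

/-- The matrix `J`, block diagonal with blocks `(0, 1; -1, 0)`. -/
def symp (R : Type) [Ring R] (n : ℕ) : Matrix (Fin (2 * n)) (Fin (2 * n)) R :=
  ∑ j : Fin n, (Matrix.single (fstIdx j) (sndIdx j) 1 - Matrix.single (sndIdx j) (fstIdx j) 1)

/-- The linear anti-automorphism with `x_{2j-1} ↦ x_{2j}`, `x_{2j} ↦ -x_{2j-1}`. -/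
def tilde (n : ℕ) : Module.End ℂ (Gr n) :=
  CliffordAlgebra.reverse (Q := (0 : QuadraticForm ℂ (Fin (2 * n) → ℂ))) ∘ₗ
    (ExteriorAlgebra.map (Matrix.toLin' (symp ℂ n).transpose)).toLinearMap

theorem tilde_mul {n : ℕ} (f g : Gr n) : tilde n (f * g) = tilde n g * tilde n f := by
  simp [tilde, CliffordAlgebra.reverse.map_mul]

theorem tilde_gen {n : ℕ} (j : Fin n) :
    tilde n (gen (fstIdx j)) = gen (sndIdx j) ∧ tilde n (gen (sndIdx j)) = -gen (fstIdx j) := by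
  have hfs : ∀ i k : Fin n, (fstIdx i = sndIdx k) = False := fun i k => by
    simp only [fstIdx, sndIdx, Fin.mk.injEq, eq_iff_iff, iff_false]; omega
  have hsf : ∀ i k : Fin n, (sndIdx i = fstIdx k) = False := fun i k => by
    simp only [fstIdx, sndIdx, Fin.mk.injEq, eq_iff_iff, iff_false]; omega
  have hff : ∀ i k : Fin n, (fstIdx i = fstIdx k) = (i = k) := fun i k => by
    simp only [fstIdx, eq_iff_iff, Fin.ext_iff]; omega
  have hss : ∀ i k : Fin n, (sndIdx i = sndIdx k) = (i = k) := fun i k => by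
    simp only [sndIdx, eq_iff_iff, Fin.ext_iff]; omega
  have h1 : (symp ℂ n).transpose.mulVec (Pi.single (fstIdx j) 1) = Pi.single (sndIdx j) 1 := by
    ext b
    simp [symp, Matrix.sum_apply, Matrix.single_apply, Pi.single_apply, hff, hsf, ite_and,
      eq_comm]
  have h2 : (symp ℂ n).transpose.mulVec (Pi.single (sndIdx j) 1) = -Pi.single (fstIdx j) 1 := by
    ext b
    simp [symp, Matrix.sum_apply, Matrix.single_apply, Pi.single_apply, hss, hfs, ite_and,
      eq_comm]
  constructor
  · simp [tilde, gen, ExteriorAlgebra.map_apply_ι, h1, ExteriorAlgebra.ι]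
  · simp [tilde, gen, ExteriorAlgebra.map_apply_ι, h2, ExteriorAlgebra.ι]

/-- The generalized Laguerre polynomial
`L_j^{(a)}(t) = ∑_i (a+i+1)_{j-i} / (i! (j-i)!) (-t)^i`, with `(·)_m` the rising factorial. -/
def laguerre (a : ℂ) (j : ℕ) : Polynomial ℂ :=
  ∑ i ∈ Finset.range (j + 1),
    Polynomial.C ((-1) ^ i * (ascPochhammer ℂ (j - i)).eval (a + i + 1) / (i ! * (j - i)!)) *
      Polynomial.X ^ i

/-- The Gegenbauer polynomial
`C_k^{(a)}(t) = ∑_j (-1)^j (a)_{k-j} / (j! (k-2j)!) (2t)^{k-2j}`. -/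
def gegenbauer (a : ℂ) (k : ℕ) : Polynomial ℂ :=
  ∑ j ∈ Finset.range (k / 2 + 1),
    Polynomial.C ((-1) ^ j * (ascPochhammer ℂ (k - j)).eval a / (j ! * (k - 2 * j)!)) *
      (Polynomial.C 2 * Polynomial.X) ^ (k - 2 * j)

/-- The Gaussian `exp(-θ²/2)`. -/
def gauss (n : ℕ) : Gr n := IsNilpotent.exp ((-1 / 2 : ℂ) • thetaSq n)

/-- The spherical Hermite function `(-∇² - θ² + 2 E - 2n)^j (h exp(-θ²/2))`. -/
def hermiteFn (n j : ℕ) (h : Gr n) : Gr n :=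
  ((-laplace n - LinearMap.mulLeft ℂ (thetaSq n) + (2 : ℂ) • euler n - (2 * n : ℂ) • 1) ^ j)
    (h * gauss n)

/-- `γ_{j,k} = 4^{2j} j! / (n-k-j)!`. -/
def gam (n j k : ℕ) : ℝ := 4 ^ (2 * j) * j ! / (n - k - j)!

/-- The spherical Hermite function divided by `√γ_{j,k}`, for `h` of degree `k`. -/
def hermiteUnit (n j k : ℕ) (h : Gr n) : Gr n :=
  ((Real.sqrt (gam n j k) : ℂ))⁻¹ • hermiteFn n j h

/-- `f ↦ f(x)`. -/
def inX (n : ℕ) : Gr n →ₐ[ℂ] Gr2 n := ExteriorAlgebra.map (LinearMap.inl ℂ _ _)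

/-- `f ↦ f(y)`. -/
def inY (n : ℕ) : Gr n →ₐ[ℂ] Gr2 n := ExteriorAlgebra.map (LinearMap.inr ℂ _ _)

/-- `θ²` in the variables `x`. -/
def thX (n : ℕ) : Gr2 n := inX n (thetaSq n)

/-- `θ²` in the variables `y`. -/
def thY (n : ℕ) : Gr2 n := inY n (thetaSq n)

/-- `⟨x, y⟩ = -1/2 ∑ (x_{2j-1} y_{2j} - x_{2j} y_{2j-1})`. -/
def pair (n : ℕ) : Gr2 n :=
  (-1 / 2 : ℂ) • ∑ j : Fin n,
    (inX n (gen (fstIdx j)) * inY n (gen (sndIdx j)) -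
      inX n (gen (sndIdx j)) * inY n (gen (fstIdx j)))

/-- Families indexed by a degree `k` and an index `l = 1, …, dim H_k`. -/
abbrev HarmonicFamily (n : ℕ) : Type :=
  (k : ℕ) → Fin (Module.finrank ℂ (harmonics n k)) → Gr n

/-- `F_k(x, y) = ∑_l H̃_k^{(l)}(x) H_k^{(l)}(y)`. -/
def reprKernel (n : ℕ) (H : HarmonicFamily n) (k : ℕ) : Gr2 n :=
  ∑ l, inX n (tilde n (H k l)) * inY n (H k l)

/-- `∑_{j,k,l} (*φ_{j,k,l})(x) e^{iα(2j+k)} φ_{j,k,l}(y)`, with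
`0 ≤ k ≤ n`, `0 ≤ j ≤ n - k`. -/
def hermiteSum (n : ℕ) (H : HarmonicFamily n) (α : ℝ) : Gr2 n :=
  ∑ k ∈ Finset.range (n + 1), ∑ j ∈ Finset.range (n - k + 1), ∑ l,
    Complex.exp (Complex.I * α * (2 * j + k)) •
      (inX n (hodge n (hermiteUnit n j k (H k l))) * inY n (hermiteUnit n j k (H k l)))

/-- `L_j^{(k-n-1)}(θ²) L_j^{(k-n-1)}(θ_y²)`. -/
def laguerrePair (n j k : ℕ) : Gr2 n :=
  Polynomial.aeval (thX n) (laguerre ((k : ℂ) - n - 1) j) *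
    Polynomial.aeval (thY n) (laguerre ((k : ℂ) - n - 1) j)

/-- `∑_{j,k} (-1)^j j! (n-k-j)! e^{iα(2j+k)} L_j(θ²) L_j(θ_y²) F_k(x, y)`, with
`0 ≤ k ≤ n`, `0 ≤ j ≤ n - k`. -/
def laguerreSum (n : ℕ) (H : HarmonicFamily n) (α : ℝ) : Gr2 n :=
  ∑ k ∈ Finset.range (n + 1), ∑ j ∈ Finset.range (n - k + 1),
    ((-1) ^ j * j ! * (n - k - j)! * Complex.exp (Complex.I * α * (2 * j + k))) •
      (laguerrePair n j k * reprKernel n H k)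

/-- The right-hand side of the formula for `hermiteSum`. -/
def mehlerKernel (n : ℕ) (α : ℝ) : Gr2 n :=
  ((Real.pi * (1 - Complex.exp (2 * Complex.I * α))) ^ n : ℂ) •
    IsNilpotent.exp ((1 / (2 - 2 * Complex.exp (2 * Complex.I * α))) •
      ((4 * Complex.exp (Complex.I * α)) • pair n -
        (1 + Complex.exp (2 * Complex.I * α)) • (thX n + thY n)))

/-- The right-hand side of the formula for `laguerreSum`. -/
def mehlerKernel' (n : ℕ) (α : ℝ) : Gr2 n :=
  ((Real.pi * (1 - Complex.exp (2 * Complex.I * α))) ^ n : ℂ) •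
    IsNilpotent.exp ((1 / (1 - Complex.exp (2 * Complex.I * α))) •
      ((2 * Complex.exp (Complex.I * α)) • pair n -
        Complex.exp (2 * Complex.I * α) • (thX n + thY n)))

/-- The simultaneous action `f(x, y) ↦ f(Aᵀ x, Aᵀ y)` of a real matrix `A`, i.e. the algebra
endomorphism `x_i ↦ ∑_j A_{ji} x_j`, `y_i ↦ ∑_j A_{ji} y_j`. -/
def act {n : ℕ} (A : Matrix (Fin (2 * n)) (Fin (2 * n)) ℝ) : Gr2 n →ₐ[ℂ] Gr2 n :=
  ExteriorAlgebra.map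
    (LinearMap.prodMap (Matrix.toLin' (A.map Complex.ofReal))
      (Matrix.toLin' (A.map Complex.ofReal)))

end

end GrassmannMehler

open GrassmannMehler

open scoped Nat

namespace GrassmannMehler

noncomputable section

/-! ### Exponentials of nilpotent elements and iterated commutators. -/

section Exponential

variable {R : Type*} [Ring R] [Algebra ℂ R]

/-! Multiplication by `θ²`, the Laplacian `∇²` and the weight operator `2(E - n)` span a copy of
`sl₂`, in which harmonic elements of degree `k` are lowest weight vectors of weight `k - n`. For the
bilinear form `∫ f (*g)` the monomials are orthogonal with positive norms and `x_i` is adjoint to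
`2∂_i`; hence `θ²` is adjoint to `-∇²` and `E` is self-adjoint. Positivity of the associated
Hermitian form gives the Fischer decomposition (`fischerSpan_eq_top`): the elements `θ^{2j} H_k`
with `j ≤ n - k` form an orthogonal basis. The Hermite functions are the ladder of the oscillator
`(θ² - ∇²)/2` over the ground states `H_k exp(-θ²/2)`. Commutators give their norms
(`form_raising_pow`), counting makes them a second orthogonal basis, and stripping the raising
operator of the Gaussian turns the ladder into a Laguerre recurrence. The star map anticommutes with
the raising operator and sends `H exp(-θ²/2)` to `H̃ exp(-θ²/2)` (`hodge_harmonic_mul_gauss`).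

All kernels come from one device, the canonical element `casimir β = ∑ β(u, u) / ‖u‖²`. It is the
same in every orthogonal basis, an operator in one slot can be traded for its adjoint in the other,
and an isometry applied in both slots drops out. With `tilde` in the first slot and scaling by `s`
in the second, monomials give `(2π)^n exp(s⟨x,y⟩)` (`casimir_tilde_scaling`). The Fischer basis
expresses the same element through the products `θ^{2j} θ_y^{2j} F_k`. Comparing powers of `s` gives
a triangular system for the `F_k`, which a telescoping hypergeometric sum inverts.

For Mehler's formula, `evolution n z` is, up to a constant, a product Gaussian, scaling, Fourier
transform, Gaussian. It commutes with the raising operator up to `z²` and multiplies ground states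
by `z^k`, so it has eigenvalue `z^{2j+k}` on the Hermite functions. The left-hand side is therefore
the canonical element of star and evolution. Moving the inner Gaussian to the other slot, where the
star turns it into a Gaussian in `x`, and dropping the isometric Fourier transform leaves
`exp(t⟨x,y⟩)` times two Gaussians (`casimir_hodge_evolution`). The Fourier kernel is the case `z =
±i`. Symplectic invariance holds because everything is a polynomial in `⟨x,y⟩`, `θ²` and `θ_y²`,
each a contraction of generators with `J`. -/

theorem exp_eq_complex_sum [Module ℚ R] {a : R} {m : ℕ} (h : a ^ m = 0) :
    IsNilpotent.exp a = ∑ i ∈ Finset.range m, ((i ! : ℂ))⁻¹ • a ^ i := by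
  rw [IsNilpotent.exp_eq_sum h]
  refine Finset.sum_congr rfl fun i _ => ?_
  rw [← Rat.cast_smul_eq_qsmul ℂ]
  simp

/-- Since `c` commutes with `a`, only the first and second iterated commutators of `a` with `b`
appear, with binomial coefficients. The exponent `m + 2` avoids truncated subtraction. -/
theorem pow_mul_eq_of_commutator {a b c d : R} (hb : a * b = b * a + d) (hd : a * d = d * a + c)
    (hc : a * c = c * a) (m : ℕ) :
    a ^ (m + 2) * b = b * a ^ (m + 2) + ((m : ℂ) + 2) • (d * a ^ (m + 1)) +
      (((m : ℂ) + 2) * (m + 1) / 2) • (c * a ^ m) := by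
  induction m with
  | zero =>
    have : a ^ 2 * b = b * a ^ 2 + d * a + d * a + c := by
      rw [pow_two, mul_assoc, hb, mul_add, ← mul_assoc, hb, hd]; noncomm_ring
    simp only [zero_add, this, pow_one, pow_zero, mul_one, Nat.cast_zero]
    module
  | succ m ih =>
    have e : a ^ (m + 1 + 2) * b = a * (a ^ (m + 2) * b) := by rw [← mul_assoc, ← pow_succ']
    rw [e, ih, mul_add, mul_add, mul_smul_comm, mul_smul_comm, ← mul_assoc, ← mul_assoc,
      ← mul_assoc, hb, hd, hc]
    have e1 : (b * a + d) * a ^ (m + 2) = b * a ^ (m + 1 + 2) + d * a ^ (m + 2) := by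
      rw [add_mul, mul_assoc, ← pow_succ']
    have e2 : (d * a + c) * a ^ (m + 1) = d * a ^ (m + 2) + c * a ^ (m + 1) := by
      rw [add_mul, mul_assoc, ← pow_succ']
    have e3 : c * a * a ^ m = c * a ^ (m + 1) := by rw [mul_assoc, ← pow_succ']
    rw [e1, e2, e3]
    push_cast
    have e4 : m + 1 + 1 = m + 2 := rfl
    rw [e4]
    module

/-- Hadamard's formula for `e^a b e^{-a}`; the series stops because the double commutator commutes
with `a`. Every conjugation of an operator by a Gaussian rests on it. -/
theorem exp_mul_eq_of_commutator [Module ℚ R] {a b c d : R} (ha : IsNilpotent a) (hb : a * b = b * a + d)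
    (hd : a * d = d * a + c) (hc : a * c = c * a) :
    IsNilpotent.exp a * b = (b + d + (1 / 2 : ℂ) • c) * IsNilpotent.exp a := by
  obtain ⟨m, hm⟩ := ha
  have h1 : a ^ (m + 1) = 0 := by rw [pow_succ, hm, zero_mul]
  have h2 : a ^ (m + 1 + 1) = 0 := by rw [pow_succ, h1, zero_mul]
  have key : IsNilpotent.exp a * b = b * IsNilpotent.exp a + d * IsNilpotent.exp a +
      (1 / 2 : ℂ) • (c * IsNilpotent.exp a) := by
    -- Truncating the series at `m + 2`, `m + 1` and `m` terms leaves the common range `m` once the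
    -- initial terms are split off.
    conv_lhs => rw [exp_eq_complex_sum h2, Finset.sum_range_succ', Finset.sum_range_succ']
    conv_rhs =>
      enter [1, 1, 2]
      rw [exp_eq_complex_sum h2, Finset.sum_range_succ', Finset.sum_range_succ']
    conv_rhs =>
      enter [1, 2, 2]
      rw [exp_eq_complex_sum h1, Finset.sum_range_succ']
    conv_rhs =>
      enter [2, 2, 2]
      rw [exp_eq_complex_sum hm]
    simp only [add_mul, mul_add, Finset.sum_mul, Finset.mul_sum, smul_mul_assoc, mul_smul_comm,
      Finset.smul_sum, smul_smul]
    have e : ∀ i ∈ Finset.range m, (((i + 1 + 1)! : ℂ))⁻¹ • (a ^ (i + 1 + 1) * b) =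
        (((i + 1 + 1)! : ℂ))⁻¹ • (b * a ^ (i + 1 + 1)) + (((i + 1)! : ℂ))⁻¹ • (d * a ^ (i + 1)) +
          (1 / 2 * ((i ! : ℂ))⁻¹) • (c * a ^ i) := by
      intro i _
      rw [pow_mul_eq_of_commutator hb hd hc i, smul_add, smul_add, smul_smul, smul_smul]
      have f0 : ((i ! : ℕ) : ℂ) ≠ 0 := by exact_mod_cast i.factorial_ne_zero
      have f1 : (i : ℂ) + 1 ≠ 0 := by exact_mod_cast i.succ_ne_zero
      have f2 : (i : ℂ) + 2 ≠ 0 := by exact_mod_cast (i + 1).succ_ne_zero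
      have g1 : (((i + 1)! : ℕ) : ℂ) = (i + 1) * i ! := by rw [Nat.factorial_succ]; push_cast; ring
      have g2 : (((i + 1 + 1)! : ℕ) : ℂ) = (i + 2) * ((i + 1) * i !) := by
        rw [Nat.factorial_succ, Nat.cast_mul, g1]; push_cast; ring
      congr 2
      · congr 1
        rw [g1, g2]; field_simp
      · rw [g2]; field_simp
    rw [Finset.sum_congr rfl e]
    simp only [Finset.sum_add_distrib, zero_add, pow_zero, pow_one, one_mul, mul_one,
      Nat.factorial_zero, Nat.factorial_one, Nat.cast_one, inv_one, one_smul, hb]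
    abel
  rw [key, add_mul, add_mul, smul_mul_assoc]

end Exponential

/-! ### Canonical anticommutation relations and the grading involution. -/

section CAR

variable {n : ℕ}

theorem ι_mul_ι_anticomm {M : Type*} [AddCommGroup M] [Module ℂ M] (v w : M) :
    ExteriorAlgebra.ι ℂ v * ExteriorAlgebra.ι ℂ w =
      -(ExteriorAlgebra.ι ℂ w * ExteriorAlgebra.ι ℂ v) := by
  rw [eq_neg_iff_add_eq_zero, ExteriorAlgebra.ι_add_mul_swap]

theorem gen_mul_gen (i j : Fin (2 * n)) : (gen i * gen j : Gr n) = -(gen j * gen i) :=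
  ι_mul_ι_anticomm _ _

theorem gen_sq (i : Fin (2 * n)) : (gen i * gen i : Gr n) = 0 :=
  ExteriorAlgebra.ι_sq_zero _

theorem gen_mul_gen_mul (i j : Fin (2 * n)) (f : Gr n) :
    gen i * (gen j * f) = -(gen j * (gen i * f)) := by
  rw [← mul_assoc, gen_mul_gen, neg_mul, mul_assoc]

theorem gen_mul_gen_mul_self (i : Fin (2 * n)) (f : Gr n) : gen i * (gen i * f) = 0 := by
  rw [← mul_assoc, gen_sq, zero_mul]

theorem pderiv_gen_mul (i j : Fin (2 * n)) (f : Gr n) :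
    pderiv i (gen j * f) = (if i = j then f else 0) - gen j * pderiv i f := by
  have h := CliffordAlgebra.contractLeft_ι_mul (Q := (0 : QuadraticForm ℂ (Fin (2 * n) → ℂ)))
    (LinearMap.proj i : (Fin (2 * n) → ℂ) →ₗ[ℂ] ℂ) (Pi.single j 1) f
  refine h.trans ?_
  congr 1
  rw [LinearMap.proj_apply, Pi.single_apply]
  split_ifs <;> simp

theorem pderiv_one (i : Fin (2 * n)) : pderiv i (1 : Gr n) = 0 :=
  CliffordAlgebra.contractLeft_one (Q := (0 : QuadraticForm ℂ (Fin (2 * n) → ℂ))) _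

theorem pderiv_pderiv (i j : Fin (2 * n)) (f : Gr n) :
    pderiv i (pderiv j f) = -pderiv j (pderiv i f) :=
  CliffordAlgebra.contractLeft_comm (Q := (0 : QuadraticForm ℂ (Fin (2 * n) → ℂ))) _ _ _

theorem ι_eq_sum (v : Fin (2 * n) → ℂ) :
    ExteriorAlgebra.ι ℂ v = ∑ i, v i • (gen i : Gr n) := by
  conv_lhs => rw [pi_eq_sum_univ' v]
  simp only [map_sum, map_smul, gen]

/-- Induction along left multiplication with generators. -/
theorem gr_induction {p : Gr n → Prop} (one : p 1) (add : ∀ f g, p f → p g → p (f + g))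
    (smul : ∀ (c : ℂ) f, p f → p (c • f)) (gen_mul : ∀ i f, p f → p (gen i * f)) (f : Gr n) :
    p f := by
  induction f using CliffordAlgebra.left_induction with
  | algebraMap r => rw [Algebra.algebraMap_eq_smul_one]; exact smul _ _ one
  | add f g hf hg => exact add f g hf hg
  | ι_mul f v hf =>
    have h0 : p 0 := by simpa using smul 0 1 one
    have : CliffordAlgebra.ι (0 : QuadraticForm ℂ (Fin (2 * n) → ℂ)) v * f =
        ∑ i, v i • (gen i * f) := by
      change ExteriorAlgebra.ι ℂ v * f = _
      rw [ι_eq_sum, Finset.sum_mul]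
      simp only [smul_mul_assoc]
    rw [this]
    exact Finset.sum_induction _ p add h0 fun i _ => smul _ _ (gen_mul i f hf)

/-- The grading involution. -/
def parity (n : ℕ) : Module.End ℂ (Gr n) :=
  (CliffordAlgebra.involute (Q := (0 : QuadraticForm ℂ (Fin (2 * n) → ℂ)))).toLinearMap

theorem parity_one : parity n (1 : Gr n) = 1 :=
  map_one (CliffordAlgebra.involute (Q := (0 : QuadraticForm ℂ (Fin (2 * n) → ℂ))))

theorem parity_mul (f g : Gr n) : parity n (f * g) = parity n f * parity n g :=
  map_mul (CliffordAlgebra.involute (Q := (0 : QuadraticForm ℂ (Fin (2 * n) → ℂ)))) _ _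

theorem parity_gen (i : Fin (2 * n)) : parity n (gen i) = -gen i :=
  CliffordAlgebra.involute_ι _

theorem parity_gen_mul (i : Fin (2 * n)) (f : Gr n) :
    parity n (gen i * f) = -(gen i * parity n f) := by
  rw [parity_mul, parity_gen, neg_mul]

theorem parity_parity (f : Gr n) : parity n (parity n f) = f :=
  CliffordAlgebra.involute_involute _

theorem parity_pderiv (i : Fin (2 * n)) (f : Gr n) :
    parity n (pderiv i f) = -pderiv i (parity n f) := by
  induction f using gr_induction with
  | one => simp [pderiv_one, parity_one]
  | add f g hf hg => simp only [map_add, hf, hg, neg_add]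
  | smul c f hf => simp only [map_smul, hf, smul_neg]
  | gen_mul j f hf =>
    rw [pderiv_gen_mul, map_sub, parity_gen_mul, hf, parity_gen_mul, map_neg, pderiv_gen_mul]
    split_ifs <;> simp

theorem mul_gen (f : Gr n) (i : Fin (2 * n)) : f * gen i = gen i * parity n f := by
  induction f using gr_induction with
  | one => simp [parity_one]
  | add f g hf hg => simp only [map_add, add_mul, mul_add, hf, hg]
  | smul c f hf => simp only [map_smul, smul_mul_assoc, mul_smul_comm, hf]
  | gen_mul j f hf => rw [mul_assoc, hf, parity_gen_mul, mul_neg, gen_mul_gen_mul]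

end CAR

/-! ### Grouping the generators in pairs. -/

section Indices

variable {n : ℕ}

theorem fstIdx_inj {i j : Fin n} : fstIdx i = fstIdx j ↔ i = j := by
  simp only [fstIdx, Fin.ext_iff]; omega

theorem sndIdx_inj {i j : Fin n} : sndIdx i = sndIdx j ↔ i = j := by
  simp only [sndIdx, Fin.ext_iff]; omega

theorem fstIdx_ne_sndIdx (i j : Fin n) : fstIdx i ≠ sndIdx j := by
  simp only [fstIdx, sndIdx, ne_eq, Fin.ext_iff]; omega

theorem sndIdx_ne_fstIdx (i j : Fin n) : sndIdx i ≠ fstIdx j := (fstIdx_ne_sndIdx j i).symm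

theorem exists_fstIdx_or_sndIdx (i : Fin (2 * n)) : ∃ j, i = fstIdx j ∨ i = sndIdx j := by
  refine ⟨⟨i / 2, by omega⟩, ?_⟩
  simp only [fstIdx, sndIdx, Fin.ext_iff]; omega

theorem sum_fstIdx_add_sndIdx {M : Type*} [AddCommMonoid M] (f : Fin (2 * n) → M) :
    ∑ i, f i = ∑ j : Fin n, (f (fstIdx j) + f (sndIdx j)) := by
  let e : Fin n × Fin 2 ≃ Fin (2 * n) :=
    { toFun := fun p => ⟨2 * p.1 + p.2, by have := p.1.2; have := p.2.2; omega⟩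
      invFun := fun i => (⟨i / 2, by omega⟩, ⟨i % 2, by omega⟩)
      left_inv := fun p => by
        have := p.2.2
        ext <;> simp <;> omega
      right_inv := fun i => by ext; simp; omega }
  rw [← e.sum_comp, Fintype.sum_prod_type]
  refine Finset.sum_congr rfl fun j _ => ?_
  rw [Fin.sum_univ_two]
  rfl

end Indices

/-! ### Products of two vectors are central and nilpotent. -/

section EvenElements

variable {M : Type*} [AddCommGroup M] [Module ℂ M]

/-- Passing a vector through a product of two vectors changes the sign twice. -/
theorem ι_mul_ι_commute (v w : M) (f : ExteriorAlgebra ℂ M) :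
    Commute (ExteriorAlgebra.ι ℂ v * ExteriorAlgebra.ι ℂ w) f := by
  induction f using ExteriorAlgebra.induction with
  | algebraMap r => exact (Algebra.commutes r _).symm
  | ι u =>
    rw [commute_iff_eq, mul_assoc, ι_mul_ι_anticomm w u, mul_neg, ← mul_assoc,
      ι_mul_ι_anticomm v u, neg_mul, neg_neg, mul_assoc]
  | mul a b ha hb => exact ha.mul_right hb
  | add a b ha hb => exact ha.add_right hb

theorem ι_mul_ι_sq (v w : M) :
    (ExteriorAlgebra.ι ℂ v * ExteriorAlgebra.ι ℂ w) ^ 2 = 0 := by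
  rw [pow_two, mul_assoc, ← mul_assoc (ExteriorAlgebra.ι ℂ w), ι_mul_ι_anticomm w v, neg_mul,
    mul_neg, mul_assoc, ExteriorAlgebra.ι_sq_zero, mul_zero, mul_zero, neg_zero]

theorem ι_mul_ι_isNilpotent (v w : M) :
    IsNilpotent (ExteriorAlgebra.ι ℂ v * ExteriorAlgebra.ι ℂ w) := ⟨2, ι_mul_ι_sq v w⟩

end EvenElements

/-! ### The `sl₂` relations. -/

section SlTwo

variable {n : ℕ}

theorem gen_mul_gen_commute (i j : Fin (2 * n)) (f : Gr n) : Commute (gen i * gen j) f :=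
  ι_mul_ι_commute _ _ f

theorem thetaSq_commute (f : Gr n) : Commute (thetaSq n) f := by
  unfold thetaSq
  exact (Commute.sum_left _ _ _ fun j _ => gen_mul_gen_commute _ _ f).neg_left

theorem thetaSq_isNilpotent : IsNilpotent (thetaSq n) := by
  unfold thetaSq
  refine (Commute.isNilpotent_sum (fun j _ => ι_mul_ι_isNilpotent _ _) ?_).neg
  exact fun _ _ _ _ => gen_mul_gen_commute _ _ _

/-- Multiplication by `θ²`. -/
def thetaOp (n : ℕ) : Module.End ℂ (Gr n) := LinearMap.mulLeft ℂ (thetaSq n)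

/-- The weight operator `2 (E - n)`. -/
def weight (n : ℕ) : Module.End ℂ (Gr n) := (2 : ℂ) • (euler n - (n : ℂ) • 1)

theorem thetaOp_apply (f : Gr n) : thetaOp n f = thetaSq n * f := rfl

theorem thetaOp_apply_eq_sum (f : Gr n) :
    thetaOp n f = -∑ j : Fin n, gen (fstIdx j) * (gen (sndIdx j) * f) := by
  simp only [thetaOp_apply, thetaSq, neg_mul, Finset.sum_mul, mul_assoc]

theorem laplace_apply (f : Gr n) :
    laplace n f = (-4 : ℂ) • ∑ j : Fin n, pderiv (fstIdx j) (pderiv (sndIdx j) f) := by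
  simp [laplace]

theorem euler_apply (f : Gr n) : euler n f = ∑ i, gen i * pderiv i f := by
  simp [euler]

theorem weight_apply (f : Gr n) : weight n f = (2 : ℂ) • euler n f - (2 * n : ℂ) • f := by
  simp [weight, smul_sub, smul_smul]

theorem pderiv_fst_thetaSq_mul (j : Fin n) (f : Gr n) :
    pderiv (fstIdx j) (thetaSq n * f) = thetaSq n * pderiv (fstIdx j) f - gen (sndIdx j) * f := by
  simp only [← thetaOp_apply, thetaOp_apply_eq_sum, map_neg, map_sum, pderiv_gen_mul, mul_sub,
    fstIdx_inj, fstIdx_ne_sndIdx, if_false, Finset.sum_sub_distrib, mul_zero]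
  simp only [Finset.sum_ite_eq, Finset.mem_univ, if_true, Finset.sum_const_zero]
  abel

theorem pderiv_snd_thetaSq_mul (j : Fin n) (f : Gr n) :
    pderiv (sndIdx j) (thetaSq n * f) = thetaSq n * pderiv (sndIdx j) f + gen (fstIdx j) * f := by
  simp only [← thetaOp_apply, thetaOp_apply_eq_sum, map_neg, map_sum, pderiv_gen_mul, mul_sub,
    sndIdx_inj, sndIdx_ne_fstIdx, if_false, Finset.sum_sub_distrib]
  simp only [mul_ite, mul_zero, Finset.sum_ite_eq, Finset.mem_univ, if_true, Finset.sum_const_zero]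
  abel

/-- Each pair contributes the identity minus its share of `E`. The `n` pairs add up to `n - E`, and
the factor `-4` turns this into twice the weight. -/
theorem laplace_mul_thetaOp :
    laplace n * thetaOp n = thetaOp n * laplace n + (2 : ℂ) • weight n := by
  refine LinearMap.ext fun f => ?_
  have h : ∀ j : Fin n, pderiv (fstIdx j) (pderiv (sndIdx j) (thetaSq n * f)) =
      thetaSq n * pderiv (fstIdx j) (pderiv (sndIdx j) f) + f -
        (gen (fstIdx j) * pderiv (fstIdx j) f + gen (sndIdx j) * pderiv (sndIdx j) f) := by
    intro j
    rw [pderiv_snd_thetaSq_mul, map_add, pderiv_fst_thetaSq_mul, pderiv_gen_mul, if_pos rfl]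
    abel
  simp only [Module.End.mul_apply, LinearMap.add_apply, LinearMap.smul_apply, weight_apply,
    laplace_apply, thetaOp_apply, h, euler_apply, sum_fstIdx_add_sndIdx, Finset.sum_sub_distrib,
    Finset.sum_add_distrib, Finset.mul_sum, mul_smul_comm, Finset.sum_const, Finset.card_univ,
    Fintype.card_fin]
  rw [← Nat.cast_smul_eq_nsmul ℂ]
  module

theorem euler_gen_mul (j : Fin (2 * n)) (f : Gr n) :
    euler n (gen j * f) = gen j * euler n f + gen j * f := by
  simp only [euler_apply, pderiv_gen_mul, mul_sub, Finset.sum_sub_distrib, Finset.mul_sum]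
  simp only [mul_ite, mul_zero, Finset.sum_ite_eq', Finset.mem_univ, if_true]
  simp only [gen_mul_gen_mul _ j, Finset.sum_neg_distrib]
  abel

theorem euler_pderiv (j : Fin (2 * n)) (f : Gr n) :
    euler n (pderiv j f) = pderiv j (euler n f) - pderiv j f := by
  simp only [euler_apply, map_sum, pderiv_gen_mul, Finset.sum_sub_distrib]
  simp only [Finset.sum_ite_eq, Finset.mem_univ, if_true]
  simp only [pderiv_pderiv _ j, mul_neg, Finset.sum_neg_distrib]
  abel

theorem euler_mul_thetaOp : euler n * thetaOp n = thetaOp n * euler n + (2 : ℂ) • thetaOp n := by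
  refine LinearMap.ext fun f => ?_
  simp only [Module.End.mul_apply, LinearMap.add_apply, LinearMap.smul_apply,
    thetaOp_apply_eq_sum, map_neg, map_sum, euler_gen_mul, mul_add, Finset.sum_add_distrib]
  module

theorem euler_mul_laplace : euler n * laplace n = laplace n * euler n - (2 : ℂ) • laplace n := by
  refine LinearMap.ext fun f => ?_
  simp only [Module.End.mul_apply, LinearMap.sub_apply, LinearMap.smul_apply, laplace_apply,
    map_smul, map_sum, euler_pderiv, map_sub, Finset.sum_sub_distrib]
  module

theorem weight_mul_thetaOp :
    weight n * thetaOp n = thetaOp n * weight n + (4 : ℂ) • thetaOp n := by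
  simp only [weight, smul_mul_assoc, mul_smul_comm, sub_mul, mul_sub, euler_mul_thetaOp, one_mul,
    mul_one]
  module

theorem weight_mul_laplace :
    weight n * laplace n = laplace n * weight n - (4 : ℂ) • laplace n := by
  simp only [weight, smul_mul_assoc, mul_smul_comm, sub_mul, mul_sub, euler_mul_laplace, one_mul,
    mul_one]
  module

end SlTwo

/-! ### Action of generators and derivatives on monomials. -/

section Monomials

variable {n : ℕ}

theorem mono_eq_prod (A : Finset (Fin (2 * n))) : mono n A = ((A.sort).map gen).prod := by
  rw [mono, ExteriorAlgebra.basis_apply_ofCard _ rfl]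
  refine (ExteriorAlgebra.ιMulti_apply _).trans ?_
  rw [← Finset.listMap_orderEmbOfFin_finRange A rfl, List.map_map,
    List.ofFn_eq_map]
  congr 1
  refine List.map_congr_left fun i _ => ?_
  simp only [Function.comp_apply, gen, Pi.basisFun_apply]
  rfl

theorem mono_empty : mono n ∅ = 1 := by simp [mono_eq_prod]

theorem mono_insert_of_lt {a : Fin (2 * n)} {A : Finset (Fin (2 * n))} (h : ∀ x ∈ A, a < x) :
    mono n (insert a A) = gen a * mono n A := by
  rw [mono_eq_prod, mono_eq_prod, Finset.sort_insert _ (fun b hb => (h b hb).le)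
    (fun ha => lt_irrefl _ (h a ha)), List.map_cons, List.prod_cons]

theorem gen_mul_mono_of_notMem (i : Fin (2 * n)) (A : Finset (Fin (2 * n))) :
    i ∉ A → ∃ c : ℂ, (c = 1 ∨ c = -1) ∧ gen i * mono n A = c • mono n (insert i A) := by
  induction A using Finset.induction_on_min with
  | empty =>
    intro _
    exact ⟨1, Or.inl rfl, by rw [mono_insert_of_lt (by simp), one_smul]⟩
  | insert a A ha ih =>
    intro hi
    rw [Finset.mem_insert, not_or] at hi
    rcases lt_or_gt_of_ne hi.1 with hlt | hgt
    · refine ⟨1, Or.inl rfl, ?_⟩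
      rw [one_smul, mono_insert_of_lt (a := i)]
      intro x hx
      rcases Finset.mem_insert.1 hx with rfl | hx
      · exact hlt
      · exact hlt.trans (ha x hx)
    · obtain ⟨c, hc, h⟩ := ih hi.2
      refine ⟨-c, by rcases hc with rfl | rfl <;> simp, ?_⟩
      rw [mono_insert_of_lt ha, gen_mul_gen_mul, h, mul_smul_comm, Finset.insert_comm,
        mono_insert_of_lt (a := a), neg_smul]
      intro x hx
      rcases Finset.mem_insert.1 hx with rfl | hx
      · exact hgt
      · exact ha x hx

theorem pderiv_mono_of_notMem (i : Fin (2 * n)) (A : Finset (Fin (2 * n))) :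
    i ∉ A → pderiv i (mono n A) = 0 := by
  induction A using Finset.induction_on_min with
  | empty => intro _; rw [mono_empty, pderiv_one]
  | insert a A ha ih =>
    intro hi
    rw [Finset.mem_insert, not_or] at hi
    rw [mono_insert_of_lt ha, pderiv_gen_mul, if_neg hi.1, ih hi.2, mul_zero, sub_zero]

/-- Multiplication and differentiation add and remove a generator with the same sign. -/
theorem exists_sign_mono_insert {i : Fin (2 * n)} {A : Finset (Fin (2 * n))} (hi : i ∉ A) :
    ∃ c : ℂ, (c = 1 ∨ c = -1) ∧ gen i * mono n A = c • mono n (insert i A) ∧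
      pderiv i (mono n (insert i A)) = c • mono n A := by
  obtain ⟨c, hc, h⟩ := gen_mul_mono_of_notMem i A hi
  have hcc : c * c = 1 := by rcases hc with rfl | rfl <;> norm_num
  refine ⟨c, hc, h, ?_⟩
  have h' : mono n (insert i A) = c • (gen i * mono n A) := by rw [h, smul_smul, hcc, one_smul]
  rw [h', map_smul, pderiv_gen_mul, if_pos rfl, pderiv_mono_of_notMem i A hi, mul_zero, sub_zero]

theorem gen_mul_mono_of_mem {i : Fin (2 * n)} {A : Finset (Fin (2 * n))} (hi : i ∈ A) :
    gen i * mono n A = 0 := by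
  obtain ⟨c, hc, h, -⟩ := exists_sign_mono_insert (Finset.notMem_erase i A)
  rw [Finset.insert_erase hi] at h
  have h' : mono n A = c • (gen i * mono n (A.erase i)) := by
    rcases hc with rfl | rfl <;> simp [h]
  rw [h', mul_smul_comm, gen_mul_gen_mul_self, smul_zero]

theorem gen_mul_pderiv_mono (i : Fin (2 * n)) (A : Finset (Fin (2 * n))) :
    gen i * pderiv i (mono n A) = if i ∈ A then mono n A else 0 := by
  split_ifs with hi
  · obtain ⟨c, hc, h, h'⟩ := exists_sign_mono_insert (Finset.notMem_erase i A)
    rw [Finset.insert_erase hi] at h h'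
    rw [h', mul_smul_comm, h, smul_smul]
    rcases hc with rfl | rfl <;> simp
  · rw [pderiv_mono_of_notMem i A hi, mul_zero]

theorem euler_mono (A : Finset (Fin (2 * n))) : euler n (mono n A) = (A.card : ℂ) • mono n A := by
  rw [euler_apply]
  simp only [gen_mul_pderiv_mono, Finset.sum_ite_mem, Finset.univ_inter, Finset.sum_const]
  rw [← Nat.cast_smul_eq_nsmul ℂ]

theorem parity_mono (A : Finset (Fin (2 * n))) :
    parity n (mono n A) = (-1 : ℂ) ^ A.card • mono n A := by
  induction A using Finset.induction_on_min with
  | empty => simp [mono_empty, parity_one]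
  | insert a A ha ih =>
    rw [mono_insert_of_lt ha, parity_gen_mul, ih,
      Finset.card_insert_of_notMem (fun h => lt_irrefl _ (ha a h)), pow_succ]
    simp

/-- Linear maps out of the Grassmann algebra agree if they agree on monomials. -/
theorem linearMap_ext_mono {M : Type*} [AddCommMonoid M] [Module ℂ M] {S T : Gr n →ₗ[ℂ] M}
    (h : ∀ A, S (mono n A) = T (mono n A)) : S = T := (mono n).ext h

end Monomials

/-! ### The star map and its effect on the `sl₂` operators. -/

section Hodge

variable {n : ℕ}

/-- The last equation compares two factorizations of the top monomial: to pass from `A ∪ {i}` to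
`A`, the generator `i` must cross `x_A`, at the cost of `(-1)^|A|`. -/
theorem exists_sign_mono_insert_compl {i : Fin (2 * n)} {A : Finset (Fin (2 * n))} (hi : i ∉ A) :
    ∃ c c' : ℂ, c * c = 1 ∧ c' * c' = 1 ∧ gen i * mono n A = c • mono n (insert i A) ∧
      pderiv i (mono n (insert i A)) = c • mono n A ∧
      gen i * mono n (insert i A)ᶜ = c' • mono n Aᶜ ∧
      pderiv i (mono n Aᶜ) = c' • mono n (insert i A)ᶜ ∧
      c * complSign (insert i A) = (-1) ^ A.card * c' * complSign A := by
  obtain ⟨c, hc, h1, h2⟩ := exists_sign_mono_insert hi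
  have hi' : i ∉ (insert i A)ᶜ := by simp
  have hins : insert i (insert i A)ᶜ = Aᶜ := by
    ext x
    simp only [Finset.mem_insert, Finset.mem_compl, not_or]
    by_cases hx : x = i
    · simp [hx, hi]
    · simp [hx]
  obtain ⟨c', hc', h3, h4⟩ := exists_sign_mono_insert hi'
  rw [hins] at h3 h4
  refine ⟨c, c', by rcases hc with rfl | rfl <;> norm_num, by rcases hc' with rfl | rfl <;> norm_num,
    h1, h2, h3, h4, ?_⟩
  apply smul_left_injective ℂ ((mono n).ne_zero Finset.univ)
  simp only
  rw [mul_smul, ← (mono_mul_mono_compl (insert i A)).1, ← smul_mul_assoc, ← h1, mul_smul,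
    ← (mono_mul_mono_compl A).1, mul_smul, ← mul_smul_comm, ← h3, ← mul_assoc, mul_gen,
    parity_mono, mul_smul_comm, smul_mul_assoc, smul_smul, ← mul_pow]
  simp

theorem hodge_mono (A : Finset (Fin (2 * n))) :
    hodge n (mono n A) = ((2 : ℂ) ^ ((A.card : ℤ) - n) * complSign A) • mono n Aᶜ :=
  Module.Basis.constr_basis _ _ _ _

theorem two_zpow_card_insert {i : Fin (2 * n)} {A : Finset (Fin (2 * n))} (hi : i ∉ A) :
    (2 : ℂ) ^ (((insert i A).card : ℤ) - n) = 2 * 2 ^ ((A.card : ℤ) - n) := by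
  rw [Finset.card_insert_of_notMem hi, Nat.cast_succ, add_sub_right_comm,
    zpow_add_one₀ (two_ne_zero), mul_comm]

/-- Adding `i` to `A` removes it from the complement, so the star exchanges multiplication and
differentiation. The `2` is the ratio of the factors `2^{|A| - n}`; `parity` absorbs the sign of
crossing `x_A`. -/
theorem hodge_gen_mul (i : Fin (2 * n)) (f : Gr n) :
    hodge n (gen i * f) = (2 : ℂ) • pderiv i (hodge n (parity n f)) := by
  have : hodge n ∘ₗ LinearMap.mulLeft ℂ (gen i) =
      (2 : ℂ) • (pderiv i ∘ₗ hodge n ∘ₗ parity n) := by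
    refine linearMap_ext_mono fun A => ?_
    simp only [LinearMap.comp_apply, LinearMap.smul_apply, LinearMap.mulLeft_apply, parity_mono,
      map_smul, hodge_mono]
    by_cases hi : i ∈ A
    · rw [gen_mul_mono_of_mem hi, map_zero, pderiv_mono_of_notMem _ _ (by simpa using hi)]
      simp
    · obtain ⟨c, c', hc, hc', h1, h2, h3, h4, h5⟩ := exists_sign_mono_insert_compl hi
      rw [h1, h4, map_smul, hodge_mono, two_zpow_card_insert hi]
      simp only [smul_smul]
      congr 1
      linear_combination (2 * 2 ^ ((A.card : ℤ) - n)) * h5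
  exact LinearMap.congr_fun this f

theorem hodge_pderiv (i : Fin (2 * n)) (f : Gr n) :
    hodge n (pderiv i f) = (-1 / 2 : ℂ) • (gen i * hodge n (parity n f)) := by
  have : hodge n ∘ₗ pderiv i =
      (-1 / 2 : ℂ) • (LinearMap.mulLeft ℂ (gen i) ∘ₗ hodge n ∘ₗ parity n) := by
    refine linearMap_ext_mono fun A => ?_
    simp only [LinearMap.comp_apply, LinearMap.smul_apply, LinearMap.mulLeft_apply, parity_mono,
      map_smul, hodge_mono]
    by_cases hi : i ∈ A
    · obtain ⟨c, c', hc, hc', h1, h2, h3, h4, h5⟩ :=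
        exists_sign_mono_insert_compl (Finset.notMem_erase i A)
      have h6 := two_zpow_card_insert (Finset.notMem_erase i A)
      have h7 := Finset.card_insert_of_notMem (Finset.notMem_erase i A)
      rw [Finset.insert_erase hi] at h1 h2 h3 h4 h5 h6 h7
      rw [h2, h3, map_smul, hodge_mono, h6, h7]
      simp only [smul_smul]
      congr 1
      have h8 : ((-1 : ℂ) ^ (A.erase i).card) * (-1) ^ (A.erase i).card = 1 := by
        rw [← mul_pow]; simp
      rw [pow_succ]
      linear_combination (-(-1 : ℂ) ^ (A.erase i).card * c * c' * 2 ^ (((A.erase i).card : ℤ) - n))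
        * h5 + ((-1 : ℂ) ^ (A.erase i).card * c' * 2 ^ (((A.erase i).card : ℤ) - n) *
          complSign A) * hc - (c * c' ^ 2 * 2 ^ (((A.erase i).card : ℤ) - n) *
          complSign (A.erase i)) * h8 - (c * 2 ^ (((A.erase i).card : ℤ) - n) *
          complSign (A.erase i)) * hc'
    · rw [gen_mul_mono_of_mem (A := Aᶜ) (by simpa using hi), pderiv_mono_of_notMem _ _ hi]
      simp
  exact LinearMap.congr_fun this f

/-- Two generators become two derivatives, and `2 · 2` matches the `4` in the Laplacian. With
`hodge_mul_laplace` and `hodge_mul_weight`, conjugation by the star exchanges `θ²` with `-∇²` and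
negates the weight. -/
theorem hodge_mul_thetaOp : hodge n * thetaOp n = -(laplace n * hodge n) := by
  refine LinearMap.ext fun f => ?_
  simp only [Module.End.mul_apply, LinearMap.neg_apply, thetaOp_apply_eq_sum, laplace_apply,
    map_neg, map_sum, hodge_gen_mul, parity_gen_mul, parity_parity, map_smul, Finset.smul_sum]
  congr 1
  refine Finset.sum_congr rfl fun j _ => ?_
  rw [smul_neg]
  module

theorem hodge_mul_laplace : hodge n * laplace n = -(thetaOp n * hodge n) := by
  refine LinearMap.ext fun f => ?_
  simp only [Module.End.mul_apply, LinearMap.neg_apply, thetaOp_apply_eq_sum, laplace_apply,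
    map_neg, map_sum, hodge_pderiv, parity_pderiv, parity_parity, map_smul, Finset.smul_sum,
    smul_smul, neg_neg]
  refine Finset.sum_congr rfl fun j _ => ?_
  rw [mul_neg, mul_smul_comm, smul_neg, smul_smul, ← neg_smul]
  norm_num

/-- The degrees of a monomial and of its complement add up to `2n`. -/
theorem hodge_mul_euler : hodge n * euler n = (2 * n : ℂ) • hodge n - euler n * hodge n := by
  refine linearMap_ext_mono fun A => ?_
  simp only [Module.End.mul_apply, LinearMap.sub_apply, LinearMap.smul_apply, euler_mono,
    hodge_mono, map_smul, smul_smul, ← sub_smul]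
  have h : A.card + Aᶜ.card = 2 * n := by simp
  have h' : (A.card : ℂ) + Aᶜ.card = 2 * n := by exact_mod_cast h
  congr 1
  linear_combination 2 ^ ((A.card : ℤ) - n) * complSign A * h'

theorem hodge_mul_weight : hodge n * weight n = -(weight n * hodge n) := by
  simp only [weight, mul_smul_comm, smul_mul_assoc, mul_sub, sub_mul, hodge_mul_euler, one_mul,
    mul_one]
  module

end Hodge

/-! ### The bilinear form, its adjoints and isometries. -/

section Form

variable {n : ℕ}

/-- The Berezin integral as a linear form. -/
def berezinLin (n : ℕ) : Gr n →ₗ[ℂ] ℂ :=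
  ((Real.pi : ℂ) ^ n)⁻¹ • (ExteriorAlgebra.algebraMapInv.toLinearMap ∘ₗ
    (List.ofFn (fun i : Fin (2 * n) => pderiv i)).reverse.prod)

theorem berezinLin_apply (f : Gr n) : berezinLin n f = berezin f := rfl

theorem pderiv_prod_gen_of_notMem (i : Fin (2 * n)) (l : List (Fin (2 * n))) (h : i ∉ l) :
    pderiv i ((l.map gen).prod : Gr n) = 0 := by
  induction l with
  | nil => exact pderiv_one i
  | cons a l ih =>
    rw [List.mem_cons, not_or] at h
    rw [List.map_cons, List.prod_cons, pderiv_gen_mul, if_neg h.1, ih h.2, mul_zero, sub_zero]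

theorem prod_pderiv_prod_gen (l : List (Fin (2 * n))) (h : l.Nodup) :
    (l.map fun i => pderiv i).reverse.prod ((l.map gen).prod : Gr n) = 1 := by
  induction l with
  | nil => rfl
  | cons a l ih =>
    rw [List.nodup_cons] at h
    rw [List.map_cons, List.map_cons, List.reverse_cons, List.prod_append, List.prod_singleton,
      Module.End.mul_apply, List.prod_cons, pderiv_gen_mul, if_pos rfl,
      pderiv_prod_gen_of_notMem a l h.1, mul_zero, sub_zero, ih h.2]

theorem prod_pderiv_mono_of_notMem (l : List (Fin (2 * n))) (A : Finset (Fin (2 * n)))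
    {i : Fin (2 * n)} (hi : i ∈ l) (hA : i ∉ A) :
    (l.map fun i => pderiv i).reverse.prod (mono n A) = 0 := by
  induction l generalizing A with
  | nil => simp at hi
  | cons a l ih =>
    rw [List.map_cons, List.reverse_cons, List.prod_append, List.prod_singleton,
      Module.End.mul_apply]
    by_cases ha : a ∈ A
    · obtain ⟨c, -, -, h⟩ := exists_sign_mono_insert (Finset.notMem_erase a A)
      rw [Finset.insert_erase ha] at h
      rw [h, map_smul, ih (A.erase a), smul_zero]
      · rcases List.mem_cons.1 hi with rfl | hi
        · exact absurd ha hA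
        · exact hi
      · exact fun h => hA (Finset.mem_of_mem_erase h)
    · rw [pderiv_mono_of_notMem a A ha, map_zero]

theorem berezin_mono (A : Finset (Fin (2 * n))) :
    berezin (mono n A) = if A = Finset.univ then ((Real.pi : ℂ) ^ n)⁻¹ else 0 := by
  rw [berezin, List.ofFn_eq_map]
  split_ifs with h
  · rw [h, mono_eq_prod, Fin.sort_univ, prod_pderiv_prod_gen _ (List.nodup_finRange _), map_one,
      mul_one]
  · obtain ⟨i, hi⟩ : ∃ i, i ∉ A := by
      by_contra hc
      exact h (Finset.eq_univ_iff_forall.2 (by simpa using hc))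
    rw [prod_pderiv_mono_of_notMem _ A (List.mem_finRange i) hi, map_zero, mul_zero]

/-- The bilinear form `∫_B f (* g)`. -/
def form (n : ℕ) : Gr n →ₗ[ℂ] Gr n →ₗ[ℂ] ℂ :=
  ((LinearMap.mul ℂ (Gr n)).compl₂ (hodge n)).compr₂ (berezinLin n)

theorem form_apply (f g : Gr n) : form n f g = berezin (f * hodge n g) := rfl

theorem ip_eq_form (f g : Gr n) : ip f g = form n f (conj g) := rfl

/-- The squared norm of the monomial `x_A`. -/
def monoNorm (n : ℕ) (A : Finset (Fin (2 * n))) : ℝ :=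
  (Real.pi ^ n)⁻¹ * 2 ^ ((A.card : ℤ) - n)

theorem monoNorm_pos (A : Finset (Fin (2 * n))) : 0 < monoNorm n A := by
  unfold monoNorm
  have := Real.pi_pos
  positivity

theorem mono_mul_mono_of_mem {i : Fin (2 * n)} {A B : Finset (Fin (2 * n))} (hA : i ∈ A)
    (hB : i ∈ B) : mono n A * mono n B = 0 := by
  obtain ⟨c, hc, h1, -⟩ := exists_sign_mono_insert (Finset.notMem_erase i A)
  rw [Finset.insert_erase hA] at h1
  have h : mono n A = c • (gen i * mono n (A.erase i)) := by
    rcases hc with rfl | rfl <;> simp [h1]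
  have h2 : gen i * mono n (A.erase i) =
      (-1 : ℂ) ^ (A.erase i).card • (mono n (A.erase i) * gen i) := by
    rw [mul_gen, parity_mono, mul_smul_comm, smul_smul, ← mul_pow]
    simp
  rw [h, h2, smul_mul_assoc, smul_mul_assoc, mul_assoc, gen_mul_mono_of_mem hB]
  simp

/-- If `A ≠ B`, either `A` has an element outside `B`, so that `x_A` and `x_{Bᶜ}` share a generator,
or `A` is a proper subset of `B`, and then a generator is missing from `x_A x_{Bᶜ}` and the Berezin
integral vanishes. -/
theorem form_mono_mono (A B : Finset (Fin (2 * n))) :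
    form n (mono n A) (mono n B) = if A = B then (monoNorm n A : ℂ) else 0 := by
  split_ifs with h
  · subst h
    rw [form_apply, mono_mul_hodge, ← berezinLin_apply, map_smul, berezinLin_apply, berezin_mono,
      if_pos rfl, monoNorm, smul_eq_mul, mul_comm]
    push_cast
    rfl
  · rw [form_apply, hodge_mono, mul_smul_comm, ← berezinLin_apply, map_smul, berezinLin_apply]
    by_cases hAB : A ⊆ B
    · obtain ⟨i, hiB, hiA⟩ := Finset.exists_of_ssubset (lt_of_le_of_ne hAB h)
      have hr : ∀ C : Finset (Fin (2 * n)), i ∉ C → berezin (mono n A * mono n C) = 0 := by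
        intro C hC
        by_cases hd : Disjoint A C
        · have h2 : mono n A * mono n C = ((mono n).repr (mono n A * mono n C) (A ∪ C)) •
              mono n (A ∪ C) := by
            have hb := ExteriorAlgebra.basis_mul_of_disjoint (Pi.basisFun ℂ (Fin (2 * n)))
              (Set.powersetCard.ofCard (s := A) rfl) (Set.powersetCard.ofCard (s := C) rfl) hd
            have hu : ((Set.powersetCard.disjUnion (s := Set.powersetCard.ofCard (s := A) rfl)
                (t := Set.powersetCard.ofCard (s := C) rfl) hd : Set.powersetCard _ _) :
                Finset (Fin (2 * n))) = A ∪ C := by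
              simp [Set.powersetCard.disjUnion, Set.powersetCard.ofCard]
            rw [hu] at hb
            change mono n A * mono n C = _ • mono n (A ∪ C) at hb
            obtain ⟨u, hu'⟩ : ∃ u : ℤˣ, mono n A * mono n C = u • mono n (A ∪ C) := ⟨_, hb⟩
            rw [hu']
            rcases Int.units_eq_one_or u with rfl | rfl <;> simp [Units.smul_def]
          rw [h2, ← berezinLin_apply, map_smul, berezinLin_apply, berezin_mono, if_neg, smul_zero]
          intro hu
          have := Finset.mem_univ i
          rw [← hu, Finset.mem_union] at this
          tauto
        · obtain ⟨x, hxA, hxC⟩ := Finset.not_disjoint_iff.1 hd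
          rw [mono_mul_mono_of_mem hxA hxC, ← berezinLin_apply, map_zero]
      rw [hr Bᶜ (by simpa using hiB), smul_zero]
    · obtain ⟨i, hiA, hiB⟩ := Finset.not_subset.1 hAB
      rw [mono_mul_mono_of_mem hiA (by simpa using hiB : i ∈ Bᶜ), ← berezinLin_apply, map_zero,
        smul_zero]

theorem form_mono_left (A : Finset (Fin (2 * n))) (f : Gr n) :
    form n (mono n A) f = monoNorm n A * (mono n).repr f A := by
  conv_lhs => rw [← (mono n).sum_repr f]
  simp only [map_sum, map_smul, form_mono_mono, smul_eq_mul, mul_ite, mul_zero, Finset.sum_ite_eq,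
    Finset.mem_univ, if_true]
  ring

theorem form_eq_sum (f g : Gr n) :
    form n f g = ∑ A, monoNorm n A * ((mono n).repr f A * (mono n).repr g A) := by
  conv_lhs => rw [← (mono n).sum_repr f]
  simp only [map_sum, map_smul, LinearMap.sum_apply, LinearMap.smul_apply, form_mono_left,
    smul_eq_mul]
  exact Finset.sum_congr rfl fun A _ => by ring

theorem form_comm (f g : Gr n) : form n f g = form n g f := by
  rw [form_eq_sum, form_eq_sum]
  exact Finset.sum_congr rfl fun A _ => by ring

/-- On monomials, inserting and removing `i` have the same sign, and the two norms differ by the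
factor `2`. -/
theorem form_gen_mul (i : Fin (2 * n)) (f g : Gr n) :
    form n (gen i * f) g = 2 * form n f (pderiv i g) := by
  have : form n ∘ₗ LinearMap.mulLeft ℂ (gen i) = (2 : ℂ) • (form n).compl₂ (pderiv i) := by
    refine (mono n).ext fun A => (mono n).ext fun B => ?_
    simp only [LinearMap.comp_apply, LinearMap.mulLeft_apply, LinearMap.smul_apply,
      LinearMap.compl₂_apply, smul_eq_mul]
    by_cases hiA : i ∈ A
    · rw [gen_mul_mono_of_mem hiA, map_zero, LinearMap.zero_apply]
      by_cases hiB : i ∈ B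
      · obtain ⟨c, -, -, h⟩ := exists_sign_mono_insert (Finset.notMem_erase i B)
        rw [Finset.insert_erase hiB] at h
        rw [h, map_smul, form_mono_mono, if_neg, smul_zero, mul_zero]
        rintro rfl
        exact Finset.notMem_erase i B hiA
      · rw [pderiv_mono_of_notMem i B hiB, map_zero, mul_zero]
    · obtain ⟨c, -, h, h'⟩ := exists_sign_mono_insert hiA
      rw [h, map_smul, LinearMap.smul_apply, form_mono_mono]
      split_ifs with hB
      · rw [← hB, h', map_smul, form_mono_mono, if_pos rfl, monoNorm, monoNorm]
        push_cast
        rw [two_zpow_card_insert hiA, smul_eq_mul, smul_eq_mul]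
        ring
      · by_cases hiB : i ∈ B
        · obtain ⟨c, -, -, h⟩ := exists_sign_mono_insert (Finset.notMem_erase i B)
          rw [Finset.insert_erase hiB] at h
          rw [h, map_smul, form_mono_mono, if_neg, smul_zero, smul_zero, mul_zero]
          rintro rfl
          exact hB (Finset.insert_erase hiB)
        · rw [pderiv_mono_of_notMem i B hiB, map_zero, mul_zero, smul_zero]
  exact LinearMap.congr_fun (LinearMap.congr_fun this f) g

theorem form_pderiv (i : Fin (2 * n)) (f g : Gr n) :
    form n (pderiv i f) g = 1 / 2 * form n f (gen i * g) := by
  rw [form_comm f, form_gen_mul, form_comm]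
  ring

/-- Adjunction reverses the order of the two derivatives in each pair; restoring it costs the sign.
-/
theorem form_thetaOp (f g : Gr n) : form n (thetaOp n f) g = -form n f (laplace n g) := by
  simp only [thetaOp_apply_eq_sum, laplace_apply, map_neg, map_sum, LinearMap.neg_apply,
    LinearMap.sum_apply, form_gen_mul, map_smul, smul_eq_mul, Finset.mul_sum]
  congr 1
  refine Finset.sum_congr rfl fun j _ => ?_
  rw [pderiv_pderiv, map_neg]
  ring

theorem form_laplace (f g : Gr n) : form n (laplace n f) g = -form n f (thetaOp n g) := by
  rw [form_comm f, form_thetaOp, form_comm, neg_neg]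

theorem form_euler (f g : Gr n) : form n (euler n f) g = form n f (euler n g) := by
  simp only [euler_apply, map_sum, LinearMap.sum_apply, form_gen_mul]
  refine Finset.sum_congr rfl fun j _ => ?_
  rw [form_pderiv]
  ring

theorem form_weight (f g : Gr n) : form n (weight n f) g = form n f (weight n g) := by
  simp only [weight_apply, map_sub, map_smul, LinearMap.sub_apply, LinearMap.smul_apply,
    form_euler]

/-- The square of `2^{|A| - n}` turns the norm of `x_{Aᶜ}` into that of `x_A`. -/
theorem form_hodge (f g : Gr n) : form n (hodge n f) (hodge n g) = form n f g := by
  have : (form n).compl₁₂ (hodge n) (hodge n) = form n := by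
    refine (mono n).ext fun A => (mono n).ext fun B => ?_
    rw [LinearMap.compl₁₂_apply, hodge_mono, hodge_mono, map_smul, map_smul, LinearMap.smul_apply,
      form_mono_mono, form_mono_mono]
    by_cases h : A = B
    · subst h
      rw [if_pos rfl, if_pos rfl]
      have h1 : complSign A * complSign A = 1 := by
        rcases (mono_mul_mono_compl A).2 with h | h <;> rw [h] <;> norm_num
      have h2 : A.card + Aᶜ.card = 2 * n := by simp
      have h3 : (2 : ℂ) ^ ((Aᶜ.card : ℤ) - n) * 2 ^ ((A.card : ℤ) - n) = 1 := by
        rw [← zpow_add₀ two_ne_zero,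
          show (Aᶜ.card : ℤ) - n + ((A.card : ℤ) - n) = 0 by omega, zpow_zero]
      simp only [monoNorm, smul_eq_mul]
      push_cast
      generalize (2 : ℂ) ^ ((A.card : ℤ) - n) = p at *
      generalize (2 : ℂ) ^ ((Aᶜ.card : ℤ) - n) = q at *
      generalize ((Real.pi : ℂ) ^ n)⁻¹ = r
      linear_combination (p * r * complSign A * complSign A) * h3 + p * r * h1
    · rw [if_neg h, if_neg (fun h' => h (compl_injective h'))]
      simp
  exact LinearMap.congr_fun (LinearMap.congr_fun this f) g

theorem form_right_injective {f : Gr n} (h : ∀ g, form n g f = 0) : f = 0 := by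
  refine (mono n).ext_elem fun A => ?_
  have := h (mono n A)
  rw [form_mono_left] at this
  have hA : (monoNorm n A : ℂ) ≠ 0 := by exact_mod_cast (monoNorm_pos A).ne'
  simpa [hA] using this

theorem hodge_injective : Function.Injective (hodge n) := by
  rw [← LinearMap.ker_eq_bot, LinearMap.ker_eq_bot']
  intro f hf
  refine form_right_injective fun g => ?_
  rw [← form_hodge, hf, map_zero]

end Form

/-! ### Complex conjugation and positivity. -/

section Conj

variable {n : ℕ}

theorem repr_conj (f : Gr n) (A : Finset (Fin (2 * n))) :
    (mono n).repr (conj f) A = (starRingEnd ℂ) ((mono n).repr f A) := by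
  simp only [conj, map_sum, map_smul, Finsupp.coe_finsetSum, Finset.sum_apply, Finsupp.smul_apply,
    Module.Basis.repr_self, smul_eq_mul, Finsupp.single_apply, mul_ite, mul_one, mul_zero,
    Finset.sum_ite_eq', Finset.mem_univ, if_true]

theorem conj_add (f g : Gr n) : conj (f + g) = conj f + conj g :=
  (mono n).ext_elem fun A => by simp [repr_conj]

theorem conj_smul (c : ℂ) (f : Gr n) : conj (c • f) = (starRingEnd ℂ) c • conj f :=
  (mono n).ext_elem fun A => by simp [repr_conj]

theorem conj_mono (A : Finset (Fin (2 * n))) : conj (mono n A) = mono n A :=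
  (mono n).ext_elem fun B => by
    rw [repr_conj, Module.Basis.repr_self, Finsupp.single_apply]; split_ifs <;> simp

/-- Complex conjugation as a semilinear map. -/
def conjLin (n : ℕ) : Gr n →ₛₗ[starRingEnd ℂ] Gr n where
  toFun := conj
  map_add' := conj_add
  map_smul' := conj_smul

theorem conjLin_apply (f : Gr n) : conjLin n f = conj f := rfl

theorem conj_gen_mul (i : Fin (2 * n)) (f : Gr n) : conj (gen i * f) = gen i * conj f := by
  have : (conjLin n).comp (LinearMap.mulLeft ℂ (gen i)) =
      (LinearMap.mulLeft ℂ (gen i)).comp (conjLin n) := by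
    refine (mono n).ext fun A => ?_
    simp only [LinearMap.comp_apply, LinearMap.mulLeft_apply, conjLin_apply, conj_mono]
    by_cases hi : i ∈ A
    · rw [gen_mul_mono_of_mem hi, ← conjLin_apply, map_zero]
    · obtain ⟨c, hc, h, -⟩ := exists_sign_mono_insert hi
      rw [h, conj_smul, conj_mono]
      rcases hc with rfl | rfl <;> simp
  exact LinearMap.congr_fun this f

theorem conj_pderiv (i : Fin (2 * n)) (f : Gr n) : conj (pderiv i f) = pderiv i (conj f) := by
  have : (conjLin n).comp (pderiv i) = (pderiv i).comp (conjLin n) := by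
    refine (mono n).ext fun A => ?_
    simp only [LinearMap.comp_apply, conjLin_apply, conj_mono]
    by_cases hi : i ∈ A
    · obtain ⟨c, hc, -, h⟩ := exists_sign_mono_insert (Finset.notMem_erase i A)
      rw [Finset.insert_erase hi] at h
      rw [h, conj_smul, conj_mono]
      rcases hc with rfl | rfl <;> simp
    · rw [pderiv_mono_of_notMem i A hi, ← conjLin_apply, map_zero]
  exact LinearMap.congr_fun this f

theorem conj_thetaOp (f : Gr n) : conj (thetaOp n f) = thetaOp n (conj f) := by
  simp only [thetaOp_apply_eq_sum, ← conjLin_apply, map_neg, map_sum]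
  simp only [conjLin_apply, conj_gen_mul]

theorem conj_laplace (f : Gr n) : conj (laplace n f) = laplace n (conj f) := by
  simp only [laplace_apply, ← conjLin_apply, map_smulₛₗ, map_sum]
  simp only [conjLin_apply, conj_pderiv]
  simp [map_ofNat]

theorem conj_weight (f : Gr n) : conj (weight n f) = weight n (conj f) := by
  simp only [weight_apply, euler_apply, ← conjLin_apply, map_smulₛₗ, map_sum, map_sub]
  simp only [conjLin_apply, conj_gen_mul, conj_pderiv]
  simp [map_ofNat]

/-- Conjugating the second argument yields a positive definite Hermitian form, on which the Fischer
decomposition depends. -/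
theorem form_conj_self (f : Gr n) :
    form n f (conj f) = ((∑ A, monoNorm n A * ‖(mono n).repr f A‖ ^ 2 : ℝ) : ℂ) := by
  rw [form_eq_sum]
  push_cast
  refine Finset.sum_congr rfl fun A _ => ?_
  rw [repr_conj, Complex.mul_conj']

theorem form_conj_self_re_nonneg (f : Gr n) : 0 ≤ (form n f (conj f)).re := by
  rw [form_conj_self, Complex.ofReal_re]
  exact Finset.sum_nonneg fun A _ => mul_nonneg (monoNorm_pos A).le (sq_nonneg _)

theorem eq_zero_of_form_conj_self_re_nonpos {f : Gr n} (h : (form n f (conj f)).re ≤ 0) :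
    f = 0 := by
  have h0 := le_antisymm h (form_conj_self_re_nonneg f)
  rw [form_conj_self, Complex.ofReal_re, Finset.sum_eq_zero_iff_of_nonneg
    (fun A _ => mul_nonneg (monoNorm_pos A).le (sq_nonneg _))] at h0
  refine (mono n).ext_elem fun A => ?_
  have := h0 A (Finset.mem_univ A)
  simpa [(monoNorm_pos A).ne'] using this

end Conj

/-! ### The anti-automorphism `tilde`. -/

section Tilde

variable {n : ℕ}

theorem tilde_one : tilde n 1 = 1 := by
  simp [tilde]

theorem tilde_fst_mul (j : Fin n) (f : Gr n) :
    tilde n (gen (fstIdx j) * f) = gen (sndIdx j) * parity n (tilde n f) := by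
  rw [tilde_mul, (tilde_gen j).1, mul_gen]

theorem tilde_snd_mul (j : Fin n) (f : Gr n) :
    tilde n (gen (sndIdx j) * f) = -(gen (fstIdx j) * parity n (tilde n f)) := by
  rw [tilde_mul, (tilde_gen j).2, mul_neg, mul_gen]

theorem gr_induction_pairs {p : Gr n → Prop} (one : p 1) (add : ∀ f g, p f → p g → p (f + g))
    (smul : ∀ (c : ℂ) f, p f → p (c • f)) (fst_mul : ∀ j f, p f → p (gen (fstIdx j) * f))
    (snd_mul : ∀ j f, p f → p (gen (sndIdx j) * f)) (f : Gr n) : p f := by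
  refine gr_induction one add smul (fun i f hf => ?_) f
  obtain ⟨j, rfl | rfl⟩ := exists_fstIdx_or_sndIdx i
  · exact fst_mul j f hf
  · exact snd_mul j f hf

theorem tilde_parity (f : Gr n) : tilde n (parity n f) = parity n (tilde n f) := by
  induction f using gr_induction_pairs with
  | one => simp only [parity_one, tilde_one]
  | add f g hf hg => simp only [map_add, hf, hg]
  | smul c f hf => simp only [map_smul, hf]
  | fst_mul j f hf => rw [parity_gen_mul, map_neg, tilde_fst_mul, hf, tilde_fst_mul, parity_gen_mul]
  | snd_mul j f hf =>
    rw [parity_gen_mul, map_neg, tilde_snd_mul, hf, tilde_snd_mul, map_neg, parity_gen_mul]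

theorem tilde_tilde (f : Gr n) : tilde n (tilde n f) = parity n f := by
  induction f using gr_induction_pairs with
  | one => simp only [parity_one, tilde_one]
  | add f g hf hg => simp only [map_add, hf, hg]
  | smul c f hf => simp only [map_smul, hf]
  | fst_mul j f hf =>
    rw [tilde_fst_mul, tilde_snd_mul, tilde_parity, parity_parity, hf, parity_gen_mul]
  | snd_mul j f hf =>
    rw [tilde_snd_mul, map_neg, tilde_fst_mul, tilde_parity, parity_parity, hf, parity_gen_mul]

theorem tilde_pderiv (j : Fin n) (f : Gr n) :
    tilde n (pderiv (fstIdx j) f) = -pderiv (sndIdx j) (parity n (tilde n f)) ∧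
      tilde n (pderiv (sndIdx j) f) = pderiv (fstIdx j) (parity n (tilde n f)) := by
  induction f using gr_induction_pairs with
  | one => simp only [parity_one, tilde_one, pderiv_one, map_zero, neg_zero, and_self]
  | add f g hf hg => simp only [map_add, hf, hg, neg_add, and_self]
  | smul c f hf => simp only [map_smul, hf, smul_neg, and_self]
  | fst_mul k f hf =>
    simp only [pderiv_gen_mul, map_sub, tilde_fst_mul, hf, parity_gen_mul, parity_parity, map_neg,
      parity_pderiv, fstIdx_inj, sndIdx_inj, fstIdx_ne_sndIdx, sndIdx_ne_fstIdx, if_false,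
      neg_sub, neg_neg, zero_sub, mul_neg, and_true]
    split_ifs <;> simp
  | snd_mul k f hf =>
    simp only [pderiv_gen_mul, map_sub, tilde_snd_mul, hf, parity_gen_mul, parity_parity, map_neg,
      parity_pderiv, fstIdx_inj, sndIdx_inj, fstIdx_ne_sndIdx, sndIdx_ne_fstIdx, if_false,
      neg_neg, zero_sub, mul_neg, true_and]
    split_ifs <;> simp

/-- Reversing a pair and replacing `x_{2j-1}, x_{2j}` by `x_{2j}, -x_{2j-1}` turns `x_{2j-1} x_{2j}`
into its negative. -/
theorem tilde_mul_thetaOp : tilde n * thetaOp n = -(thetaOp n * tilde n) := by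
  refine LinearMap.ext fun f => ?_
  simp only [Module.End.mul_apply, LinearMap.neg_apply, thetaOp_apply_eq_sum, map_neg, map_sum,
    tilde_fst_mul, tilde_snd_mul, parity_gen_mul, parity_parity, neg_neg]
  rw [← Finset.sum_neg_distrib]
  exact Finset.sum_congr rfl fun j _ => (gen_mul_gen_mul _ _ _).symm

theorem tilde_mul_laplace : tilde n * laplace n = -(laplace n * tilde n) := by
  refine LinearMap.ext fun f => ?_
  simp only [Module.End.mul_apply, LinearMap.neg_apply, laplace_apply, map_smul, map_sum,
    (tilde_pderiv _ _).1, (tilde_pderiv _ _).2, parity_pderiv, parity_parity, map_neg, neg_neg]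
  rw [← smul_neg, ← Finset.sum_neg_distrib]
  congr 1
  exact Finset.sum_congr rfl fun j _ => pderiv_pderiv _ _ _

theorem tilde_mul_euler : tilde n * euler n = euler n * tilde n := by
  refine LinearMap.ext fun f => ?_
  simp only [Module.End.mul_apply, euler_apply, sum_fstIdx_add_sndIdx, map_add, map_sum,
    tilde_fst_mul, tilde_snd_mul, (tilde_pderiv _ _).1, (tilde_pderiv _ _).2, parity_pderiv,
    parity_parity, map_neg, neg_neg, mul_neg]
  exact Finset.sum_congr rfl fun j _ => add_comm _ _

theorem tilde_mul_weight : tilde n * weight n = weight n * tilde n := by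
  simp only [weight, mul_smul_comm, smul_mul_assoc, mul_sub, sub_mul, tilde_mul_euler, one_mul,
    mul_one]

theorem form_parity (f g : Gr n) : form n (parity n f) g = form n f (parity n g) := by
  have : form n ∘ₗ parity n = (form n).compl₂ (parity n) := by
    refine (mono n).ext fun A => (mono n).ext fun B => ?_
    simp only [LinearMap.comp_apply, LinearMap.compl₂_apply, parity_mono, map_smul,
      LinearMap.smul_apply, form_mono_mono]
    split_ifs with h
    · rw [h]
    · simp
  exact LinearMap.congr_fun (LinearMap.congr_fun this f) g

/-- `tilde` transports multiplication by a generator and its adjoint derivative compatibly, so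
induction on `f` reduces the claim to `f = 1`. -/
theorem form_tilde (f g : Gr n) : form n (tilde n f) (tilde n g) = form n f g := by
  induction f using gr_induction_pairs generalizing g with
  | one =>
    have h0 : ∀ i (g : Gr n), form n 1 (gen i * g) = 0 := fun i g => by
      rw [form_comm, form_gen_mul, pderiv_one, map_zero, mul_zero]
    induction g using gr_induction_pairs with
    | one => simp only [tilde_one]
    | add f g hf hg => simp only [map_add, hf, hg]
    | smul c f hf => simp only [map_smul, hf]
    | fst_mul j g hg => rw [tilde_fst_mul, tilde_one, h0, h0]
    | snd_mul j g hg => rw [tilde_snd_mul, tilde_one, map_neg, h0, h0, neg_zero]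
  | add f f' hf hf' => simp only [map_add, LinearMap.add_apply, hf, hf']
  | smul c f hf => simp only [map_smul, LinearMap.smul_apply, hf]
  | fst_mul j f hf =>
    rw [tilde_fst_mul, form_gen_mul, form_gen_mul, form_parity, parity_pderiv,
      ← (tilde_pderiv j g).1, hf]
  | snd_mul j f hf =>
    rw [tilde_snd_mul, map_neg, LinearMap.neg_apply, form_gen_mul, form_gen_mul, form_parity,
      parity_pderiv, ← (tilde_pderiv j g).2, map_neg, hf, mul_neg, neg_neg]

end Tilde

/-! ### Conjugation by Gaussians. -/

section Gaussian

variable {n : ℕ}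

/-- Multiplication by `exp(a θ²)`. -/
def gaussOp (n : ℕ) (a : ℂ) : Module.End ℂ (Gr n) :=
  LinearMap.mulLeft ℂ (IsNilpotent.exp (a • thetaSq n))

theorem gaussOp_apply (a : ℂ) (f : Gr n) :
    gaussOp n a f = IsNilpotent.exp (a • thetaSq n) * f := rfl

theorem mulLeft_exp {a : Gr n} (ha : IsNilpotent a) :
    LinearMap.mulLeft ℂ (IsNilpotent.exp a) = IsNilpotent.exp (LinearMap.mulLeft ℂ a) :=
  IsNilpotent.map_exp ha (Algebra.lmul ℂ (Gr n))

theorem mulLeft_isNilpotent {a : Gr n} (ha : IsNilpotent a) :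
    IsNilpotent (LinearMap.mulLeft ℂ a) :=
  ha.map (Algebra.lmul ℂ (Gr n))

theorem smul_isNilpotent {R : Type*} [Ring R] [Algebra ℂ R] {a : R} (ha : IsNilpotent a) (c : ℂ) :
    IsNilpotent (c • a) := by
  obtain ⟨m, hm⟩ := ha
  exact ⟨m, by rw [smul_pow, hm, smul_zero]⟩

theorem thetaOp_isNilpotent : IsNilpotent (thetaOp n) := mulLeft_isNilpotent thetaSq_isNilpotent

theorem gaussOp_eq_exp (a : ℂ) : gaussOp n a = IsNilpotent.exp (a • thetaOp n) := by
  have : LinearMap.mulLeft ℂ (a • thetaSq n) = a • thetaOp n :=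
    LinearMap.ext fun f => smul_mul_assoc _ _ _
  rw [gaussOp, mulLeft_exp (smul_isNilpotent thetaSq_isNilpotent a), this]

theorem gaussOp_zero : gaussOp n 0 = 1 := by
  rw [gaussOp_eq_exp, zero_smul, IsNilpotent.exp_zero]

theorem gaussOp_mul_gaussOp (a b : ℂ) : gaussOp n a * gaussOp n b = gaussOp n (a + b) := by
  rw [gaussOp_eq_exp, gaussOp_eq_exp, gaussOp_eq_exp, add_smul, IsNilpotent.exp_add_of_commute _
    (smul_isNilpotent thetaOp_isNilpotent a) (smul_isNilpotent thetaOp_isNilpotent b)]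
  exact ((Commute.refl _).smul_left a).smul_right b

theorem gaussOp_mul_thetaOp (a : ℂ) : gaussOp n a * thetaOp n = thetaOp n * gaussOp n a := by
  rw [gaussOp_eq_exp, exp_mul_eq_of_commutator (d := 0) (c := 0)
    (smul_isNilpotent thetaOp_isNilpotent a)] <;> simp

theorem gaussOp_mul_weight (a : ℂ) :
    gaussOp n a * weight n = (weight n - (4 * a) • thetaOp n) * gaussOp n a := by
  rw [gaussOp_eq_exp, exp_mul_eq_of_commutator (d := -(4 * a) • thetaOp n) (c := 0)
    (smul_isNilpotent thetaOp_isNilpotent a)]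
  · congr 1
    module
  · rw [mul_smul_comm, weight_mul_thetaOp, smul_mul_assoc]
    module
  · simp [smul_smul, mul_comm]
  · simp

theorem gaussOp_mul_laplace (a : ℂ) :
    gaussOp n a * laplace n =
      (laplace n - (2 * a) • weight n + (4 * a ^ 2) • thetaOp n) * gaussOp n a := by
  -- Here `d = [aθ², ∇²]` and `c = [aθ², d]`, by the `sl₂` relations.
  rw [gaussOp_eq_exp, exp_mul_eq_of_commutator (d := -(2 * a) • weight n)
    (c := (8 * a ^ 2) • thetaOp n) (smul_isNilpotent thetaOp_isNilpotent a)]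
  · congr 1
    module
  · rw [mul_smul_comm, laplace_mul_thetaOp, smul_mul_assoc]
    module
  · simp only [mul_smul_comm, smul_mul_assoc, weight_mul_thetaOp]
    module
  · simp [smul_smul, mul_comm]

theorem gaussOp_pderiv_fst (a : ℂ) (j : Fin n) (f : Gr n) :
    gaussOp n a (pderiv (fstIdx j) f) =
      pderiv (fstIdx j) (gaussOp n a f) + a • (gen (sndIdx j) * gaussOp n a f) := by
  have := exp_mul_eq_of_commutator (a := a • thetaOp n) (b := pderiv (fstIdx j))
    (d := a • LinearMap.mulLeft ℂ (gen (sndIdx j))) (c := 0)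
    (smul_isNilpotent thetaOp_isNilpotent a) ?_ ?_ (by simp)
  · rw [gaussOp_eq_exp]
    simpa using LinearMap.congr_fun this f
  · refine LinearMap.ext fun f => ?_
    simp only [Module.End.mul_apply, LinearMap.smul_apply, LinearMap.add_apply, map_smul,
      thetaOp_apply, pderiv_fst_thetaSq_mul, LinearMap.mulLeft_apply]
    module
  · refine LinearMap.ext fun f => ?_
    simp only [Module.End.mul_apply, LinearMap.smul_apply, map_smul, thetaOp_apply,
      LinearMap.mulLeft_apply, ← mul_assoc, (thetaSq_commute (gen (sndIdx j))).eq, add_zero]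

theorem gaussOp_pderiv_snd (a : ℂ) (j : Fin n) (f : Gr n) :
    gaussOp n a (pderiv (sndIdx j) f) =
      pderiv (sndIdx j) (gaussOp n a f) - a • (gen (fstIdx j) * gaussOp n a f) := by
  have := exp_mul_eq_of_commutator (a := a • thetaOp n) (b := pderiv (sndIdx j))
    (d := -a • LinearMap.mulLeft ℂ (gen (fstIdx j))) (c := 0)
    (smul_isNilpotent thetaOp_isNilpotent a) ?_ ?_ (by simp)
  · rw [gaussOp_eq_exp]
    simpa [sub_eq_add_neg] using LinearMap.congr_fun this f
  · refine LinearMap.ext fun f => ?_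
    simp only [Module.End.mul_apply, LinearMap.smul_apply, LinearMap.add_apply, map_smul,
      thetaOp_apply, pderiv_snd_thetaSq_mul, LinearMap.mulLeft_apply]
    module
  · refine LinearMap.ext fun f => ?_
    simp only [Module.End.mul_apply, LinearMap.smul_apply, map_smul, thetaOp_apply,
      LinearMap.mulLeft_apply, ← mul_assoc, (thetaSq_commute (gen (fstIdx j))).eq, add_zero]
    module

theorem exp_thetaSq_commute (a : ℂ) (f : Gr n) :
    Commute (IsNilpotent.exp (a • thetaSq n)) f := by
  obtain ⟨m, hm⟩ := smul_isNilpotent (thetaSq_isNilpotent (n := n)) a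
  rw [exp_eq_complex_sum hm]
  exact Commute.sum_left _ _ _ fun i _ =>
    (((thetaSq_commute f).smul_left a).pow_left i).smul_left _

theorem mul_gauss (f : Gr n) : f * gauss n = gaussOp n (-1 / 2) f :=
  (exp_thetaSq_commute (-1 / 2) f).eq.symm

theorem parity_thetaSq : parity n (thetaSq n) = thetaSq n := by
  have : thetaSq n = thetaOp n 1 := by rw [thetaOp_apply, mul_one]
  rw [this, thetaOp_apply_eq_sum, map_neg, map_sum]
  simp only [parity_gen_mul, parity_one, mul_neg, neg_neg]

theorem parity_gaussOp (a : ℂ) (f : Gr n) :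
    parity n (gaussOp n a f) = gaussOp n a (parity n f) := by
  rw [gaussOp_apply, gaussOp_apply, parity_mul]
  congr 1
  have := IsNilpotent.map_exp (smul_isNilpotent (thetaSq_isNilpotent (n := n)) a)
    (CliffordAlgebra.involute (Q := (0 : QuadraticForm ℂ (Fin (2 * n) → ℂ))))
  refine this.trans ?_
  rw [map_smul]
  congr 2
  exact parity_thetaSq

theorem tilde_thetaSq : tilde n (thetaSq n) = -thetaSq n := by
  have := LinearMap.congr_fun (tilde_mul_thetaOp (n := n)) 1
  simpa [thetaOp_apply, tilde_one] using this

/-- The injective star map conjugates `∇²` into the nilpotent operator `-θ²`. -/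
theorem laplace_isNilpotent : IsNilpotent (laplace n) := by
  obtain ⟨m, hm⟩ := thetaOp_isNilpotent (n := n)
  refine ⟨m, ?_⟩
  have h : ∀ (m : ℕ) (f : Gr n),
      hodge n ((laplace n ^ m) f) = (-1 : ℂ) ^ m • (thetaOp n ^ m) (hodge n f) := by
    intro m
    induction m with
    | zero => simp
    | succ m ih =>
      intro f
      have h1 := LinearMap.congr_fun (hodge_mul_laplace (n := n)) f
      simp only [Module.End.mul_apply, LinearMap.neg_apply] at h1
      rw [pow_succ, Module.End.mul_apply, ih, h1, map_neg, pow_succ, pow_succ,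
        Module.End.mul_apply]
      module
  refine LinearMap.ext fun f => hodge_injective ?_
  rw [h, hm]
  simp

end Gaussian

/-! ### The star map on Gaussians times polynomials. -/

section HodgeGaussian

variable {n : ℕ}

theorem repr_eq_zero_of_euler {μ : ℂ} {f : Gr n} (hf : euler n f = μ • f)
    {A : Finset (Fin (2 * n))} (hA : (A.card : ℂ) ≠ μ) : (mono n).repr f A = 0 := by
  have : euler n f = ∑ A, ((A.card : ℂ) * (mono n).repr f A) • mono n A := by
    conv_lhs => rw [← (mono n).sum_repr f]
    simp only [map_sum, map_smul, euler_mono, smul_smul, mul_comm]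
  have h3 := (mono n).repr_sum_self fun A => (A.card : ℂ) * (mono n).repr f A
  rw [← this, hf] at h3
  have h4 := congrFun h3 A
  rw [map_smul, Finsupp.smul_apply, smul_eq_mul, eq_comm, ← sub_eq_zero, ← sub_mul, mul_eq_zero,
    sub_eq_zero] at h4
  exact h4.resolve_left hA

theorem eq_smul_one_of_pderiv_eq_zero {f : Gr n} (h : ∀ i, pderiv i f = 0) :
    f = (mono n).repr f ∅ • 1 := by
  have he : euler n f = (0 : ℂ) • f := by rw [euler_apply]; simp [h]
  refine (mono n).ext_elem fun A => ?_
  rw [← mono_empty, map_smul, Module.Basis.repr_self, Finsupp.smul_apply, Finsupp.single_apply]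
  split_ifs with hA
  · simp [← hA]
  · rw [repr_eq_zero_of_euler he (by simpa using Ne.symm hA), smul_zero]

theorem pderiv_exp_mul {z : Gr n} (hz : IsNilpotent z) (i : Fin (2 * n))
    (h : ∀ f, pderiv i (z * f) = z * pderiv i f) : pderiv i (IsNilpotent.exp z) = 0 := by
  have h1 := exp_mul_eq_of_commutator (a := LinearMap.mulLeft ℂ z) (b := pderiv i) (d := 0)
    (c := 0) (mulLeft_isNilpotent hz)
    (LinearMap.ext fun f => by simp [h]) (by simp) (by simp)
  rw [← mulLeft_exp hz] at h1
  simpa [pderiv_one] using (LinearMap.congr_fun h1 1).symm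

/-- The Gaussian integral factorizes over the pairs: the exponential of one pair is `1 + c x_{2j-1}
x_{2j}`, its two derivatives extract `c`, and they annihilate the exponential of the other pairs. -/
theorem prod_pderiv_pairs_exp (l : List (Fin n)) (hl : l.Nodup) (c : ℂ) :
    (l.map fun j => pderiv (sndIdx j) * pderiv (fstIdx j)).reverse.prod
      (IsNilpotent.exp (l.map fun j => c • (gen (fstIdx j) * gen (sndIdx j) : Gr n)).sum) =
      c ^ l.length • (1 : Gr n) := by
  induction l with
  | nil => simp [IsNilpotent.exp_zero]
  | cons a l ih =>
    rw [List.nodup_cons] at hl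
    set S : Gr n := (l.map fun j => c • (gen (fstIdx j) * gen (sndIdx j) : Gr n)).sum with hS
    have hcomm : ∀ (l : List (Fin n)) (f : Gr n),
        Commute (l.map fun j => c • (gen (fstIdx j) * gen (sndIdx j) : Gr n)).sum f := by
      intro l f
      induction l with
      | nil => exact Commute.zero_left f
      | cons b l ih =>
        rw [List.map_cons, List.sum_cons]
        exact ((gen_mul_gen_commute _ _ f).smul_left c).add_left ih
    have hnil : ∀ l : List (Fin n),
        IsNilpotent (l.map fun j => c • (gen (fstIdx j) * gen (sndIdx j) : Gr n)).sum := by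
      intro l
      induction l with
      | nil => exact IsNilpotent.zero
      | cons b l ih =>
        rw [List.map_cons, List.sum_cons]
        exact Commute.isNilpotent_add (hcomm l _).symm
          (smul_isNilpotent (ι_mul_ι_isNilpotent _ _) c) ih
    have hd : ∀ i : Fin (2 * n), (∀ b ∈ l, i ≠ fstIdx b ∧ i ≠ sndIdx b) → ∀ f,
        pderiv i (S * f) = S * pderiv i f := by
      intro i hi f
      rw [hS]
      clear hS ih S hl
      induction l with
      | nil => simp
      | cons b l ih =>
        have hb := hi b (by simp)
        rw [List.map_cons, List.sum_cons, add_mul, add_mul, map_add,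
          ih (fun b hb => hi b (by simp [hb]))]
        simp only [smul_mul_assoc, map_smul, mul_assoc, pderiv_gen_mul, if_neg hb.1, if_neg hb.2,
          zero_sub, mul_neg, neg_neg]
    have hne : ∀ b ∈ l, a ≠ b := fun b hb h => hl.1 (h ▸ hb)
    have h1 : pderiv (fstIdx a) (IsNilpotent.exp S) = 0 :=
      pderiv_exp_mul (hnil l) _ (hd _ fun b hb =>
        ⟨by simpa [fstIdx_inj] using hne b hb, fstIdx_ne_sndIdx a b⟩)
    have h2 : pderiv (sndIdx a) (IsNilpotent.exp S) = 0 :=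
      pderiv_exp_mul (hnil l) _ (hd _ fun b hb =>
        ⟨sndIdx_ne_fstIdx a b, by simpa [sndIdx_inj] using hne b hb⟩)
    have hz : (c • (gen (fstIdx a) * gen (sndIdx a) : Gr n)) ^ 2 = 0 := by
      rw [smul_pow, gen, gen, ι_mul_ι_sq, smul_zero]
    rw [List.map_cons, List.map_cons, List.reverse_cons, List.prod_append, List.prod_singleton,
      List.sum_cons, Module.End.mul_apply, IsNilpotent.exp_add_of_commute
        ((hcomm l _).symm) ⟨2, hz⟩ (hnil l), exp_eq_complex_sum hz]
    have h3 : (pderiv (sndIdx a) * pderiv (fstIdx a))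
        ((∑ i ∈ Finset.range 2, ((i ! : ℂ))⁻¹ • (c • (gen (fstIdx a) * gen (sndIdx a) : Gr n)) ^ i) *
          IsNilpotent.exp S) = c • IsNilpotent.exp S := by
      simp only [Finset.sum_range_succ, Finset.sum_range_zero, zero_add, pow_zero, pow_one,
        Nat.factorial_zero, Nat.factorial_one, Nat.cast_one, inv_one, one_smul, add_mul, one_mul,
        map_add, Module.End.mul_apply, h1, map_zero, smul_mul_assoc, map_smul, mul_assoc,
        pderiv_gen_mul, if_true, if_neg (fstIdx_ne_sndIdx a a), mul_zero, sub_zero, h2]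
    rw [h3, map_smul, ih hl.2, smul_smul, List.length_cons, pow_succ']

theorem berezin_gauss : berezin (gauss n) = ((2 * Real.pi : ℂ) ^ n)⁻¹ := by
  have h := prod_pderiv_pairs_exp (List.finRange n) (List.nodup_finRange n) (1 / 2)
  have h1 : ((List.finRange n).map
      fun j => (1 / 2 : ℂ) • (gen (fstIdx j) * gen (sndIdx j) : Gr n)).sum =
      (-1 / 2 : ℂ) • thetaSq n := by
    rw [← List.ofFn_eq_map, List.sum_ofFn, thetaSq, ← Finset.smul_sum]
    module
  -- The `2n` derivatives of the Berezin integral are grouped in pairs, keeping the reversed order.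
  have h2 : (List.ofFn (fun i : Fin (2 * n) => pderiv i)).reverse.prod =
      ((List.finRange n).map fun j => pderiv (sndIdx j) * pderiv (fstIdx j)).reverse.prod := by
    rw [List.ofFn_mul', ← List.ofFn_eq_map]
    have : ∀ l : List (Fin n),
        ((l.map fun i : Fin n => List.ofFn fun j : Fin 2 => pderiv
          (⟨2 * i + j, by have := i.2; have := j.2; omega⟩ : Fin (2 * n))).flatten).reverse.prod =
        (l.map fun j => pderiv (sndIdx j) * pderiv (fstIdx j)).reverse.prod := by
      intro l
      induction l with
      | nil => rfl
      | cons a l ih =>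
        rw [List.map_cons, List.flatten_cons, List.reverse_append, List.prod_append, ih,
          List.map_cons, List.reverse_cons, List.prod_append]
        simp [fstIdx, sndIdx]
    rw [List.ofFn_eq_map, List.ofFn_eq_map]
    exact this _
  rw [berezin, h2, gauss, ← h1, h, map_smul, map_one, List.length_finRange, smul_eq_mul, mul_one,
    mul_pow, mul_inv, one_div, inv_pow, mul_comm]

theorem pderiv_gauss (j : Fin n) :
    pderiv (fstIdx j) (gauss n) = (1 / 2 : ℂ) • (gen (sndIdx j) * gauss n) ∧
      pderiv (sndIdx j) (gauss n) = -(1 / 2 : ℂ) • (gen (fstIdx j) * gauss n) := by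
  have h1 := gaussOp_pderiv_fst (-1 / 2) j 1
  have h2 := gaussOp_pderiv_snd (-1 / 2) j 1
  rw [pderiv_one, map_zero, ← mul_gauss, one_mul] at h1 h2
  constructor
  · rw [eq_comm, add_eq_zero_iff_eq_neg] at h1
    rw [h1]; module
  · rw [eq_comm, sub_eq_zero] at h2
    rw [h2]; module

theorem parity_gauss : parity n (gauss n) = gauss n := by
  rw [← one_mul (gauss n), mul_gauss, parity_gaussOp, parity_one]

/-- Constants are orthogonal to all multiples of `θ²`, because `∇²1 = 0`; so only the zeroth term of
the series contributes. -/
theorem repr_gauss_empty : (mono n).repr (gauss n) ∅ = 1 := by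
  have h1 : form n 1 (gauss n) = form n 1 1 := by
    obtain ⟨m, hm⟩ := smul_isNilpotent (thetaSq_isNilpotent (n := n)) (-1 / 2)
    have hm' : ((-1 / 2 : ℂ) • thetaSq n) ^ (m + 1) = 0 := by rw [pow_succ, hm, zero_mul]
    rw [gauss, exp_eq_complex_sum hm', Finset.sum_range_succ', map_add, map_sum,
      Finset.sum_eq_zero, zero_add]
    · simp
    · intro i _
      rw [pow_succ', smul_mul_assoc, ← thetaOp_apply, map_smul, map_smul, form_comm, form_thetaOp,
        show laplace n (1 : Gr n) = 0 by simp [laplace_apply, pderiv_one], map_zero]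
      simp
  have hn : (monoNorm n ∅ : ℂ) ≠ 0 := by exact_mod_cast (monoNorm_pos _).ne'
  rw [← mono_empty, form_mono_left, form_mono_left, Module.Basis.repr_self] at h1
  simpa using mul_left_cancel₀ hn h1

/-- Only the top monomial is sent to a constant, with factor `2^n`, so the constant term of the star
reads off the Berezin integral. -/
theorem repr_hodge_empty (f : Gr n) : (mono n).repr (hodge n f) ∅ =
    (2 * Real.pi : ℂ) ^ n * berezin f := by
  have : (mono n).coord ∅ ∘ₗ hodge n = (2 * Real.pi : ℂ) ^ n • berezinLin n := by
    refine linearMap_ext_mono fun A => ?_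
    simp only [LinearMap.comp_apply, hodge_mono, map_smul, LinearMap.smul_apply, berezinLin_apply,
      berezin_mono, Module.Basis.coord_apply, Module.Basis.repr_self, Finsupp.single_apply,
      Finset.compl_eq_empty_iff]
    split_ifs with h
    · have h1 : complSign (Finset.univ : Finset (Fin (2 * n))) = 1 := by
        rw [complSign, Finset.compl_univ, mono_empty, mul_one, Module.Basis.repr_self]
        simp
      have hpi : (Real.pi : ℂ) ≠ 0 := by exact_mod_cast Real.pi_ne_zero
      rw [h, h1, Finset.card_univ, Fintype.card_fin,
        show ((2 * n : ℕ) : ℤ) - n = n by push_cast; ring, zpow_natCast, mul_pow]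
      simp only [smul_eq_mul]
      field_simp
    · simp
  exact LinearMap.congr_fun this f

/-- The Gaussian is determined up to a scalar by the first order equations in `pderiv_gauss`, and
the star permutes these equations. The scalar is the constant term of the image, which
`repr_hodge_empty` and `berezin_gauss` evaluate to `1`. -/
theorem hodge_gauss : hodge n (gauss n) = gauss n := by
  have h1 : ∀ j : Fin n, pderiv (sndIdx j) (hodge n (gauss n)) =
      -(1 / 2 : ℂ) • (gen (fstIdx j) * hodge n (gauss n)) := by
    intro j
    have h := hodge_pderiv (fstIdx j) (gauss n)
    rw [(pderiv_gauss j).1, map_smul, hodge_gen_mul, parity_gauss, smul_smul] at h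
    norm_num at h
    rw [h]; module
  have h2 : ∀ j : Fin n, pderiv (fstIdx j) (hodge n (gauss n)) =
      (1 / 2 : ℂ) • (gen (sndIdx j) * hodge n (gauss n)) := by
    intro j
    have h := hodge_pderiv (sndIdx j) (gauss n)
    rw [(pderiv_gauss j).2, map_smul, hodge_gen_mul, parity_gauss, smul_smul] at h
    norm_num at h
    rw [h]
  -- Multiplication by the inverse Gaussian turns the first order equations into the vanishing of
  -- all derivatives.
  have h3 : ∀ i, pderiv i (gaussOp n (1 / 2) (hodge n (gauss n))) = 0 := by
    intro i
    obtain ⟨j, rfl | rfl⟩ := exists_fstIdx_or_sndIdx i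
    · have h := gaussOp_pderiv_fst (1 / 2) j (hodge n (gauss n))
      have e : gen (sndIdx j) * gaussOp n (1 / 2) (hodge n (gauss n)) =
          gaussOp n (1 / 2) (gen (sndIdx j) * hodge n (gauss n)) := by
        rw [gaussOp_apply, gaussOp_apply, ← mul_assoc, ← mul_assoc,
          (exp_thetaSq_commute _ (gen (sndIdx j))).eq]
      rw [h2, map_smul, e] at h
      simpa using h.symm
    · have h := gaussOp_pderiv_snd (1 / 2) j (hodge n (gauss n))
      have e : gen (fstIdx j) * gaussOp n (1 / 2) (hodge n (gauss n)) =
          gaussOp n (1 / 2) (gen (fstIdx j) * hodge n (gauss n)) := by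
        rw [gaussOp_apply, gaussOp_apply, ← mul_assoc, ← mul_assoc,
          (exp_thetaSq_commute _ (gen (fstIdx j))).eq]
      rw [h1, map_smul, e, eq_sub_iff_add_eq] at h
      rw [← h]; module
  have h4 := congrArg (gaussOp n (-1 / 2)) (eq_smul_one_of_pderiv_eq_zero h3)
  rw [← Module.End.mul_apply, gaussOp_mul_gaussOp, map_smul, ← mul_gauss, one_mul,
    show (-1 / 2 + 1 / 2 : ℂ) = 0 by norm_num, gaussOp_zero, Module.End.one_apply] at h4
  have hpi : (2 * Real.pi : ℂ) ^ n ≠ 0 := by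
    have : (Real.pi : ℂ) ≠ 0 := by exact_mod_cast Real.pi_ne_zero
    exact pow_ne_zero _ (mul_ne_zero two_ne_zero this)
  have h5 := repr_hodge_empty (gauss n)
  rw [berezin_gauss, mul_inv_cancel₀ hpi, h4, map_smul, Finsupp.smul_apply, repr_gauss_empty,
    smul_eq_mul, mul_one] at h5
  rw [h4, h5, one_smul]

/-- The commutator of `∇²` with a generator is `±4` times the derivative in its partner, which
commutes with `∇²`. -/
theorem exp_laplace_gen_mul (c : ℂ) (j : Fin n) (f : Gr n) :
    IsNilpotent.exp (c • laplace n) (gen (fstIdx j) * f) =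
        gen (fstIdx j) * IsNilpotent.exp (c • laplace n) f +
          (4 * c) • pderiv (sndIdx j) (IsNilpotent.exp (c • laplace n) f) ∧
      IsNilpotent.exp (c • laplace n) (gen (sndIdx j) * f) =
        gen (sndIdx j) * IsNilpotent.exp (c • laplace n) f -
          (4 * c) • pderiv (fstIdx j) (IsNilpotent.exp (c • laplace n) f) := by
  have hp : ∀ i (f : Gr n), laplace n (pderiv i f) = pderiv i (laplace n f) := by
    intro i f
    simp only [laplace_apply, map_smul, map_sum]
    congr 1
    refine Finset.sum_congr rfl fun k _ => ?_
    rw [pderiv_pderiv (sndIdx k), map_neg, pderiv_pderiv (fstIdx k), neg_neg]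
  constructor
  · have := exp_mul_eq_of_commutator (a := c • laplace n)
      (b := LinearMap.mulLeft ℂ (gen (fstIdx j))) (d := (4 * c) • pderiv (sndIdx j)) (c := 0)
      (smul_isNilpotent laplace_isNilpotent c) ?_ ?_ (by simp)
    · simpa using LinearMap.congr_fun this f
    · refine LinearMap.ext fun f => ?_
      simp only [Module.End.mul_apply, LinearMap.smul_apply, LinearMap.add_apply,
        laplace_apply, LinearMap.mulLeft_apply, pderiv_gen_mul, sndIdx_ne_fstIdx, if_false,
        zero_sub, map_neg, fstIdx_inj, neg_sub, Finset.sum_sub_distrib, mul_smul_comm,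
        Finset.mul_sum, Finset.sum_ite_eq', Finset.mem_univ, if_true]
      module
    · refine LinearMap.ext fun f => ?_
      simp [hp, smul_smul, mul_comm]
  · have := exp_mul_eq_of_commutator (a := c • laplace n)
      (b := LinearMap.mulLeft ℂ (gen (sndIdx j))) (d := -(4 * c) • pderiv (fstIdx j)) (c := 0)
      (smul_isNilpotent laplace_isNilpotent c) ?_ ?_ (by simp)
    · simpa [sub_eq_add_neg] using LinearMap.congr_fun this f
    · refine LinearMap.ext fun f => ?_
      have e : ∀ k : Fin n, pderiv (fstIdx k) (if k = j then f else 0) =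
          if k = j then pderiv (fstIdx k) f else 0 := by
        intro k; split_ifs <;> simp
      simp only [Module.End.mul_apply, LinearMap.smul_apply, LinearMap.add_apply,
        laplace_apply, LinearMap.mulLeft_apply, pderiv_gen_mul, fstIdx_ne_sndIdx, if_false,
        zero_sub, map_sub, sndIdx_inj, e, sub_neg_eq_add, Finset.sum_add_distrib, mul_smul_comm,
        Finset.mul_sum, Finset.sum_ite_eq', Finset.mem_univ, if_true]
      module
    · refine LinearMap.ext fun f => ?_
      simp [hp, smul_smul, mul_comm]

/-- The star turns a generator into `2∂_i`. Across the Gaussian this derivative becomes a derivative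
plus multiplication by the partner generator, which is also what conjugation by `exp(-∇²/2)`
produces from `tilde` of the generator. -/
theorem hodge_mul_gauss (f : Gr n) : hodge n (f * gauss n) =
    gaussOp n (-1 / 2) (IsNilpotent.exp ((-1 / 2 : ℂ) • laplace n) (tilde n f)) := by
  set U := IsNilpotent.exp ((-1 / 2 : ℂ) • laplace n) with hU
  -- Each use of `hodge_gen_mul` introduces `parity`, so the induction carries `f` and `parity f`
  -- together.
  suffices h : hodge n (f * gauss n) = gaussOp n (-1 / 2) (U (tilde n f)) ∧
      hodge n (parity n f * gauss n) = gaussOp n (-1 / 2) (U (tilde n (parity n f))) from h.1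
  have key : ∀ (i : Fin (2 * n)) (f : Gr n),
      hodge n (parity n f * gauss n) = gaussOp n (-1 / 2) (U (tilde n (parity n f))) →
      hodge n (gen i * f * gauss n) = gaussOp n (-1 / 2) (U (tilde n (gen i * f))) := by
    intro i f hf
    rw [mul_assoc, hodge_gen_mul, parity_mul, parity_gauss, hf, tilde_parity]
    obtain ⟨j, rfl | rfl⟩ := exists_fstIdx_or_sndIdx i
    · rw [tilde_fst_mul, (exp_laplace_gen_mul _ j _).2, map_sub, map_smul, gaussOp_pderiv_fst,
        gaussOp_apply, gaussOp_apply, ← mul_assoc, (exp_thetaSq_commute _ (gen (sndIdx j))).eq,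
        mul_assoc]
      module
    · rw [tilde_snd_mul, map_neg, (exp_laplace_gen_mul _ j _).1, map_neg, map_add, map_smul,
        gaussOp_pderiv_snd,
        gaussOp_apply, gaussOp_apply, ← mul_assoc, (exp_thetaSq_commute _ (gen (fstIdx j))).eq,
        mul_assoc]
      module
  induction f using gr_induction with
  | one =>
    have hU1 : U 1 = 1 := by
      obtain ⟨m, hm⟩ := smul_isNilpotent (laplace_isNilpotent (n := n)) (-1 / 2)
      have hm' : ((-1 / 2 : ℂ) • laplace n) ^ (m + 1) = 0 := by rw [pow_succ, hm, zero_mul]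
      rw [hU, exp_eq_complex_sum hm', Finset.sum_range_succ', LinearMap.add_apply,
        LinearMap.sum_apply, Finset.sum_eq_zero, zero_add]
      · simp
      · intro i _
        rw [pow_succ, LinearMap.smul_apply, Module.End.mul_apply, LinearMap.smul_apply,
          laplace_apply]
        simp [pderiv_one]
    rw [parity_one, one_mul, tilde_one, hU1, hodge_gauss, ← mul_gauss, one_mul]
    exact ⟨rfl, rfl⟩
  | add f g hf hg =>
    simp only [map_add, add_mul, hf.1, hg.1, hf.2, hg.2, and_self]
  | smul c f hf =>
    simp only [map_smul, smul_mul_assoc, hf.1, hf.2, and_self]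
  | gen_mul i f hf =>
    refine ⟨key i f hf.2, ?_⟩
    have := key i (parity n f) (by rw [parity_parity]; exact hf.1)
    rw [parity_gen_mul, neg_mul, map_neg, this, map_neg, map_neg, map_neg]

theorem exp_apply_of_apply_eq_zero {a : Module.End ℂ (Gr n)} (ha : IsNilpotent a) {f : Gr n}
    (h : a f = 0) : IsNilpotent.exp a f = f := by
  obtain ⟨m, hm⟩ := ha
  have hm' : a ^ (m + 1) = 0 := by rw [pow_succ, hm, zero_mul]
  rw [exp_eq_complex_sum hm', Finset.sum_range_succ', LinearMap.add_apply, LinearMap.sum_apply,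
    Finset.sum_eq_zero, zero_add]
  · simp
  · intro i _
    rw [pow_succ, LinearMap.smul_apply, Module.End.mul_apply, h, map_zero, smul_zero]

theorem laplace_tilde {f : Gr n} (h : laplace n f = 0) : laplace n (tilde n f) = 0 := by
  have := LinearMap.congr_fun (tilde_mul_laplace (n := n)) f
  simpa [h] using this

/-- `tilde f` is again harmonic, so `exp(-∇²/2)` fixes it. -/
theorem hodge_harmonic_mul_gauss {f : Gr n} (h : laplace n f = 0) :
    hodge n (f * gauss n) = tilde n f * gauss n := by
  rw [hodge_mul_gauss, exp_apply_of_apply_eq_zero (smul_isNilpotent laplace_isNilpotent _)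
    (by rw [LinearMap.smul_apply, laplace_tilde h, smul_zero]), mul_gauss]

end HodgeGaussian

/-! ### Raising, lowering and oscillator operators. -/

section Ladder

variable {n : ℕ}

theorem laplace_thetaOp (f : Gr n) :
    laplace n (thetaOp n f) = thetaOp n (laplace n f) + (2 : ℂ) • weight n f :=
  LinearMap.congr_fun laplace_mul_thetaOp f

theorem weight_thetaOp (f : Gr n) :
    weight n (thetaOp n f) = thetaOp n (weight n f) + (4 : ℂ) • thetaOp n f :=
  LinearMap.congr_fun weight_mul_thetaOp f

theorem weight_laplace (f : Gr n) :
    weight n (laplace n f) = laplace n (weight n f) - (4 : ℂ) • laplace n f :=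
  LinearMap.congr_fun weight_mul_laplace f

theorem gaussOp_thetaOp (a : ℂ) (f : Gr n) :
    gaussOp n a (thetaOp n f) = thetaOp n (gaussOp n a f) :=
  LinearMap.congr_fun (gaussOp_mul_thetaOp a) f

theorem gaussOp_weight (a : ℂ) (f : Gr n) :
    gaussOp n a (weight n f) = weight n (gaussOp n a f) - (4 * a) • thetaOp n (gaussOp n a f) :=
  LinearMap.congr_fun (gaussOp_mul_weight a) f

theorem gaussOp_laplace (a : ℂ) (f : Gr n) :
    gaussOp n a (laplace n f) = laplace n (gaussOp n a f) - (2 * a) • weight n (gaussOp n a f) +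
      (4 * a ^ 2) • thetaOp n (gaussOp n a f) :=
  LinearMap.congr_fun (gaussOp_mul_laplace a) f

theorem hodge_thetaOp (f : Gr n) : hodge n (thetaOp n f) = -laplace n (hodge n f) :=
  LinearMap.congr_fun hodge_mul_thetaOp f

theorem hodge_laplace (f : Gr n) : hodge n (laplace n f) = -thetaOp n (hodge n f) :=
  LinearMap.congr_fun hodge_mul_laplace f

theorem hodge_weight (f : Gr n) : hodge n (weight n f) = -weight n (hodge n f) :=
  LinearMap.congr_fun hodge_mul_weight f

/-- The operator `-∇² - θ² + 2 E - 2 n` that generates the spherical Hermite functions. -/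
def raising (n : ℕ) : Module.End ℂ (Gr n) := -laplace n - thetaOp n + weight n

/-- The adjoint `∇² + θ² + 2 E - 2 n` of `raising`. -/
def lowering (n : ℕ) : Module.End ℂ (Gr n) := laplace n + thetaOp n + weight n

/-- The oscillator Hamiltonian `(θ² - ∇²) / 2`. -/
def oscillator (n : ℕ) : Module.End ℂ (Gr n) := (1 / 2 : ℂ) • (thetaOp n - laplace n)

theorem raising_apply (f : Gr n) :
    raising n f = -laplace n f - thetaOp n f + weight n f := rfl

theorem lowering_apply (f : Gr n) :
    lowering n f = laplace n f + thetaOp n f + weight n f := rfl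

theorem oscillator_apply (f : Gr n) :
    oscillator n f = (1 / 2 : ℂ) • (thetaOp n f - laplace n f) := rfl

theorem hermiteFn_eq (j : ℕ) (h : Gr n) :
    hermiteFn n j h = (raising n ^ j) (h * gauss n) := by
  unfold hermiteFn
  congr 2
  refine LinearMap.ext fun f => ?_
  simp only [raising_apply, weight_apply, LinearMap.sub_apply, LinearMap.add_apply,
    LinearMap.neg_apply, LinearMap.smul_apply, Module.End.one_apply, thetaOp]
  module

/-- This produces the sign `(-1)^j` in the star of the Laguerre functions. -/
theorem hodge_raising (f : Gr n) : hodge n (raising n f) = -raising n (hodge n f) := by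
  simp only [raising_apply, map_add, map_sub, map_neg, hodge_thetaOp, hodge_laplace, hodge_weight]
  module

theorem oscillator_raising (f : Gr n) :
    oscillator n (raising n f) = raising n (oscillator n f) + (2 : ℂ) • raising n f := by
  simp only [raising_apply, oscillator_apply, map_add, map_sub, map_neg, map_smul,
    laplace_thetaOp, weight_thetaOp, weight_laplace]
  module

/-- Raising, lowering and oscillator form a second `sl₂` triple; the `16` becomes the factor
`4^{2j}` of `γ_{j,k}`. -/
theorem lowering_raising (f : Gr n) :
    lowering n (raising n f) = raising n (lowering n f) - (16 : ℂ) • oscillator n f := by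
  simp only [raising_apply, oscillator_apply, lowering_apply, map_add, map_sub, map_neg,
    laplace_thetaOp, weight_thetaOp, weight_laplace]
  module

theorem form_raising (f g : Gr n) : form n (raising n f) g = form n f (lowering n g) := by
  simp only [raising_apply, lowering_apply, map_add, map_sub, map_neg, LinearMap.add_apply,
    LinearMap.sub_apply, LinearMap.neg_apply, form_laplace, form_thetaOp, form_weight]
  ring

theorem form_oscillator (f g : Gr n) :
    form n (oscillator n f) g = form n f (oscillator n g) := by
  simp only [oscillator_apply, map_sub, map_smul, LinearMap.sub_apply, LinearMap.smul_apply,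
    form_laplace, form_thetaOp]
  congr 1
  ring

/-- Harmonic elements of degree `c + n`, described by the action of the `sl₂` operators. -/
def IsLowestWeight {n : ℕ} (c : ℂ) (h : Gr n) : Prop :=
  laplace n h = 0 ∧ weight n h = (2 * c) • h

theorem IsLowestWeight.tilde {c : ℂ} {h : Gr n} (hh : IsLowestWeight c h) :
    IsLowestWeight c (tilde n h) := by
  refine ⟨laplace_tilde hh.1, ?_⟩
  have := LinearMap.congr_fun (tilde_mul_weight (n := n)) h
  simp only [Module.End.mul_apply] at this
  rw [← this, hh.2, map_smul]

/-- Across the Gaussian, `∇²h = 0` says that `∇² + θ² + weight` kills `h * gauss n`, and the weight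
equation says that `weight + 2θ²` acts on it by `2c`. Half the difference is the oscillator. -/
theorem IsLowestWeight.oscillator {c : ℂ} {h : Gr n} (hh : IsLowestWeight c h) :
    oscillator n (h * gauss n) = c • (h * gauss n) := by
  rw [mul_gauss]
  have h1 := gaussOp_laplace (-1 / 2) h
  have h2 := gaussOp_weight (-1 / 2) h
  rw [hh.1, map_zero] at h1
  rw [hh.2, map_smul] at h2
  rw [oscillator_apply]
  linear_combination (norm := module) (1 / 2 : ℂ) • h1 - (1 / 2 : ℂ) • h2

theorem IsLowestWeight.lowering {c : ℂ} {h : Gr n} (hh : IsLowestWeight c h) :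
    lowering n (h * gauss n) = 0 := by
  rw [mul_gauss]
  have h1 := gaussOp_laplace (-1 / 2) h
  rw [hh.1, map_zero] at h1
  rw [lowering_apply]
  linear_combination (norm := module) -h1

theorem IsLowestWeight.oscillator_raising_pow {c : ℂ} {h : Gr n} (hh : IsLowestWeight c h)
    (j : ℕ) : GrassmannMehler.oscillator n ((raising n ^ j) (h * gauss n)) =
      (c + 2 * j) • (raising n ^ j) (h * gauss n) := by
  induction j with
  | zero => simp [hh.oscillator]
  | succ j ih =>
    rw [pow_succ', Module.End.mul_apply, oscillator_raising, ih, map_smul]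
    push_cast
    module

theorem IsLowestWeight.lowering_raising_pow {c : ℂ} {h : Gr n} (hh : IsLowestWeight c h)
    (j : ℕ) : GrassmannMehler.lowering n ((raising n ^ (j + 1)) (h * gauss n)) =
      (-16 * (j + 1) * (c + j)) • (raising n ^ j) (h * gauss n) := by
  induction j with
  | zero =>
    rw [pow_succ', Module.End.mul_apply, lowering_raising, hh.oscillator_raising_pow]
    simp only [pow_zero, Module.End.one_apply, hh.lowering, map_zero]
    push_cast
    module
  | succ j ih =>
    rw [pow_succ', Module.End.mul_apply, lowering_raising, ih, map_smul,
      ← Module.End.mul_apply, ← pow_succ', hh.oscillator_raising_pow]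
    push_cast
    module

/-- A raising operator moved across the form becomes a lowering operator, which descends the other
ladder by a scalar. Ladders of unequal length end with lowering applied to a ground state. -/
theorem form_raising_pow {c c' : ℂ} {h h' : Gr n} (hh : IsLowestWeight c h)
    (hh' : IsLowestWeight c' h') (i j : ℕ) :
    form n ((raising n ^ i) (h * gauss n)) ((raising n ^ j) (h' * gauss n)) =
      if i = j then (∏ m ∈ Finset.range j, (-16 * ((m : ℂ) + 1) * (c' + m))) *
        form n (h * gauss n) (h' * gauss n) else 0 := by
  induction i generalizing j with
  | zero =>
    cases j with
    | zero => simp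
    | succ j =>
      rw [form_comm, pow_succ', Module.End.mul_apply, form_raising, pow_zero, Module.End.one_apply,
        hh.lowering, map_zero, if_neg (Nat.succ_ne_zero j).symm]
  | succ i ih =>
    rw [pow_succ', Module.End.mul_apply, form_raising]
    cases j with
    | zero =>
      rw [pow_zero, Module.End.one_apply, hh'.lowering, map_zero, if_neg (Nat.succ_ne_zero i)]
    | succ j =>
      rw [hh'.lowering_raising_pow, map_smul, ih, Finset.prod_range_succ]
      simp only [add_left_inj, smul_eq_mul]
      split_ifs
      · ring
      · simp

/-- Eigenvectors of the self-adjoint oscillator with distinct eigenvalues are orthogonal. -/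
theorem form_gauss_eq_zero {c c' : ℂ} {h h' : Gr n} (hh : IsLowestWeight c h)
    (hh' : IsLowestWeight c' h') (hc : c ≠ c') :
    form n (h * gauss n) (h' * gauss n) = 0 := by
  have := form_oscillator (h * gauss n) (h' * gauss n)
  rw [hh.oscillator, hh'.oscillator, map_smul, map_smul, LinearMap.smul_apply, smul_eq_mul,
    smul_eq_mul, ← sub_eq_zero, ← sub_mul, mul_eq_zero] at this
  exact this.resolve_left (sub_ne_zero.2 hc)

/-- Used with `d = 16` for the Hermite ladder and `d = 4` for the Fischer ladder; the factor `(N -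
j)!` avoids a division. -/
theorem prod_ladder_mul_factorial {N : ℕ} {d : ℂ} (j : ℕ) (hj : j ≤ N) :
    (∏ m ∈ Finset.range j, (-d * ((m : ℂ) + 1) * (-N + m))) * (N - j)! = d ^ j * j ! * N ! := by
  induction j with
  | zero => simp
  | succ j ih =>
    obtain ⟨r, rfl⟩ := Nat.exists_eq_add_of_le hj
    have h1 := ih (by omega)
    have e1 : j + 1 + r - j = r + 1 := by omega
    have e2 : j + 1 + r - (j + 1) = r := by omega
    rw [e1, Nat.factorial_succ] at h1
    rw [Finset.prod_range_succ, e2, Nat.factorial_succ]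
    push_cast at h1 ⊢
    linear_combination d * (j + 1) * h1

end Ladder

/-! ### The ladder in terms of Laguerre polynomials. -/

section Laguerre

variable {n : ℕ}

/-- The coefficients of the Laguerre polynomials with parameter `c - 1`. -/
def laguerreCoeff (c : ℂ) (j i : ℕ) : ℂ :=
  if i ≤ j then (-1) ^ i * (ascPochhammer ℂ (j - i)).eval (c + i) / (i ! * (j - i)!) else 0

/-- This is the coefficient of `θ^{2i} h` in the identity of `IsLowestWeight.laguerre_step`, divided
by `4`. -/
theorem laguerreCoeff_recurrence (c : ℂ) (j i : ℕ) :
    -((i : ℂ) + 1) * (c + i) * laguerreCoeff c j (i + 1) + (c + 2 * i) * laguerreCoeff c j i -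
      (if i = 0 then 0 else laguerreCoeff c j (i - 1)) =
      (j + 1) * laguerreCoeff c (j + 1) i := by
  have hp : ∀ r x, (ascPochhammer ℂ (r + 1)).eval x = x * (ascPochhammer ℂ r).eval (x + 1) := by
    intro r x
    rw [ascPochhammer_succ_left]; simp
  have hq : ∀ r x, (ascPochhammer ℂ (r + 1)).eval x = (ascPochhammer ℂ r).eval x * (x + r) :=
    fun r x => ascPochhammer_succ_eval r x
  have hf : ∀ m : ℕ, ((m ! : ℕ) : ℂ) ≠ 0 := fun m => by exact_mod_cast m.factorial_ne_zero
  have hs : ∀ m : ℕ, (m : ℂ) + 1 ≠ 0 := fun m => by exact_mod_cast m.succ_ne_zero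
  -- For `j = i + r` all terms are multiples of the Pochhammer symbol `(c + i)_r`; the factors `r`
  -- in `t1` and `i` in `t3` cover the boundary cases. For `i = j + 1` only leading coefficients
  -- survive, and beyond that all terms vanish.
  rcases lt_trichotomy i (j + 1) with hi | hi | hi
  · obtain ⟨r, rfl⟩ := Nat.exists_eq_add_of_le (Nat.lt_succ_iff.1 hi)
    -- the contribution of the next coefficient
    have t1 : -((i : ℂ) + 1) * (c + i) * laguerreCoeff c (i + r) (i + 1) =
        (-1) ^ i * (r * (ascPochhammer ℂ r).eval (c + i) / (i ! * r !)) := by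
      cases r with
      | zero => simp [laguerreCoeff]
      | succ r =>
        rw [laguerreCoeff, if_pos (by omega), show i + (r + 1) - (i + 1) = r by omega,
          Nat.factorial_succ, Nat.factorial_succ, hp]
        push_cast
        have := hf i; have := hf r; have := hs i; have := hs r
        rw [add_assoc c, pow_succ]
        field_simp
    have t2 : laguerreCoeff c (i + r) i =
        (-1) ^ i * ((ascPochhammer ℂ r).eval (c + i) / (i ! * r !)) := by
      rw [laguerreCoeff, if_pos (by omega), show i + r - i = r by omega]
      ring
    have t3 : (if i = 0 then 0 else laguerreCoeff c (i + r) (i - 1)) =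
        -(-1) ^ i * (i * ((c + i - 1) * (ascPochhammer ℂ r).eval (c + i)) /
          (i ! * ((r + 1) * r !))) := by
      cases i with
      | zero => simp
      | succ i =>
        rw [if_neg (Nat.succ_ne_zero i), laguerreCoeff, if_pos (by omega),
          show i + 1 + r - (i + 1 - 1) = r + 1 by omega, Nat.add_sub_cancel, hp,
          Nat.factorial_succ, Nat.factorial_succ]
        push_cast
        have := hf i; have := hf r; have := hs i; have := hs r
        rw [show c + (i : ℂ) + 1 = c + (i + 1) by ring, show c + ((i : ℂ) + 1) - 1 = c + i by ring]
        field_simp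
        ring
    have t4 : laguerreCoeff c (i + r + 1) i = (-1) ^ i *
        ((ascPochhammer ℂ r).eval (c + i) * (c + i + r) / (i ! * ((r + 1) * r !))) := by
      rw [laguerreCoeff, if_pos (by omega), show i + r + 1 - i = r + 1 by omega, hq,
        Nat.factorial_succ]
      push_cast
      ring
    rw [t1, t2, t3, t4]
    have := hf i; have := hf r; have := hs r
    push_cast
    field_simp
    ring
  · subst hi
    have e1 : laguerreCoeff c j (j + 1 + 1) = 0 := if_neg (by omega)
    have e2 : laguerreCoeff c j (j + 1) = 0 := if_neg (by omega)
    rw [e1, e2, if_neg (Nat.succ_ne_zero j), Nat.add_sub_cancel, laguerreCoeff, laguerreCoeff,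
      if_pos le_rfl, if_pos le_rfl, Nat.factorial_succ]
    have := hf j; have := hs j
    push_cast
    simp only [Nat.sub_self, ascPochhammer_zero, Polynomial.eval_one]
    field_simp
    ring
  · have e1 : laguerreCoeff c j (i + 1) = 0 := if_neg (by omega)
    have e2 : laguerreCoeff c j i = 0 := if_neg (by omega)
    have e3 : laguerreCoeff c j (i - 1) = 0 := if_neg (by omega)
    have e4 : laguerreCoeff c (j + 1) i = 0 := if_neg (by omega)
    rw [e1, e2, e3, e4]
    simp

theorem thetaOp_pow_apply (i : ℕ) (f : Gr n) : (thetaOp n ^ i) f = thetaSq n ^ i * f := by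
  induction i with
  | zero => simp
  | succ i ih => rw [pow_succ', Module.End.mul_apply, ih, thetaOp_apply, pow_succ', mul_assoc]

theorem aeval_laguerre_mul (c : ℂ) (j : ℕ) (h : Gr n) :
    Polynomial.aeval (thetaSq n) (laguerre (c - 1) j) * h =
      ∑ i ∈ Finset.range (j + 1), laguerreCoeff c j i • (thetaOp n ^ i) h := by
  rw [laguerre, map_sum, Finset.sum_mul]
  refine Finset.sum_congr rfl fun i hi => ?_
  rw [map_mul, Polynomial.aeval_C, map_pow, Polynomial.aeval_X, thetaOp_pow_apply, laguerreCoeff,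
    if_pos (Nat.lt_succ_iff.1 (Finset.mem_range.1 hi)), ← Algebra.smul_def, smul_mul_assoc,
    show c - 1 + (i : ℂ) + 1 = c + i by ring]

theorem IsLowestWeight.weight_thetaOp_pow {c : ℂ} {h : Gr n} (hh : IsLowestWeight c h) (i : ℕ) :
    weight n ((thetaOp n ^ i) h) = (2 * c + 4 * i) • (thetaOp n ^ i) h := by
  induction i with
  | zero => simp [hh.2]
  | succ i ih =>
    rw [pow_succ', Module.End.mul_apply, weight_thetaOp, ih, map_smul]
    push_cast
    module

theorem IsLowestWeight.laplace_thetaOp_pow {c : ℂ} {h : Gr n} (hh : IsLowestWeight c h) (i : ℕ) :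
    laplace n ((thetaOp n ^ (i + 1)) h) = (4 * (i + 1) * (c + i)) • (thetaOp n ^ i) h := by
  induction i with
  | zero =>
    rw [pow_succ', Module.End.mul_apply, laplace_thetaOp, hh.weight_thetaOp_pow]
    simp only [pow_zero, Module.End.one_apply, hh.1, map_zero]
    push_cast
    module
  | succ i ih =>
    rw [pow_succ', Module.End.mul_apply, laplace_thetaOp, ih, hh.weight_thetaOp_pow, map_smul,
      ← Module.End.mul_apply, ← pow_succ']
    push_cast
    module

theorem raising_gaussOp (h : Gr n) : raising n (gaussOp n (-1 / 2) h) =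
    gaussOp n (-1 / 2) (-laplace n h + (2 : ℂ) • weight n h - (4 : ℂ) • thetaOp n h) := by
  rw [raising_apply, map_sub, map_add, map_neg, map_smul, map_smul, gaussOp_laplace,
    gaussOp_weight, gaussOp_thetaOp]
  module

theorem IsLowestWeight.laguerre_step {c : ℂ} {h : Gr n} (hh : IsLowestWeight c h) (j : ℕ)
    {L : Gr n} (h0 : L = Polynomial.aeval (thetaSq n) (laguerre (c - 1) j) * h) :
    -laplace n L + (2 : ℂ) • weight n L - (4 : ℂ) • thetaOp n L =
      (4 * (j + 1) : ℂ) • (Polynomial.aeval (thetaSq n) (laguerre (c - 1) (j + 1)) * h) := by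
  rw [aeval_laguerre_mul] at h0
  -- Vanishing coefficients pad the sums so that `∇² L`, `weight L` and `θ² L` all run over the
  -- range `j + 2`; the Laplacian lowers the index and needs one more term.
  have hL : L = ∑ i ∈ Finset.range (j + 2), laguerreCoeff c j i • (thetaOp n ^ i) h := by
    rw [Finset.sum_range_succ, ← h0, laguerreCoeff, if_neg (by omega), zero_smul,
      add_zero]
  have hL3 : L = ∑ i ∈ Finset.range (j + 3), laguerreCoeff c j i • (thetaOp n ^ i) h := by
    rw [Finset.sum_range_succ, ← hL, laguerreCoeff, if_neg (by omega), zero_smul, add_zero]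
  have h1 : laplace n L = ∑ i ∈ Finset.range (j + 2),
      (laguerreCoeff c j (i + 1) * (4 * (i + 1) * (c + i))) • (thetaOp n ^ i) h := by
    rw [hL3, Finset.sum_range_succ', map_add, map_sum]
    simp only [map_smul, hh.laplace_thetaOp_pow, smul_smul, pow_zero, Module.End.one_apply, hh.1,
      smul_zero, add_zero]
  have h2 : weight n L = ∑ i ∈ Finset.range (j + 2),
      (laguerreCoeff c j i * (2 * c + 4 * i)) • (thetaOp n ^ i) h := by
    rw [hL, map_sum]
    simp only [map_smul, hh.weight_thetaOp_pow, smul_smul]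
  have h3 : thetaOp n L = ∑ i ∈ Finset.range (j + 2),
      (if i = 0 then 0 else laguerreCoeff c j (i - 1)) • (thetaOp n ^ i) h := by
    rw [Finset.sum_range_succ']
    simp only [if_true, zero_smul, add_zero, Nat.succ_ne_zero, if_false, Nat.add_sub_cancel]
    rw [h0, map_sum]
    simp only [map_smul, pow_succ', Module.End.mul_apply]
  rw [h1, h2, h3, aeval_laguerre_mul, Finset.smul_sum, Finset.smul_sum, Finset.smul_sum,
    ← Finset.sum_neg_distrib, ← Finset.sum_add_distrib, ← Finset.sum_sub_distrib]
  refine Finset.sum_congr rfl fun i _ => ?_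
  rw [smul_smul (4 * ((j : ℂ) + 1)), mul_assoc (4 : ℂ) ((j : ℂ) + 1), ← laguerreCoeff_recurrence]
  module

theorem IsLowestWeight.raising_pow {c : ℂ} {h : Gr n} (hh : IsLowestWeight c h) (j : ℕ) :
    (raising n ^ j) (h * gauss n) = ((2 : ℂ) ^ (2 * j) * j !) •
      (Polynomial.aeval (thetaSq n) (laguerre (c - 1) j) * h * gauss n) := by
  induction j with
  | zero => simp [laguerre]
  | succ j ih =>
    rw [pow_succ', Module.End.mul_apply, ih, map_smul, mul_gauss, raising_gaussOp,
      hh.laguerre_step j rfl, map_smul, smul_smul, mul_gauss, Nat.factorial_succ]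
    congr 1
    push_cast
    ring

/-- The star moves past the `j` raising operators with sign `(-1)^j` and acts on the ground state by
`tilde`. Both sides are then ladders, and the common factor `2^{2j} j!` cancels. -/
theorem IsLowestWeight.hodge_laguerre {c : ℂ} {h : Gr n} (hh : IsLowestWeight c h) (j : ℕ) :
    hodge n (Polynomial.aeval (thetaSq n) (laguerre (c - 1) j) * h * gauss n) =
      (-1 : ℂ) ^ j • (Polynomial.aeval (thetaSq n) (laguerre (c - 1) j) *
        GrassmannMehler.tilde n h * gauss n) := by
  have h1 : ∀ f : Gr n, hodge n ((raising n ^ j) f) = (-1 : ℂ) ^ j • (raising n ^ j) (hodge n f) := by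
    induction j with
    | zero => simp
    | succ j ih =>
      intro f
      rw [pow_succ', Module.End.mul_apply, hodge_raising, ih, map_smul, pow_succ',
        Module.End.mul_apply]
      module
  have h2 := h1 (h * gauss n)
  have hne : ((2 : ℂ) ^ (2 * j) * j !) ≠ 0 :=
    mul_ne_zero (pow_ne_zero _ two_ne_zero) (by exact_mod_cast j.factorial_ne_zero)
  rw [hodge_harmonic_mul_gauss hh.1, hh.raising_pow, hh.tilde.raising_pow, map_smul,
    smul_comm] at h2
  exact smul_right_injective _ hne h2

end Laguerre

/-! ### Harmonics as Euler eigenvectors. -/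

section Harmonics

variable {n : ℕ}

theorem isLowestWeight_of_euler {k : ℂ} {h : Gr n} (h0 : laplace n h = 0)
    (h1 : euler n h = k • h) : IsLowestWeight (k - n) h := by
  refine ⟨h0, ?_⟩
  rw [weight_apply, h1]
  module

theorem euler_of_mem_exteriorPower {k : ℕ} {f : Gr n}
    (hf : f ∈ (⋀[ℂ]^k (Fin (2 * n) → ℂ) : Submodule ℂ (Gr n))) : euler n f = (k : ℂ) • f := by
  rw [← ExteriorAlgebra.ιMulti_span_fixedDegree] at hf
  induction hf using Submodule.span_induction with
  | mem x hx =>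
    obtain ⟨v, rfl⟩ := hx
    rw [ExteriorAlgebra.ιMulti_apply]
    induction k with
    | zero => simp [euler_apply, pderiv_one]
    | succ k ih =>
      rw [List.ofFn_succ, List.prod_cons, ι_eq_sum, Finset.sum_mul, map_sum, Finset.smul_sum]
      refine Finset.sum_congr rfl fun i _ => ?_
      rw [smul_mul_assoc, map_smul, euler_gen_mul, ih, mul_smul_comm]
      push_cast
      module
  | zero => simp
  | add f g _ _ hf hg => simp only [map_add, hf, hg, smul_add]
  | smul c f _ hf => rw [map_smul, hf, smul_comm]

theorem mem_exteriorPower_of_euler {k : ℕ} {f : Gr n} (hf : euler n f = (k : ℂ) • f) :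
    f ∈ (⋀[ℂ]^k (Fin (2 * n) → ℂ) : Submodule ℂ (Gr n)) := by
  rw [← (mono n).sum_repr f]
  refine Submodule.sum_mem _ fun A _ => ?_
  by_cases hA : A.card = k
  · refine Submodule.smul_mem _ _ ?_
    rw [mono, ExteriorAlgebra.basis_apply_ofCard _ hA]
    exact ExteriorAlgebra.ιMulti_range ℂ k ⟨_, rfl⟩
  · rw [repr_eq_zero_of_euler hf (by exact_mod_cast hA), zero_smul]
    exact Submodule.zero_mem _

theorem mem_harmonics_iff {k : ℕ} {f : Gr n} :
    f ∈ harmonics n k ↔ laplace n f = 0 ∧ euler n f = (k : ℂ) • f := by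
  rw [harmonics, Submodule.mem_inf, LinearMap.mem_ker]
  exact and_congr_right fun _ => ⟨euler_of_mem_exteriorPower, mem_exteriorPower_of_euler⟩

theorem isLowestWeight_of_mem_harmonics {k : ℕ} {f : Gr n} (hf : f ∈ harmonics n k) :
    IsLowestWeight ((k : ℂ) - n) f := by
  rw [mem_harmonics_iff] at hf
  exact isLowestWeight_of_euler hf.1 hf.2

end Harmonics

/-! ### Reality of the Hermite functions. -/

section RealStructure

variable {n : ℕ}

theorem conj_gauss_mul {f : Gr n} (hf : conj f = f) : conj (f * gauss n) = f * gauss n := by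
  have h : ∀ i : ℕ, conj ((thetaOp n ^ i) f) = (thetaOp n ^ i) f := by
    intro i
    induction i with
    | zero => exact hf
    | succ i ih => rw [pow_succ', Module.End.mul_apply, conj_thetaOp, ih]
  obtain ⟨m, hm⟩ := smul_isNilpotent (thetaOp_isNilpotent (n := n)) (-1 / 2)
  rw [mul_gauss, gaussOp_eq_exp, exp_eq_complex_sum hm, LinearMap.sum_apply, ← conjLin_apply,
    map_sum]
  refine Finset.sum_congr rfl fun i _ => ?_
  rw [conjLin_apply, smul_pow, LinearMap.smul_apply, LinearMap.smul_apply, conj_smul, conj_smul, h]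
  simp [map_ofNat]

theorem conj_raising_pow {f : Gr n} (hf : conj f = f) (j : ℕ) :
    conj ((raising n ^ j) f) = (raising n ^ j) f := by
  induction j with
  | zero => exact hf
  | succ j ih =>
    rw [pow_succ', Module.End.mul_apply]
    conv_rhs => rw [← ih]
    simp only [raising_apply, ← conjLin_apply, map_add, map_sub, map_neg]
    simp only [conjLin_apply, conj_laplace, conj_thetaOp, conj_weight]

theorem conj_hermiteUnit {j k : ℕ} {h : Gr n} (hh : conj h = h) :
    conj (hermiteUnit n j k h) = hermiteUnit n j k h := by
  rw [hermiteUnit, conj_smul, hermiteFn_eq, conj_raising_pow (conj_gauss_mul hh)]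
  simp

end RealStructure

/-! ### Orthogonal bases and the canonical element. -/

section OrthogonalFamilies

variable {n : ℕ} {I M : Type*} [Fintype I] [AddCommGroup M] [Module ℂ M]

instance gr_finite : Module.Finite ℂ (Gr n) := Module.Finite.of_basis (mono n)

/-- The canonical element of a bilinear map, `∑_A β(x_A, x_A) / ‖x_A‖²`. -/
def casimir (β : Gr n →ₗ[ℂ] Gr n →ₗ[ℂ] M) : M :=
  ∑ A, (monoNorm n A : ℂ)⁻¹ • β (mono n A) (mono n A)

theorem monoNorm_ne_zero (A : Finset (Fin (2 * n))) : (monoNorm n A : ℂ) ≠ 0 := by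
  exact_mod_cast (monoNorm_pos A).ne'

theorem linearIndependent_of_orthogonal [DecidableEq I] {u : I → Gr n} {c : I → ℂ}
    (hc : ∀ a, c a ≠ 0) (horth : ∀ a b, form n (u a) (u b) = if a = b then c a else 0) :
    LinearIndependent ℂ u := by
  rw [Fintype.linearIndependent_iff]
  intro g hg a
  have h := congrArg (form n (u a)) hg
  simp only [map_sum, map_smul, horth, smul_eq_mul, mul_ite, mul_zero, map_zero,
    Finset.sum_ite_eq, Finset.mem_univ, if_true] at h
  exact (mul_eq_zero.1 h).resolve_right (hc a)

theorem sum_orthogonal_expansion [DecidableEq I] {u : I → Gr n} {c : I → ℂ} (hc : ∀ a, c a ≠ 0)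
    (horth : ∀ a b, form n (u a) (u b) = if a = b then c a else 0)
    (hspan : Submodule.span ℂ (Set.range u) = ⊤) (f : Gr n) :
    ∑ a, ((c a)⁻¹ * form n f (u a)) • u a = f := by
  have hf : f ∈ Submodule.span ℂ (Set.range u) := hspan ▸ Submodule.mem_top
  induction hf using Submodule.span_induction with
  | mem x hx =>
    obtain ⟨b, rfl⟩ := hx
    simp only [horth, mul_ite, mul_zero, ite_smul, zero_smul, Finset.sum_ite_eq, Finset.mem_univ,
      if_true, inv_mul_cancel₀ (hc b), one_smul]
  | zero => simp
  | add f g _ _ hf hg =>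
    simp only [map_add, LinearMap.add_apply, mul_add, add_smul, Finset.sum_add_distrib, hf, hg]
  | smul r f _ hf =>
    conv_rhs => rw [← hf, Finset.smul_sum]
    refine Finset.sum_congr rfl fun a _ => ?_
    rw [map_smul, LinearMap.smul_apply, smul_eq_mul, smul_smul, mul_left_comm]

/-- The canonical element can be computed in every orthogonal basis. -/
theorem sum_orthogonal_eq_casimir [DecidableEq I] {u : I → Gr n} {c : I → ℂ}
    (hc : ∀ a, c a ≠ 0) (horth : ∀ a b, form n (u a) (u b) = if a = b then c a else 0)
    (hspan : Submodule.span ℂ (Set.range u) = ⊤) (β : Gr n →ₗ[ℂ] Gr n →ₗ[ℂ] M) :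
    ∑ a, (c a)⁻¹ • β (u a) (u a) = casimir β := by
  -- The expansion of a monomial in the basis `u`, divided by the squared norm of that monomial.
  have h1 : ∀ A, ∑ a, ((c a)⁻¹ * (mono n).repr (u a) A) • u a =
      (monoNorm n A : ℂ)⁻¹ • mono n A := by
    intro A
    have := sum_orthogonal_expansion hc horth hspan (mono n A)
    rw [eq_inv_smul_iff₀ (monoNorm_ne_zero A), Finset.smul_sum, ← this]
    simp only [form_mono_left, smul_smul]
    exact Finset.sum_congr rfl fun a _ => by congr 1; ring
  have h2 : ∀ a, (c a)⁻¹ • β (u a) (u a) =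
      ∑ A, β (mono n A) (((c a)⁻¹ * (mono n).repr (u a) A) • u a) := by
    intro a
    conv_lhs => enter [2, 1, 2]; rw [← (mono n).sum_repr (u a)]
    simp only [map_sum, map_smul, LinearMap.sum_apply, LinearMap.smul_apply, Finset.smul_sum,
      smul_smul]
  rw [Finset.sum_congr rfl fun a _ => h2 a, Finset.sum_comm, casimir]
  refine Finset.sum_congr rfl fun A _ => ?_
  rw [← map_sum, h1, map_smul]

/-- In the monomial basis, adjointness says that the matrix of `X` divided by the norms is the
transpose of that of `Y`; exchanging two sums gives the claim. -/
theorem casimir_adjoint {X Y : Module.End ℂ (Gr n)}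
    (h : ∀ f g, form n (X f) g = form n f (Y g)) (β : Gr n →ₗ[ℂ] Gr n →ₗ[ℂ] M) :
    casimir (β ∘ₗ X) = casimir (β.compl₂ Y) := by
  have h1 : ∀ A B, (monoNorm n A : ℂ)⁻¹ * (mono n).repr (X (mono n A)) B =
      (monoNorm n B : ℂ)⁻¹ * (mono n).repr (Y (mono n B)) A := by
    intro A B
    have := h (mono n A) (mono n B)
    rw [form_comm, form_mono_left, form_mono_left] at this
    have := monoNorm_ne_zero A
    have := monoNorm_ne_zero B
    field_simp
    linear_combination h (mono n A) (mono n B) -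
      (form_comm (X (mono n A)) (mono n B)).trans (form_mono_left B (X (mono n A))) +
      form_mono_left A (Y (mono n B))
  have h2 : ∀ A, (monoNorm n A : ℂ)⁻¹ • β (X (mono n A)) (mono n A) =
      ∑ B, ((monoNorm n A : ℂ)⁻¹ * (mono n).repr (X (mono n A)) B) • β (mono n B) (mono n A) := by
    intro A
    conv_lhs => enter [2, 1, 2]; rw [← (mono n).sum_repr (X (mono n A))]
    simp only [map_sum, map_smul, LinearMap.sum_apply, LinearMap.smul_apply, Finset.smul_sum,
      smul_smul]
  have h3 : ∀ B, (monoNorm n B : ℂ)⁻¹ • β (mono n B) (Y (mono n B)) =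
      ∑ A, ((monoNorm n B : ℂ)⁻¹ * (mono n).repr (Y (mono n B)) A) • β (mono n B) (mono n A) := by
    intro B
    conv_lhs => enter [2, 2]; rw [← (mono n).sum_repr (Y (mono n B))]
    simp only [map_sum, map_smul, Finset.smul_sum, smul_smul]
  simp only [casimir, LinearMap.comp_apply, LinearMap.compl₂_apply, h2, h3, h1]
  exact Finset.sum_comm

/-- Isometries preserve the canonical element. -/
theorem casimir_isometry {X : Module.End ℂ (Gr n)}
    (h : ∀ f g, form n (X f) (X g) = form n f g) (β : Gr n →ₗ[ℂ] Gr n →ₗ[ℂ] M) :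
    casimir (β.compl₁₂ X X) = casimir β := by
  have horth : ∀ A B, form n (X (mono n A)) (X (mono n B)) =
      if A = B then (monoNorm n A : ℂ) else 0 := fun A B => by rw [h, form_mono_mono]
  -- The images of the monomials are again an orthogonal basis with the same norms.
  refine sum_orthogonal_eq_casimir (u := fun A => X (mono n A)) monoNorm_ne_zero horth ?_ β
  refine (linearIndependent_of_orthogonal monoNorm_ne_zero
    horth).span_eq_top_of_card_eq_finrank' ?_
  rw [Module.finrank_eq_card_basis (mono n)]

end OrthogonalFamilies

/-! ### The Fischer decomposition. -/

section Fischer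

variable {n : ℕ}

theorem eq_zero_of_euler {μ : ℂ} {f : Gr n} (hf : euler n f = μ • f) (hμ : ∀ m : ℕ, (m : ℂ) ≠ μ) :
    f = 0 :=
  (mono n).ext_elem fun A => by simpa using repr_eq_zero_of_euler hf (hμ A.card)

theorem euler_thetaOp {μ : ℂ} {f : Gr n} (hf : euler n f = μ • f) :
    euler n (thetaOp n f) = (μ + 2) • thetaOp n f := by
  have := LinearMap.congr_fun (euler_mul_thetaOp (n := n)) f
  simp only [Module.End.mul_apply, LinearMap.add_apply, LinearMap.smul_apply, hf, map_smul] at this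
  rw [this, add_smul]

theorem euler_laplace {μ : ℂ} {f : Gr n} (hf : euler n f = μ • f) :
    euler n (laplace n f) = (μ - 2) • laplace n f := by
  have := LinearMap.congr_fun (euler_mul_laplace (n := n)) f
  simp only [Module.End.mul_apply, LinearMap.sub_apply, LinearMap.smul_apply, hf, map_smul] at this
  rw [this, sub_smul]

/-- By adjointness the two norms differ by minus the expectation of `[∇², θ²]`, which is twice the
weight and hence the scalar `4(d - n)` in degree `d`. -/
theorem form_thetaOp_conj_self {d : ℕ} {f : Gr n} (hf : euler n f = (d : ℂ) • f) :
    (form n (thetaOp n f) (conj (thetaOp n f))).re =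
      (form n (laplace n f) (conj (laplace n f))).re +
        4 * ((n : ℝ) - d) * (form n f (conj f)).re := by
  have hw : weight n f = ((2 * ((d : ℝ) - n) : ℝ) : ℂ) • f := by
    rw [weight_apply, hf]
    push_cast
    module
  have h : form n (thetaOp n f) (conj (thetaOp n f)) = form n (laplace n f) (conj (laplace n f)) +
      ((4 * ((n : ℝ) - d) : ℝ) : ℂ) * form n f (conj f) := by
    rw [form_thetaOp, conj_thetaOp, laplace_thetaOp, map_add, map_smul, ← conj_weight, hw,
      conj_smul, Complex.conj_ofReal, map_smul, conj_laplace, form_laplace]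
    simp only [smul_eq_mul]
    push_cast
    ring
  rw [h, Complex.add_re, Complex.re_ofReal_mul]

/-- The hypothesis makes the norm of `θ²f` zero. Below degree `n` the norm identity then writes zero
as a sum of nonnegative terms. Above degree `n`, `eq_zero_of_thetaOp_laplace` reads the identity the
other way. -/
theorem eq_zero_of_laplace_thetaOp {d : ℕ} {f : Gr n} (hf : euler n f = (d : ℂ) • f) (hd : d < n)
    (h : laplace n (thetaOp n f) = 0) : f = 0 := by
  have h1 : form n (thetaOp n f) (conj (thetaOp n f)) = 0 := by
    rw [form_thetaOp, ← conj_laplace, h, ← conjLin_apply, map_zero, map_zero, neg_zero]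
  have h2 := form_thetaOp_conj_self hf
  rw [h1, Complex.zero_re] at h2
  have h3 := form_conj_self_re_nonneg (laplace n f)
  have h4 : (0 : ℝ) < (n : ℝ) - d := sub_pos.2 (by exact_mod_cast hd)
  refine eq_zero_of_form_conj_self_re_nonpos ?_
  by_contra hc
  have := mul_pos h4 (not_le.1 hc)
  linarith

theorem eq_zero_of_thetaOp_laplace {d : ℕ} {f : Gr n} (hf : euler n f = (d : ℂ) • f) (hd : n < d)
    (h : thetaOp n (laplace n f) = 0) : f = 0 := by
  have h1 : form n (laplace n f) (conj (laplace n f)) = 0 := by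
    rw [form_laplace, ← conj_thetaOp, h, ← conjLin_apply, map_zero, map_zero, neg_zero]
  have h2 := form_thetaOp_conj_self hf
  rw [h1, Complex.zero_re] at h2
  have h3 := form_conj_self_re_nonneg (thetaOp n f)
  have h4 : (0 : ℝ) < (d : ℝ) - n := sub_pos.2 (by exact_mod_cast hd)
  refine eq_zero_of_form_conj_self_re_nonpos ?_
  by_contra hc
  have := mul_pos h4 (not_le.1 hc)
  linarith

/-- An injective operator of degree zero is onto in every degree. -/
theorem exists_preimage_of_euler {T : Module.End ℂ (Gr n)} {μ : ℂ}
    (hT : ∀ f, euler n f = μ • f → euler n (T f) = μ • T f)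
    (hinj : ∀ f, euler n f = μ • f → T f = 0 → f = 0) {f : Gr n} (hf : euler n f = μ • f) :
    ∃ g, euler n g = μ • g ∧ T g = f := by
  let V : Submodule ℂ (Gr n) := Module.End.eigenspace (euler n) μ
  have hV : ∀ g, g ∈ V ↔ euler n g = μ • g := fun g => Module.End.mem_eigenspace_iff
  let S : V →ₗ[ℂ] V := T.restrict fun g hg => (hV _).2 (hT g ((hV g).1 hg))
  have hS : Function.Injective S := by
    rw [← LinearMap.ker_eq_bot, LinearMap.ker_eq_bot']
    intro g hg
    exact Subtype.ext (hinj g.1 ((hV _).1 g.2) (congrArg Subtype.val hg))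
  obtain ⟨g, hg⟩ := LinearMap.injective_iff_surjective.1 hS ⟨f, (hV f).2 hf⟩
  exact ⟨g.1, (hV _).1 g.2, congrArg Subtype.val hg⟩

/-- The span of the elements `θ^{2j} h` with `h` harmonic of degree at most `n`. -/
def fischerSpan (n : ℕ) : Submodule ℂ (Gr n) :=
  Submodule.span ℂ {f | ∃ (j k : ℕ) (h : Gr n), k ≤ n ∧ h ∈ harmonics n k ∧ f = (thetaOp n ^ j) h}

theorem thetaOp_mem_fischerSpan {f : Gr n} (hf : f ∈ fischerSpan n) :
    thetaOp n f ∈ fischerSpan n := by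
  induction hf using Submodule.span_induction with
  | mem x hx =>
    obtain ⟨j, k, h, hk, hh, rfl⟩ := hx
    exact Submodule.subset_span ⟨j + 1, k, h, hk, hh, by rw [pow_succ', Module.End.mul_apply]⟩
  | zero => rw [map_zero]; exact Submodule.zero_mem _
  | add f g _ _ hf hg => rw [map_add]; exact Submodule.add_mem _ hf hg
  | smul c f _ hf => rw [map_smul]; exact Submodule.smul_mem _ _ hf

/-- Above degree `n` the operator `θ²∇²` is onto in degree `d`, so `f` is `θ²` times an element of
lower degree. Otherwise `∇²θ²` is onto in degree `d - 2`, and subtracting a suitable `θ²g` makes `f`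
harmonic. In degrees `0` and `1` the Laplacian vanishes. -/
theorem mem_fischerSpan_of_euler (d : ℕ) {f : Gr n} (hf : euler n f = (d : ℂ) • f) :
    f ∈ fischerSpan n := by
  induction d using Nat.strong_induction_on generalizing f with
  | _ d ih =>
    have hlow : d < 2 → ∀ g, euler n g = (d : ℂ) • g → laplace n g = 0 := by
      intro hd g hg
      refine eq_zero_of_euler (euler_laplace hg) fun m hm => ?_
      rw [eq_sub_iff_add_eq] at hm
      have : m + 2 = d := by exact_mod_cast hm
      omega
    have hharm : d ≤ n → ∀ g, euler n g = (d : ℂ) • g → laplace n g = 0 → g ∈ fischerSpan n :=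
      fun hd g hg h0 => Submodule.subset_span ⟨0, d, g, hd, mem_harmonics_iff.2 ⟨h0, hg⟩, rfl⟩
    have hcast : ∀ e : ℕ, d = e + 2 → (d : ℂ) - 2 = e := by
      rintro e rfl; push_cast; ring
    rcases Nat.lt_or_ge n d with hd | hd
    · obtain ⟨g, hg, rfl⟩ := exists_preimage_of_euler (T := thetaOp n * laplace n) (μ := d)
        (fun f hf => by
          have := euler_thetaOp (euler_laplace hf)
          rwa [sub_add_cancel] at this)
        (fun f hf h => eq_zero_of_thetaOp_laplace hf hd h) hf
      refine thetaOp_mem_fischerSpan ?_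
      rcases Nat.lt_or_ge d 2 with h2 | h2
      · rw [hlow h2 g hg]; exact Submodule.zero_mem _
      · obtain ⟨e, rfl⟩ := Nat.exists_eq_add_of_le' h2
        refine ih e (by omega) ?_
        rw [euler_laplace hg, hcast e rfl]
    · rcases Nat.lt_or_ge d 2 with h2 | h2
      · exact hharm hd f hf (hlow h2 f hf)
      · obtain ⟨e, rfl⟩ := Nat.exists_eq_add_of_le' h2
        have hPf : euler n (laplace n f) = (e : ℂ) • laplace n f := by
          rw [euler_laplace hf, hcast e rfl]
        obtain ⟨g, hg, hgf⟩ := exists_preimage_of_euler (T := laplace n * thetaOp n) (μ := e)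
          (fun f hf => by
            have := euler_laplace (euler_thetaOp hf)
            rwa [add_sub_cancel_right] at this)
          (fun f hf h => eq_zero_of_laplace_thetaOp hf (by omega) h) hPf
        have h1 : f - thetaOp n g ∈ fischerSpan n := by
          refine hharm hd _ ?_ ?_
          · rw [map_sub, hf, euler_thetaOp hg, smul_sub]
            push_cast
            rfl
          · rw [map_sub, ← hgf, Module.End.mul_apply, sub_self]
        have h2 := Submodule.add_mem _ h1 (thetaOp_mem_fischerSpan (ih e (by omega) hg))
        rwa [sub_add_cancel] at h2

theorem fischerSpan_eq_top : fischerSpan n = ⊤ := by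
  rw [eq_top_iff, ← (mono n).span_eq, Submodule.span_le]
  rintro _ ⟨A, rfl⟩
  exact mem_fischerSpan_of_euler A.card (euler_mono A)

theorem form_thetaOp_pow {c c' : ℂ} {h h' : Gr n} (hh : IsLowestWeight c h)
    (hh' : IsLowestWeight c' h') (i j : ℕ) :
    form n ((thetaOp n ^ i) h) ((thetaOp n ^ j) h') =
      if i = j then (∏ m ∈ Finset.range j, (-4 * ((m : ℂ) + 1) * (c' + m))) * form n h h'
      else 0 := by
  induction i generalizing j with
  | zero =>
    cases j with
    | zero => simp
    | succ j =>
      rw [form_comm, pow_succ', Module.End.mul_apply, form_thetaOp, pow_zero, Module.End.one_apply,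
        hh.1, map_zero, if_neg (Nat.succ_ne_zero j).symm, neg_zero]
  | succ i ih =>
    rw [pow_succ', Module.End.mul_apply, form_thetaOp]
    cases j with
    | zero =>
      rw [pow_zero, Module.End.one_apply, hh'.1, map_zero, if_neg (Nat.succ_ne_zero i), neg_zero]
    | succ j =>
      rw [hh'.laplace_thetaOp_pow, map_smul, ih, Finset.prod_range_succ]
      simp only [add_left_inj, smul_eq_mul]
      split_ifs
      · ring
      · simp

theorem form_eq_zero_of_weight_ne {c c' : ℂ} {h h' : Gr n} (hh : IsLowestWeight c h)
    (hh' : IsLowestWeight c' h') (hc : c ≠ c') : form n h h' = 0 := by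
  have := form_weight h h'
  rw [hh.2, hh'.2, map_smul, map_smul, LinearMap.smul_apply, smul_eq_mul,
    smul_eq_mul, ← sub_eq_zero, ← sub_mul, mul_eq_zero] at this
  refine this.resolve_left (sub_ne_zero.2 fun h => hc ?_)
  linear_combination h / 2

theorem prod_ladder_eq_zero {N j : ℕ} (d : ℂ) (hj : N < j) :
    ∏ m ∈ Finset.range j, (-d * ((m : ℂ) + 1) * (-N + m)) = 0 :=
  Finset.prod_eq_zero (Finset.mem_range.2 hj) (by simp)

/-- The norm is a multiple of a ladder product containing the zero factor `m = N`. -/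
theorem thetaOp_pow_eq_zero {N j : ℕ} {h : Gr n} (hh : IsLowestWeight (-N : ℂ) h) (hj : N < j) :
    (thetaOp n ^ j) h = 0 := by
  have hc : IsLowestWeight (-N : ℂ) (conj h) := by
    refine ⟨by rw [← conj_laplace, hh.1, ← conjLin_apply, map_zero], ?_⟩
    rw [← conj_weight, hh.2, conj_smul]
    simp [map_ofNat]
  have hcp : ∀ j, conj ((thetaOp n ^ j) h) = (thetaOp n ^ j) (conj h) := by
    intro j
    induction j with
    | zero => rfl
    | succ j ih => rw [pow_succ', Module.End.mul_apply, conj_thetaOp, ih, Module.End.mul_apply]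
  refine eq_zero_of_form_conj_self_re_nonpos ?_
  rw [hcp, form_thetaOp_pow hh hc, if_pos rfl, prod_ladder_eq_zero 4 hj]
  simp

/-- Only equal powers of `θ²` pair nontrivially. The `i`-th terms of the two Gaussian series
contribute `N.choose i` times the form of `h` and `h'`, and the binomial coefficients add up to
`2^N`. -/
theorem form_gauss_mul {N : ℕ} {h h' : Gr n} (hh : IsLowestWeight (-N : ℂ) h)
    (hh' : IsLowestWeight (-N : ℂ) h') :
    form n (h * gauss n) (h' * gauss n) = 2 ^ N * form n h h' := by
  obtain ⟨m, hm⟩ := smul_isNilpotent (thetaOp_isNilpotent (n := n)) (-1 / 2)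
  -- A truncation beyond `N + 1` contains the whole binomial sum; the surplus terms vanish by
  -- `prod_ladder_eq_zero`.
  have hm' : ((-1 / 2 : ℂ) • thetaOp n) ^ (N + 1 + m) = 0 := by rw [pow_add, hm, mul_zero]
  have hf : ∀ m : ℕ, ((m ! : ℕ) : ℂ) ≠ 0 := fun m => by exact_mod_cast m.factorial_ne_zero
  have h1 : ∀ f : Gr n, f * gauss n = ∑ i ∈ Finset.range (N + 1 + m),
      (((i ! : ℂ))⁻¹ * (-1 / 2) ^ i) • (thetaOp n ^ i) f := by
    intro f
    rw [mul_gauss, gaussOp_eq_exp, exp_eq_complex_sum hm', LinearMap.sum_apply]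
    refine Finset.sum_congr rfl fun i _ => ?_
    rw [smul_pow, LinearMap.smul_apply, LinearMap.smul_apply, smul_smul]
  rw [h1 h, h1 h']
  simp only [map_sum, LinearMap.sum_apply, map_smul, LinearMap.smul_apply, form_thetaOp_pow hh hh',
    smul_eq_mul, mul_ite, mul_zero]
  rw [Finset.sum_congr rfl fun x hx => by rw [Finset.sum_ite_eq', if_pos hx],
    Finset.sum_range_add, Finset.sum_eq_zero (s := Finset.range m), add_zero]
  · have h2 : (2 : ℂ) ^ N = ∑ i ∈ Finset.range (N + 1), (N.choose i : ℂ) := by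
      have := Nat.sum_range_choose N
      exact_mod_cast this.symm
    rw [h2, Finset.sum_mul]
    refine Finset.sum_congr rfl fun i hi => ?_
    have hi' : i ≤ N := Nat.lt_succ_iff.1 (Finset.mem_range.1 hi)
    have h3 := prod_ladder_mul_factorial (d := 4) i hi'
    have h4 : (N.choose i : ℂ) * (i ! * (N - i)!) = N ! := by
      exact_mod_cast (by rw [← Nat.choose_mul_factorial_mul_factorial hi']; ring)
    have h5 : (-1 / 2 : ℂ) ^ i * (-1 / 2) ^ i * 4 ^ i = 1 := by
      rw [← mul_pow, ← mul_pow]; norm_num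
    have := hf i
    have := hf (N - i)
    generalize ∏ m ∈ Finset.range i, (-4 * ((m : ℂ) + 1) * (-N + m)) = p at h3 ⊢
    have h6 : p = 4 ^ i * i ! * (N.choose i * i !) := by
      have : p * (N - i)! = (4 ^ i * i ! * (N.choose i * i !)) * (N - i)! := by
        rw [h3, ← h4]; ring
      exact mul_right_cancel₀ (hf (N - i)) this
    rw [h6]
    field_simp
    linear_combination (N.choose i * form n h h') * h5
  · intro i _
    rw [prod_ladder_eq_zero 4 (by omega)]
    simp

end Fischer

/-! ### The Fischer basis and the Hermite basis. -/

section HermiteBasis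

variable {n : ℕ}

/-- Indices `(k, j, l)` with `0 ≤ k ≤ n`, `0 ≤ j ≤ n - k`, `1 ≤ l ≤ dim H_k`. -/
abbrev HermiteIndex (n : ℕ) : Type :=
  Σ k : Fin (n + 1), Fin (n - k + 1) × Fin (Module.finrank ℂ (harmonics n k))

theorem sum_hermiteIndex {M : Type*} [AddCommMonoid M]
    (f : (k : ℕ) → ℕ → Fin (Module.finrank ℂ (harmonics n k)) → M) :
    ∑ a : HermiteIndex n, f a.1 a.2.1 a.2.2 =
      ∑ k ∈ Finset.range (n + 1), ∑ j ∈ Finset.range (n - k + 1), ∑ l, f k j l := by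
  rw [Fintype.sum_sigma,
    ← Fin.sum_univ_eq_sum_range (fun k => ∑ j ∈ Finset.range (n - k + 1), ∑ l, f k j l)]
  refine Finset.sum_congr rfl fun k _ => ?_
  rw [Fintype.sum_prod_type, ← Fin.sum_univ_eq_sum_range (fun j => ∑ l, f k j l)]

/-- The hypothesis on the families of harmonics, expressed by the bilinear form. -/
structure IsOrthonormalFamily (H : HarmonicFamily n) : Prop where
  mem : ∀ k ≤ n, ∀ l, H k l ∈ harmonics n k
  form_gauss : ∀ k ≤ n, ∀ p q, form n (H k p * gauss n) (H k q * gauss n) =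
    if p = q then 1 / ((n - k)! : ℂ) else 0

variable {H : HarmonicFamily n}

theorem IsOrthonormalFamily.lowest (hH : IsOrthonormalFamily H) {k : ℕ} (hk : k ≤ n)
    (l : Fin (Module.finrank ℂ (harmonics n k))) : IsLowestWeight (-((n - k : ℕ) : ℂ)) (H k l) := by
  have := isLowestWeight_of_mem_harmonics (hH.mem k hk l)
  rwa [← neg_sub, ← Nat.cast_sub hk] at this

theorem IsOrthonormalFamily.form_eq (hH : IsOrthonormalFamily H) {k : ℕ} (hk : k ≤ n)
    (p q : Fin (Module.finrank ℂ (harmonics n k))) :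
    form n (H k p) (H k q) = if p = q then (2 ^ (n - k) * (n - k)! : ℂ)⁻¹ else 0 := by
  have h1 := hH.form_gauss k hk p q
  rw [form_gauss_mul (hH.lowest hk p) (hH.lowest hk q)] at h1
  have h2 : (2 : ℂ) ^ (n - k) ≠ 0 := pow_ne_zero _ two_ne_zero
  have h3 : (((n - k)! : ℕ) : ℂ) ≠ 0 := by exact_mod_cast (n - k).factorial_ne_zero
  split_ifs at h1 ⊢ with h
  · rw [mul_inv, eq_inv_mul_iff_mul_eq₀ h2, h1, one_div]
  · exact (mul_eq_zero.1 h1).resolve_left h2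

/-- Spanning follows from the normalization: orthogonality with nonzero norms gives independence,
and the number of elements is the dimension. -/
theorem IsOrthonormalFamily.harmonics_le_span (hH : IsOrthonormalFamily H) {k : ℕ} (hk : k ≤ n) :
    harmonics n k ≤ Submodule.span ℂ (Set.range (H k)) := by
  have h2 : (2 ^ (n - k) * (n - k)! : ℂ)⁻¹ ≠ 0 := inv_ne_zero
    (mul_ne_zero (pow_ne_zero _ two_ne_zero) (by exact_mod_cast (n - k).factorial_ne_zero))
  have h1 : LinearIndependent ℂ (H k) :=
    linearIndependent_of_orthogonal (fun _ => h2) (hH.form_eq hk)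
  let v : Fin (Module.finrank ℂ (harmonics n k)) → harmonics n k :=
    fun l => ⟨H k l, hH.mem k hk l⟩
  have hv : LinearIndependent ℂ v := LinearIndependent.of_comp (harmonics n k).subtype h1
  have h3 := hv.span_eq_top_of_card_eq_finrank' (by simp)
  have h4 := congrArg (Submodule.map (harmonics n k).subtype) h3
  rw [Submodule.map_span, ← Set.range_comp, Submodule.map_subtype_top] at h4
  exact h4.symm.le

/-- The squared norms of the elements `θ^{2j} H_k`. -/
def fischerNorm (n k j : ℕ) : ℂ := 4 ^ j * j ! / ((n - k - j)! * 2 ^ (n - k))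

theorem fischerNorm_ne_zero (k j : ℕ) : fischerNorm n k j ≠ 0 := by
  have hf : ∀ m : ℕ, ((m ! : ℕ) : ℂ) ≠ 0 := fun m => by exact_mod_cast m.factorial_ne_zero
  exact div_ne_zero (mul_ne_zero (pow_ne_zero _ (by norm_num)) (hf _))
    (mul_ne_zero (hf _) (pow_ne_zero _ two_ne_zero))

theorem IsOrthonormalFamily.form_fischer (hH : IsOrthonormalFamily H) (a b : HermiteIndex n) :
    form n ((thetaOp n ^ (a.2.1 : ℕ)) (H a.1 a.2.2)) ((thetaOp n ^ (b.2.1 : ℕ)) (H b.1 b.2.2)) =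
      if a = b then fischerNorm n a.1 a.2.1 else 0 := by
  obtain ⟨⟨k, hk⟩, ⟨j, hj⟩, l⟩ := a
  obtain ⟨⟨k', hk'⟩, ⟨j', hj'⟩, l'⟩ := b
  have hk0 : k ≤ n := Nat.lt_succ_iff.1 hk
  have hk0' : k' ≤ n := Nat.lt_succ_iff.1 hk'
  simp only
  rw [form_thetaOp_pow (hH.lowest hk0 l) (hH.lowest hk0' l')]
  by_cases hkk : k = k'
  · subst hkk
    rw [hH.form_eq hk0]
    by_cases hjj : j = j'
    · subst hjj
      by_cases hl : l = l'
      · subst hl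
        rw [if_pos rfl, if_pos rfl, if_pos rfl, fischerNorm]
        have h3 := prod_ladder_mul_factorial (d := 4) (N := n - k) j (Nat.lt_succ_iff.1 hj)
        have hf : ∀ m : ℕ, ((m ! : ℕ) : ℂ) ≠ 0 := fun m => by exact_mod_cast m.factorial_ne_zero
        have := hf (n - k - j)
        have := hf (n - k)
        have : (2 : ℂ) ^ (n - k) ≠ 0 := pow_ne_zero _ two_ne_zero
        generalize ∏ m ∈ Finset.range j, (-4 * ((m : ℂ) + 1) * (-((n - k : ℕ) : ℂ) + m)) = p at h3 ⊢
        field_simp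
        linear_combination h3
      · rw [if_neg hl, mul_zero, if_pos rfl, if_neg]
        intro h
        simp only [Sigma.mk.injEq, heq_eq_eq, Prod.mk.injEq, true_and] at h
        exact hl h
    · rw [if_neg hjj, if_neg]
      intro h
      simp only [Sigma.mk.injEq, heq_eq_eq, Prod.mk.injEq, Fin.mk.injEq, true_and] at h
      exact hjj h.1
  · rw [form_eq_zero_of_weight_ne (hH.lowest hk0 l) (hH.lowest hk0' l')
      (by
        rw [ne_eq, neg_inj, Nat.cast_inj]
        omega), mul_zero, ite_self, if_neg]
    intro h
    have := congrArg (fun x : HermiteIndex n => (x.1 : ℕ)) h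
    exact hkk this

theorem IsOrthonormalFamily.span_fischer (hH : IsOrthonormalFamily H) :
    Submodule.span ℂ (Set.range fun a : HermiteIndex n =>
      (thetaOp n ^ (a.2.1 : ℕ)) (H a.1 a.2.2)) = ⊤ := by
  rw [eq_top_iff, ← fischerSpan_eq_top, fischerSpan, Submodule.span_le]
  rintro _ ⟨j, k, h, hk, hh, rfl⟩
  rcases Nat.lt_or_ge (n - k) j with hj | hj
  · have := isLowestWeight_of_mem_harmonics hh
    rw [← neg_sub, ← Nat.cast_sub hk] at this
    rw [thetaOp_pow_eq_zero this hj]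
    exact Submodule.zero_mem _
  · have h1 := Submodule.mem_map_of_mem (f := thetaOp n ^ j) (hH.harmonics_le_span hk hh)
    rw [Submodule.map_span, ← Set.range_comp] at h1
    refine Submodule.span_mono ?_ h1
    rintro _ ⟨l, rfl⟩
    exact ⟨⟨⟨k, Nat.lt_succ_iff.2 hk⟩, ⟨j, Nat.lt_succ_iff.2 hj⟩, l⟩, rfl⟩

theorem gam_pos (j k : ℕ) : 0 < gam n j k := by
  have hf : ∀ m : ℕ, (0 : ℝ) < (m ! : ℕ) := fun m => by exact_mod_cast m.factorial_pos
  exact div_pos (mul_pos (pow_pos (by norm_num) _) (hf j)) (hf _)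

theorem gam_ne_zero (j k : ℕ) : (gam n j k : ℂ) ≠ 0 := by
  exact_mod_cast (gam_pos j k).ne'

theorem IsOrthonormalFamily.form_hermiteFn (hH : IsOrthonormalFamily H) {k k' j j' : ℕ}
    (hk : k ≤ n) (hk' : k' ≤ n) (hj : j ≤ n - k)
    (l : Fin (Module.finrank ℂ (harmonics n k))) (l' : Fin (Module.finrank ℂ (harmonics n k'))) :
    form n (hermiteFn n j (H k l)) (hermiteFn n j' (H k' l')) =
      if j = j' ∧ (⟨k, l⟩ : Σ k, Fin (Module.finrank ℂ (harmonics n k))) = ⟨k', l'⟩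
      then (gam n j k : ℂ) else 0 := by
  rw [hermiteFn_eq, hermiteFn_eq, form_raising_pow (hH.lowest hk l) (hH.lowest hk' l')]
  by_cases hkk : k = k'
  · subst hkk
    rw [hH.form_gauss k hk]
    by_cases hjj : j = j'
    · subst hjj
      by_cases hl : l = l'
      · subst hl
        rw [if_pos rfl, if_pos rfl, if_pos ⟨rfl, rfl⟩, gam]
        have h3 := prod_ladder_mul_factorial (d := 16) (N := n - k) j hj
        have hf : ∀ m : ℕ, ((m ! : ℕ) : ℂ) ≠ 0 := fun m => by exact_mod_cast m.factorial_ne_zero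
        have := hf (n - k - j)
        have := hf (n - k)
        generalize ∏ m ∈ Finset.range j, (-16 * ((m : ℂ) + 1) * (-((n - k : ℕ) : ℂ) + m)) = p at h3 ⊢
        push_cast
        rw [pow_mul, show (4 : ℂ) ^ 2 = 16 by norm_num]
        field_simp
        linear_combination h3
      · rw [if_neg hl, mul_zero, if_pos rfl, if_neg]
        rintro ⟨-, h⟩
        simp only [Sigma.mk.injEq, heq_eq_eq, true_and] at h
        exact hl h
    · rw [if_neg hjj, if_neg fun h => hjj h.1]
  · rw [form_gauss_eq_zero (hH.lowest hk l) (hH.lowest hk' l')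
      (by
        rw [ne_eq, neg_inj, Nat.cast_inj]
        omega), mul_zero, ite_self, if_neg]
    rintro ⟨-, h⟩
    exact hkk (congrArg Sigma.fst h)

theorem IsOrthonormalFamily.form_hermiteIndex (hH : IsOrthonormalFamily H)
    (a b : HermiteIndex n) :
    form n (hermiteFn n a.2.1 (H a.1 a.2.2)) (hermiteFn n b.2.1 (H b.1 b.2.2)) =
      if a = b then (gam n a.2.1 a.1 : ℂ) else 0 := by
  rw [hH.form_hermiteFn (Nat.lt_succ_iff.1 a.1.2) (Nat.lt_succ_iff.1 b.1.2)
    (Nat.lt_succ_iff.1 a.2.1.2)]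
  obtain ⟨⟨k, hk⟩, ⟨j, hj⟩, l⟩ := a
  obtain ⟨⟨k', hk'⟩, ⟨j', hj'⟩, l'⟩ := b
  refine if_congr ⟨fun h => ?_, fun h => ?_⟩ rfl rfl
  · obtain ⟨h1, h2⟩ := h
    simp only at h1
    obtain rfl : k = k' := congrArg Sigma.fst h2
    simp only [Sigma.mk.injEq, heq_eq_eq, true_and] at h2
    subst h1 h2
    rfl
  · obtain rfl : k = k' := congrArg (fun x : HermiteIndex n => (x.1 : ℕ)) h
    simp only [Sigma.mk.injEq, heq_eq_eq, Prod.mk.injEq, Fin.mk.injEq, true_and] at h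
    obtain ⟨rfl, rfl⟩ := h
    exact ⟨rfl, rfl⟩

/-- The Hermite functions are independent, and their index set is that of the Fischer basis, so its
size is the full dimension. -/
theorem IsOrthonormalFamily.span_hermiteFn (hH : IsOrthonormalFamily H) :
    Submodule.span ℂ (Set.range fun a : HermiteIndex n => hermiteFn n a.2.1 (H a.1 a.2.2)) =
      ⊤ := by
  refine (linearIndependent_of_orthogonal (fun a => gam_ne_zero _ _)
    hH.form_hermiteIndex).span_eq_top_of_card_eq_finrank' ?_
  have h := linearIndependent_of_orthogonal (fun a => fischerNorm_ne_zero _ _) hH.form_fischer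
  exact (Module.finrank_eq_card_basis (Module.Basis.mk h hH.span_fischer.ge)).symm

end HermiteBasis

/-! ### Two sets of variables and the exponential kernel. -/

section TwoVariables

variable {n : ℕ}

/-- The bilinear map `(f, g) ↦ f(x) g(y)`. -/
def kap (n : ℕ) : Gr n →ₗ[ℂ] Gr n →ₗ[ℂ] Gr2 n :=
  (LinearMap.mul ℂ (Gr2 n)).compl₁₂ (inX n).toLinearMap (inY n).toLinearMap

theorem kap_apply (f g : Gr n) : kap n f g = inX n f * inY n g := rfl

theorem inX_gen (i : Fin (2 * n)) :
    inX n (gen i) = ExteriorAlgebra.ι ℂ ((Pi.single i 1, 0) : (Fin (2 * n) → ℂ) × _) := by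
  simp [inX, gen]

theorem inY_gen (i : Fin (2 * n)) :
    inY n (gen i) = ExteriorAlgebra.ι ℂ ((0, Pi.single i 1) : (Fin (2 * n) → ℂ) × _) := by
  simp [inY, gen]

theorem thX_commute (f : Gr2 n) : Commute (thX n) f := by
  unfold thX thetaSq
  rw [map_neg, map_sum]
  refine (Commute.sum_left _ _ _ fun j _ => ?_).neg_left
  rw [map_mul, inX_gen, inX_gen]
  exact ι_mul_ι_commute _ _ f

theorem thY_commute (f : Gr2 n) : Commute (thY n) f := by
  unfold thY thetaSq
  rw [map_neg, map_sum]
  refine (Commute.sum_left _ _ _ fun j _ => ?_).neg_left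
  rw [map_mul, inY_gen, inY_gen]
  exact ι_mul_ι_commute _ _ f

theorem pair_commute (f : Gr2 n) : Commute (pair n) f := by
  unfold pair
  refine (Commute.sum_left _ _ _ fun j _ => ?_).smul_left _
  rw [inX_gen, inX_gen, inY_gen, inY_gen]
  exact (ι_mul_ι_commute _ _ f).sub_left (ι_mul_ι_commute _ _ f)

theorem thX_isNilpotent : IsNilpotent (thX n) := thetaSq_isNilpotent.map (inX n)

theorem thY_isNilpotent : IsNilpotent (thY n) := thetaSq_isNilpotent.map (inY n)

theorem pair_isNilpotent : IsNilpotent (pair n) := by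
  unfold pair
  refine smul_isNilpotent (Commute.isNilpotent_sum (fun j _ => ?_) fun i j _ _ => ?_) _
  · rw [inX_gen, inX_gen, inY_gen, inY_gen]
    exact Commute.isNilpotent_sub (ι_mul_ι_commute _ _ _) (ι_mul_ι_isNilpotent _ _)
      (ι_mul_ι_isNilpotent _ _)
  · rw [inX_gen, inX_gen, inY_gen, inY_gen]
    exact (ι_mul_ι_commute _ _ _).sub_left (ι_mul_ι_commute _ _ _)

theorem inX_thetaOp_pow (j : ℕ) (f : Gr n) : inX n ((thetaOp n ^ j) f) = thX n ^ j * inX n f := by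
  rw [thetaOp_pow_apply, map_mul, map_pow, thX]

theorem inY_thetaOp_pow (j : ℕ) (f : Gr n) : inY n ((thetaOp n ^ j) f) = thY n ^ j * inY n f := by
  rw [thetaOp_pow_apply, map_mul, map_pow, thY]

theorem exists_tilde_gen_eq_ι (i : Fin (2 * n)) :
    ∃ v, tilde n (gen i) = ExteriorAlgebra.ι ℂ v := by
  obtain ⟨j, rfl | rfl⟩ := exists_fstIdx_or_sndIdx i
  · exact ⟨_, (tilde_gen j).1⟩
  · exact ⟨-Pi.single (fstIdx j) 1, by rw [(tilde_gen j).2, gen, map_neg]⟩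

theorem exists_inX_tilde_gen_mul_inY_gen (i : Fin (2 * n)) :
    ∃ v w, inX n (tilde n (gen i)) * inY n (gen i) =
      ExteriorAlgebra.ι ℂ v * ExteriorAlgebra.ι ℂ w := by
  obtain ⟨v, hv⟩ := exists_tilde_gen_eq_ι i
  exact ⟨(v, 0), (0, Pi.single i 1), by rw [hv, inY_gen]; simp [inX]⟩

/-- Because `tilde` reverses products, the factors of `x̃_A(x) x_A(y)` nest, with each `x̃_i` next
to its `y_i`. These products are central with square zero, so the sum over subsets is a product of
factors `1 + t x̃_i y_i`, each an exponential. -/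
theorem sum_powerset_kap_tilde (t : ℂ) (s : Finset (Fin (2 * n))) :
    ∑ A ∈ s.powerset, t ^ A.card • kap n (tilde n (mono n A)) (mono n A) =
      IsNilpotent.exp (∑ i ∈ s, t • (inX n (tilde n (gen i)) * inY n (gen i))) := by
  have hcomm : ∀ i f, Commute (inX n (tilde n (gen i)) * inY n (gen i)) f := by
    intro i f
    obtain ⟨v, w, h⟩ := exists_inX_tilde_gen_mul_inY_gen i
    rw [h]
    exact ι_mul_ι_commute v w f
  have hsq : ∀ i, (t • (inX n (tilde n (gen i)) * inY n (gen i))) ^ 2 = 0 := by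
    intro i
    obtain ⟨v, w, h⟩ := exists_inX_tilde_gen_mul_inY_gen i
    rw [h, smul_pow, ι_mul_ι_sq, smul_zero]
  induction s using Finset.induction_on_min with
  | empty =>
    rw [Finset.powerset_empty, Finset.sum_singleton, Finset.sum_empty, IsNilpotent.exp_zero,
      mono_empty, tilde_one, kap_apply, map_one, map_one]
    simp
  | insert a s ha ih =>
    have has : a ∉ s := fun h => lt_irrefl _ (ha a h)
    have hS : IsNilpotent (∑ i ∈ s, t • (inX n (tilde n (gen i)) * inY n (gen i))) :=
      Commute.isNilpotent_sum (fun i _ => ⟨2, hsq i⟩)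
        fun i j _ _ => ((hcomm i _).smul_left t)
    rw [Finset.sum_powerset_insert has, Finset.sum_insert has,
      IsNilpotent.exp_add_of_commute ((hcomm a _).smul_left t) ⟨2, hsq a⟩ hS,
      exp_eq_complex_sum (hsq a), ← ih]
    simp only [Finset.sum_range_succ, Finset.sum_range_zero, zero_add, pow_zero, pow_one,
      Nat.factorial_zero, Nat.factorial_one, Nat.cast_one, inv_one, one_smul, add_mul, one_mul]
    congr 1
    rw [Finset.mul_sum]
    refine Finset.sum_congr rfl fun A hA => ?_
    have hA' := Finset.mem_powerset.1 hA
    rw [mono_insert_of_lt (fun x hx => ha x (hA' hx)),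
      Finset.card_insert_of_notMem (fun h => has (hA' h)), tilde_mul, kap_apply, map_mul, map_mul,
      kap_apply, mul_assoc, ← mul_assoc (inX n (tilde n (gen a))), ← mul_assoc,
      ← (hcomm a (inX n (tilde n (mono n A)))).eq, mul_assoc, pow_succ, mul_smul]
    simp only [smul_mul_assoc, mul_smul_comm]

theorem sum_inX_tilde_gen_mul_inY_gen :
    ∑ i, inX n (tilde n (gen i)) * inY n (gen i) = (2 : ℂ) • pair n := by
  rw [sum_fstIdx_add_sndIdx, pair, smul_smul]
  simp only [(tilde_gen _).1, (tilde_gen _).2, map_neg, neg_mul]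
  rw [Finset.smul_sum]
  refine Finset.sum_congr rfl fun j _ => ?_
  module

/-- The scaling `f(x) ↦ f(s x)`. -/
def scaling (n : ℕ) (s : ℂ) : Gr n →ₐ[ℂ] Gr n := ExteriorAlgebra.map (s • LinearMap.id)

theorem scaling_gen (s : ℂ) (i : Fin (2 * n)) : scaling n s (gen i) = s • gen i := by
  simp [scaling, gen]

theorem scaling_mono (s : ℂ) (A : Finset (Fin (2 * n))) :
    scaling n s (mono n A) = s ^ A.card • mono n A := by
  induction A using Finset.induction_on_min with
  | empty => simp [mono_empty]
  | insert a A ha ih =>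
    rw [mono_insert_of_lt ha, map_mul, scaling_gen, ih,
      Finset.card_insert_of_notMem (fun h => lt_irrefl _ (ha a h)), pow_succ']
    rw [smul_mul_smul_comm]

theorem scaling_of_euler (s : ℂ) {k : ℕ} {f : Gr n} (hf : euler n f = (k : ℂ) • f) :
    scaling n s f = s ^ k • f := by
  conv_lhs => rw [← (mono n).sum_repr f]
  conv_rhs => rw [← (mono n).sum_repr f]
  rw [map_sum, Finset.smul_sum]
  refine Finset.sum_congr rfl fun A _ => ?_
  by_cases hA : A.card = k
  · rw [map_smul, scaling_mono, hA, smul_comm]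
  · rw [repr_eq_zero_of_euler hf (by exact_mod_cast hA), zero_smul, map_zero, smul_zero]

/-- The inverse squared norm of `x_A` is `(2π)^n 2^{-|A|}`, which calls for the parameter `s / 2`;
the exponent is then `s / 2` times `2⟨x,y⟩`. -/
theorem casimir_tilde_scaling (s : ℂ) :
    casimir ((kap n).compl₁₂ (tilde n) (scaling n s).toLinearMap) =
      (2 * Real.pi : ℂ) ^ n • IsNilpotent.exp (s • pair n) := by
  have h1 := sum_powerset_kap_tilde (n := n) (s / 2) Finset.univ
  have h2 : ∑ i, (s / 2) • (inX n (tilde n (gen i)) * inY n (gen i)) = s • pair n := by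
    rw [← Finset.smul_sum, sum_inX_tilde_gen_mul_inY_gen, smul_smul]
    norm_num
  rw [h2, Finset.powerset_univ] at h1
  rw [← h1, casimir, Finset.smul_sum]
  refine Finset.sum_congr rfl fun A _ => ?_
  rw [LinearMap.compl₁₂_apply, AlgHom.toLinearMap_apply, scaling_mono, map_smul, smul_smul,
    smul_smul, monoNorm]
  congr 1
  have hpi : (Real.pi : ℂ) ≠ 0 := by exact_mod_cast Real.pi_ne_zero
  push_cast
  rw [zpow_sub₀ two_ne_zero, zpow_natCast, zpow_natCast, div_pow, mul_pow]
  field_simp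

end TwoVariables

/-! ### Comparison of coefficients and a hypergeometric sum. -/

section CoefficientExtraction

/-- Linear functionals separate points, and after applying one this is an identity of polynomials in
`s`. -/
theorem eq_of_forall_sum_pow_smul_eq {M : Type*} [AddCommGroup M] [Module ℂ M] {N : ℕ}
    {a b : ℕ → M} (h : ∀ s : ℂ, ∑ m ∈ Finset.range N, s ^ m • a m =
      ∑ m ∈ Finset.range N, s ^ m • b m) {m : ℕ} (hm : m < N) : a m = b m := by
  rw [← sub_eq_zero, ← Module.forall_dual_apply_eq_zero_iff ℂ]
  intro L
  let p : Polynomial ℂ := ∑ m ∈ Finset.range N, Polynomial.monomial m (L (a m) - L (b m))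
  have hp : p = 0 := by
    refine Polynomial.funext fun s => ?_
    have := congrArg L (h s)
    simp only [map_sum, map_smul, smul_eq_mul] at this
    rw [Polynomial.eval_finsetSum]
    simp only [Polynomial.eval_monomial, mul_comm _ (s ^ _), mul_sub, Finset.sum_sub_distrib,
      Polynomial.eval_zero, this, sub_self]
  have := congrArg (fun q => Polynomial.coeff q m) hp
  simpa [p, Polynomial.finsetSum_coeff, Polynomial.coeff_monomial, hm] using this

/-- Partial sums of the hypergeometric sum that inverts the Fischer decomposition. -/
theorem sum_range_fischer_coeff (N r : ℕ) (hr : 0 < r) (J : ℕ) (hJ : J ≤ r) :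
    ∑ j ∈ Finset.range (J + 1), (-1 : ℂ) ^ j * (N + j)! * (N + 1 + 2 * j) /
      (j ! * (r - j)! * (N + 1 + r + j)!) =
      if J = r then 0 else ((-1 : ℂ) ^ J * (N + J + 1)! / ((r : ℂ) * (J ! * (r - J - 1)! *
        (N + r + J + 1)!))) := by
  have hf : ∀ m : ℕ, ((m ! : ℕ) : ℂ) ≠ 0 := fun m => by exact_mod_cast m.factorial_ne_zero
  have hs : ∀ m : ℕ, (m : ℂ) + 1 ≠ 0 := fun m => by exact_mod_cast m.succ_ne_zero
  -- The sum telescopes: adding the next term to the closed form reproduces it, down to zero at `J =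
  -- r`.
  induction J with
  | zero =>
    obtain ⟨q, rfl⟩ := Nat.exists_eq_add_of_le' hr
    rw [if_neg (by omega)]
    have e1 : q + 1 - 0 - 1 = q := by omega
    have e2 : N + (q + 1) + 0 + 1 = N + 1 + (q + 1) := by omega
    simp only [zero_add, Finset.sum_range_one, e2, add_zero, Nat.sub_zero, pow_zero,
      Nat.factorial_zero, Nat.cast_zero, mul_zero, Nat.cast_one]
    rw [Nat.factorial_succ q, Nat.factorial_succ N]
    have := hf q; have := hs q; have := hf (N + 1 + (q + 1)); have := hf N
    push_cast
    field_simp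
  | succ J ih =>
    obtain ⟨q, rfl⟩ := Nat.exists_eq_add_of_le hJ
    rw [Finset.sum_range_succ, ih (by omega), if_neg (by omega)]
    have e1 : J + 1 + q - J - 1 = q := by omega
    have e2 : J + 1 + q - (J + 1) = q := by omega
    have e3 : N + (J + 1 + q) + J + 1 = N + 2 * J + q + 2 := by omega
    have e4 : N + 1 + (J + 1 + q) + (J + 1) = N + 2 * J + q + 2 + 1 := by omega
    have e5 : N + (J + 1) = N + J + 1 := by omega
    rw [e1, e2, e3, e4, e5, Nat.factorial_succ (N + 2 * J + q + 2), Nat.factorial_succ J, pow_succ]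
    have := hf q; have := hf J; have := hf (N + 2 * J + q + 2); have := hf (N + J + 1)
    have := hs J
    have h3 : (N : ℂ) + J * 2 + q + 2 + 1 ≠ 0 := by exact_mod_cast (N + J * 2 + q + 2).succ_ne_zero
    have h4 : (J : ℂ) + 1 + q ≠ 0 := by
      have := hs (J + q)
      push_cast at this
      rwa [add_right_comm]
    split_ifs with hq
    · obtain rfl : q = 0 := by omega
      push_cast
      simp only [Nat.cast_zero, add_zero] at h3 h4 ⊢
      field_simp
      ring
    · obtain ⟨p, rfl⟩ : ∃ p, q = p + 1 := ⟨q - 1, by omega⟩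
      have e6 : p + 1 - 1 = p := by omega
      have e7 : N + (J + 1 + (p + 1)) + (J + 1) + 1 = N + 2 * J + (p + 1) + 2 + 1 := by omega
      have := hf p; have := hs p
      rw [e6, e7, Nat.factorial_succ (N + 2 * J + (p + 1) + 2), Nat.factorial_succ p,
        Nat.factorial_succ (N + J + 1)]
      push_cast at h3 h4 ⊢
      field_simp
      ring

/-- The orthogonality relation that inverts the triangular system of `pair_pow`. -/
theorem sum_fischer_coeff (N r : ℕ) :
    ∑ j ∈ Finset.range (r + 1), (-1 : ℂ) ^ j * (N + j)! * (N + 1 + 2 * j) /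
      (j ! * (r - j)! * (N + 1 + r + j)!) = if r = 0 then 1 else 0 := by
  rcases Nat.eq_zero_or_pos r with rfl | hr
  · have hf : (((N + 1)! : ℕ) : ℂ) ≠ 0 := by exact_mod_cast (N + 1).factorial_ne_zero
    rw [if_pos rfl]
    simp only [zero_add, Finset.sum_range_one, pow_zero, add_zero, Nat.cast_zero, mul_zero,
      Nat.sub_self, Nat.factorial_zero, Nat.cast_one]
    rw [div_eq_one_iff_eq (by simpa using hf), Nat.factorial_succ]
    push_cast
    ring
  · rw [sum_range_fischer_coeff N r hr r le_rfl, if_pos rfl, if_neg hr.ne']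

end CoefficientExtraction

/-! ### The reproducing kernels `F_k`. -/

section ReproducingKernel

variable {n : ℕ} {H : HarmonicFamily n}

theorem tilde_thetaOp_pow (j : ℕ) (f : Gr n) :
    tilde n ((thetaOp n ^ j) f) = (-1 : ℂ) ^ j • (thetaOp n ^ j) (tilde n f) := by
  induction j with
  | zero => simp
  | succ j ih =>
    have h := LinearMap.congr_fun (tilde_mul_thetaOp (n := n)) ((thetaOp n ^ j) f)
    simp only [Module.End.mul_apply, LinearMap.neg_apply] at h
    rw [pow_succ', Module.End.mul_apply, h, ih, map_smul, pow_succ', Module.End.mul_apply]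
    module

theorem euler_thetaOp_pow {k : ℕ} {f : Gr n} (hf : euler n f = (k : ℂ) • f) (j : ℕ) :
    euler n ((thetaOp n ^ j) f) = ((2 * j + k : ℕ) : ℂ) • (thetaOp n ^ j) f := by
  induction j with
  | zero => simp [hf]
  | succ j ih =>
    rw [pow_succ', Module.End.mul_apply, euler_thetaOp ih]
    congr 1
    push_cast
    ring

/-- The canonical element of `casimir_tilde_scaling` computed in the Fischer basis: scaling gives
`s^{2j+k}`, and `tilde` gives the sign `(-1)^j`. -/
theorem IsOrthonormalFamily.generating_function (hH : IsOrthonormalFamily H) (s : ℂ) :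
    ∑ k ∈ Finset.range (n + 1), ∑ j ∈ Finset.range (n - k + 1),
      s ^ (2 * j + k) • ((fischerNorm n k j)⁻¹ * (-1) ^ j) •
        (thX n ^ j * thY n ^ j * reprKernel n H k) =
      (2 * Real.pi : ℂ) ^ n • IsNilpotent.exp (s • pair n) := by
  rw [← casimir_tilde_scaling, ← sum_orthogonal_eq_casimir
    (fun a : HermiteIndex n => fischerNorm_ne_zero _ _) hH.form_fischer hH.span_fischer,
    sum_hermiteIndex (fun k j l => (fischerNorm n k j)⁻¹ •
      (kap n).compl₁₂ (tilde n) (scaling n s).toLinearMap ((thetaOp n ^ j) (H k l))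
        ((thetaOp n ^ j) (H k l)))]
  refine Finset.sum_congr rfl fun k hk => Finset.sum_congr rfl fun j _ => ?_
  have hk' : k ≤ n := Nat.lt_succ_iff.1 (Finset.mem_range.1 hk)
  rw [reprKernel, Finset.mul_sum, Finset.smul_sum, Finset.smul_sum]
  refine Finset.sum_congr rfl fun l _ => ?_
  rw [LinearMap.compl₁₂_apply, AlgHom.toLinearMap_apply, scaling_of_euler s (euler_thetaOp_pow
    (mem_harmonics_iff.1 (hH.mem k hk' l)).2 j), tilde_thetaOp_pow, map_smul, map_smul,
    LinearMap.smul_apply, kap_apply, inX_thetaOp_pow, inY_thetaOp_pow, smul_smul, smul_smul,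
    smul_smul]
  congr 1
  · ring
  · rw [mul_assoc, mul_assoc, ← mul_assoc (inX n (tilde n (H k l))),
      ← ((thY_commute (inX n (tilde n (H k l)))).pow_left j).eq, mul_assoc]

/-- This is the coefficient of `s^m`. For `m ≤ n` and `k = m - 2j` the bound `j ≤ n - k` cuts off
nothing. -/
theorem IsOrthonormalFamily.pair_pow (hH : IsOrthonormalFamily H) {m : ℕ} (hm : m ≤ n) :
    ∑ j ∈ Finset.range (m / 2 + 1), ((-1 : ℂ) ^ j * (n - m + j)! * 2 ^ (n - m) / j !) •
      (thX n ^ j * thY n ^ j * reprKernel n H (m - 2 * j)) =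
      ((2 * Real.pi : ℂ) ^ n / m !) • pair n ^ m := by
  obtain ⟨M, hM⟩ := pair_isNilpotent (n := n)
  set a : ℕ → ℕ → Gr2 n := fun k j => ((fischerNorm n k j)⁻¹ * (-1) ^ j) •
        (thX n ^ j * thY n ^ j * reprKernel n H k) with ha
  -- The length exceeds every exponent `2j + k ≤ 2n` and lies beyond the nilpotency order `M` of
  -- `⟨x,y⟩`.
  have h1 : ∀ s : ℂ, ∑ i ∈ Finset.range (2 * n + 1 + M), s ^ i •
      (∑ k ∈ Finset.range (n + 1), ∑ j ∈ Finset.range (n - k + 1),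
        if 2 * j + k = i then a k j else 0) =
      ∑ i ∈ Finset.range (2 * n + 1 + M), s ^ i • (((2 * Real.pi : ℂ) ^ n / i !) • pair n ^ i) := by
    intro s
    have hM' : (s • pair n) ^ (2 * n + 1 + M) = 0 := by
      rw [smul_pow, pow_add (pair n), hM, mul_zero, smul_zero]
    have h := hH.generating_function s
    rw [exp_eq_complex_sum hM', Finset.smul_sum] at h
    simp only [Finset.smul_sum]
    rw [Finset.sum_comm]
    refine Eq.trans ?_ (h.trans ?_)
    · refine Finset.sum_congr rfl fun k hk => ?_
      rw [Finset.sum_comm]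
      refine Finset.sum_congr rfl fun j hj => ?_
      rw [Finset.mem_range] at hk hj
      simp only [smul_ite, smul_zero]
      rw [Finset.sum_ite_eq, if_pos (Finset.mem_range.2 (by omega))]
    · refine Finset.sum_congr rfl fun i _ => ?_
      rw [smul_pow, smul_smul, smul_smul, smul_smul]
      congr 1
      ring
  have h2 := eq_of_forall_sum_pow_smul_eq h1 (m := m) (by omega)
  rw [← h2]
  simp only [← Finset.sum_filter]
  rw [Finset.sum_sigma' (Finset.range (n + 1))]
  refine Finset.sum_nbij' (fun j => ⟨m - 2 * j, j⟩) (fun x => x.2) ?_ ?_ ?_ ?_ ?_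
  · intro j hj
    simp only [Finset.mem_sigma, Finset.mem_filter, Finset.mem_range] at hj ⊢
    omega
  · rintro ⟨k, j⟩ hj
    simp only [Finset.mem_sigma, Finset.mem_filter, Finset.mem_range] at hj ⊢
    omega
  · intro j _
    rfl
  · rintro ⟨k, j⟩ hj
    simp only [Finset.mem_sigma, Finset.mem_filter, Finset.mem_range] at hj
    obtain rfl : k = m - 2 * j := by omega
    rfl
  · intro j hj
    rw [Finset.mem_range] at hj
    simp only [ha]
    congr 1
    obtain ⟨i, rfl⟩ : ∃ i, m = i + 2 * j := ⟨m - 2 * j, by omega⟩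
    obtain ⟨N, rfl⟩ := Nat.exists_eq_add_of_le hm
    rw [fischerNorm, show i + 2 * j + N - (i + 2 * j) = N by omega,
      show i + 2 * j - 2 * j = i by omega, show i + 2 * j + N - i - j = N + j by omega,
      show i + 2 * j + N - i = N + 2 * j by omega, pow_add, pow_mul]
    have hf : ∀ m : ℕ, ((m ! : ℕ) : ℂ) ≠ 0 := fun m => by exact_mod_cast m.factorial_ne_zero
    have := hf j
    have := hf (N + j)
    norm_num
    field_simp

/-- By `pair_pow` the kernels solve a triangular system with nonzero diagonal, and `key` shows that
the claimed expressions `G` solve it as well. Strong induction on `k` identifies the two. -/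
theorem IsOrthonormalFamily.reprKernel_eq (hH : IsOrthonormalFamily H) (k : ℕ) (hk : k ≤ n) :
    reprKernel n H k = ∑ j ∈ Finset.range (k / 2 + 1),
      ((2 : ℂ) ^ (k - 2 * j) * Real.pi ^ n * (n + 1 - k) /
        ((k - 2 * j)! * j ! * (n + 1 + j - k)!)) •
        (pair n ^ (k - 2 * j) * thX n ^ j * thY n ^ j) := by
  induction k using Nat.strong_induction_on with
  | _ k ih =>
    have hf : ∀ m : ℕ, ((m ! : ℕ) : ℂ) ≠ 0 := fun m => by exact_mod_cast m.factorial_ne_zero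
    set G : ℕ → Gr2 n := fun k => ∑ j ∈ Finset.range (k / 2 + 1),
      ((2 : ℂ) ^ (k - 2 * j) * Real.pi ^ n * (n + 1 - k) /
        ((k - 2 * j)! * j ! * (n + 1 + j - k)!)) •
        (pair n ^ (k - 2 * j) * thX n ^ j * thY n ^ j) with hG
    change reprKernel n H k = G k
    have key : ∑ j ∈ Finset.range (k / 2 + 1), ((-1 : ℂ) ^ j * (n - k + j)! * 2 ^ (n - k) / j !) •
        (thX n ^ j * thY n ^ j * G (k - 2 * j)) = ((2 * Real.pi : ℂ) ^ n / k !) • pair n ^ k := by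
      obtain ⟨N, rfl⟩ := Nat.exists_eq_add_of_le hk
      -- With `N = n - k`, the inner sum is reindexed by the total power `r = j + i` of `θ² θ_y²`;
      -- the sum over `j` then becomes `sum_fischer_coeff`.
      have h1 : ∀ j ∈ Finset.range (k / 2 + 1),
          ((-1 : ℂ) ^ j * (k + N - k + j)! * 2 ^ (k + N - k) / j !) •
            (thX (k + N) ^ j * thY (k + N) ^ j * G (k - 2 * j)) =
          ∑ r ∈ Finset.range (k / 2 + 1), if j ≤ r then
            (((-1 : ℂ) ^ j * (N + j)! * (N + 1 + 2 * j) / (j ! * (r - j)! * (N + 1 + r + j)!)) *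
              (2 ^ N * 2 ^ (k - 2 * r) * Real.pi ^ (k + N) / (k - 2 * r)!)) •
              (pair (k + N) ^ (k - 2 * r) * thX (k + N) ^ r * thY (k + N) ^ r) else 0 := by
        intro j hj
        rw [Finset.mem_range] at hj
        rw [← Finset.sum_filter, hG, Finset.mul_sum, Finset.smul_sum]
        refine Finset.sum_nbij' (fun i => j + i) (fun r => r - j) ?_ ?_ ?_ ?_ ?_
        · intro i hi
          simp only [Finset.mem_filter, Finset.mem_range] at hi ⊢
          omega
        · intro r hr
          simp only [Finset.mem_filter, Finset.mem_range] at hr ⊢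
          omega
        · intro i _
          omega
        · intro r hr
          simp only [Finset.mem_filter, Finset.mem_range] at hr
          omega
        · intro i hi
          rw [Finset.mem_range] at hi
          rw [mul_smul_comm, smul_smul]
          have e1 : k + N + 1 + i - (k - 2 * j) = N + 1 + (j + i) + j := by omega
          have e2 : k - 2 * j - 2 * i = k - 2 * (j + i) := by omega
          have e3 : ((k - 2 * j : ℕ) : ℂ) = k - 2 * j := by
            rw [Nat.cast_sub (by omega)]; push_cast; ring
          rw [e1, e2, e3, Nat.add_sub_cancel_left, Nat.add_sub_cancel_left]
          congr 1
          · have := hf j; have := hf i; have := hf (N + 1 + (j + i) + j)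
            have := hf (k - 2 * (j + i))
            push_cast
            field_simp
            ring
          · rw [pow_add (thX (k + N)), pow_add (thY (k + N)),
              mul_assoc (pair (k + N) ^ _) (thX (k + N) ^ i),
              ← ((pair_commute (n := k + N) _).pow_left _).left_comm, mul_assoc (pair (k + N) ^ _)]
            congr 1
            rw [mul_assoc, mul_assoc, ((thY_commute (thX (k + N) ^ i)).pow_left j).left_comm]
      rw [Finset.sum_congr rfl h1, Finset.sum_comm]
      have h2 : ∀ r ∈ Finset.range (k / 2 + 1), ∑ j ∈ Finset.range (k / 2 + 1), (if j ≤ r then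
            (((-1 : ℂ) ^ j * (N + j)! * (N + 1 + 2 * j) / (j ! * (r - j)! * (N + 1 + r + j)!)) *
              (2 ^ N * 2 ^ (k - 2 * r) * Real.pi ^ (k + N) / (k - 2 * r)!)) •
              (pair (k + N) ^ (k - 2 * r) * thX (k + N) ^ r * thY (k + N) ^ r) else 0) =
          if r = 0 then ((2 * Real.pi : ℂ) ^ (k + N) / k !) • pair (k + N) ^ k else 0 := by
        intro r hr
        rw [Finset.mem_range] at hr
        have e : Finset.filter (fun j => j ≤ r) (Finset.range (k / 2 + 1)) =
            Finset.range (r + 1) := by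
          ext j
          simp only [Finset.mem_filter, Finset.mem_range]
          omega
        rw [← Finset.sum_filter, e, ← Finset.sum_smul, ← Finset.sum_mul, sum_fischer_coeff]
        split_ifs with h
        · subst h
          simp only [mul_zero, Nat.sub_zero, pow_zero, mul_one, one_mul]
          congr 1
          rw [mul_pow, pow_add 2]
          ring
        · rw [zero_mul, zero_smul]
      rw [Finset.sum_congr rfl h2, Finset.sum_ite_eq', if_pos (by simp)]
    -- By induction the two systems agree in all terms except `j = 0`, whose coefficient can be
    -- cancelled.
    have h3 := (hH.pair_pow hk).trans key.symm
    rw [Finset.sum_range_succ', Finset.sum_range_succ'] at h3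
    have h4 : ∀ j ∈ Finset.range (k / 2),
        ((-1 : ℂ) ^ (j + 1) * (n - k + (j + 1))! * 2 ^ (n - k) / (j + 1)!) •
          (thX n ^ (j + 1) * thY n ^ (j + 1) * reprKernel n H (k - 2 * (j + 1))) =
        ((-1 : ℂ) ^ (j + 1) * (n - k + (j + 1))! * 2 ^ (n - k) / (j + 1)!) •
          (thX n ^ (j + 1) * thY n ^ (j + 1) * G (k - 2 * (j + 1))) := by
      intro j hj
      rw [Finset.mem_range] at hj
      rw [ih (k - 2 * (j + 1)) (by omega) (by omega)]
    rw [Finset.sum_congr rfl h4, add_right_inj] at h3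
    have h5 : ((-1 : ℂ) ^ 0 * (n - k + 0)! * 2 ^ (n - k) / (0 : ℕ)!) ≠ 0 := by
      have h6 := hf (n - k)
      have h7 : (2 : ℂ) ^ (n - k) ≠ 0 := pow_ne_zero _ two_ne_zero
      simp [h6]
    simpa using smul_right_injective _ h5 h3

/-- Converts the Pochhammer symbols of the Gegenbauer polynomial at the negative parameter `-n - 1`
into the factorials of `reprKernel_eq`. -/
theorem ascPochhammer_eval_neg_mul_factorial (n m : ℕ) (hm : m ≤ n + 1) :
    (ascPochhammer ℂ m).eval (-(n : ℂ) - 1) * (n + 1 - m)! = (-1) ^ m * (n + 1)! := by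
  induction m with
  | zero => simp
  | succ m ih =>
    obtain ⟨r, hr⟩ := Nat.exists_eq_add_of_le hm
    have h1 := ih (by omega)
    have e1 : n + 1 - m = r + 1 := by omega
    have e2 : n + 1 - (m + 1) = r := by omega
    have e3 : (n : ℂ) + 1 = m + 1 + r := by exact_mod_cast hr
    rw [e1, Nat.factorial_succ] at h1
    rw [ascPochhammer_succ_eval, e2, pow_succ, show -(n : ℂ) - 1 + m = -(r + 1) by
      linear_combination -e3]
    push_cast at h1 ⊢
    linear_combination -h1

theorem gegenbauer_coeff (a : ℂ) {k j : ℕ} (hj : j ≤ k / 2) :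
    (gegenbauer a k).coeff (k - 2 * j) =
      (-1) ^ j * (ascPochhammer ℂ (k - j)).eval a / (j ! * (k - 2 * j)!) * 2 ^ (k - 2 * j) := by
  rw [gegenbauer, Polynomial.finsetSum_coeff, Finset.sum_eq_single j]
  · rw [mul_pow, ← mul_assoc, ← Polynomial.C_pow, ← Polynomial.C_mul,
      Polynomial.coeff_C_mul_X_pow, if_pos rfl]
  · intro i hi hij
    rw [mul_pow, ← mul_assoc, ← Polynomial.C_pow, ← Polynomial.C_mul,
      Polynomial.coeff_C_mul_X_pow, if_neg]
    rw [Finset.mem_range] at hi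
    omega
  · intro h
    exact absurd (Finset.mem_range.2 (by omega)) h

theorem IsOrthonormalFamily.reprKernel_eq_gegenbauer (hH : IsOrthonormalFamily H) (k : ℕ)
    (hk : k ≤ n) : reprKernel n H k = ((Real.pi : ℂ) ^ n * (-1) ^ k * (n + 1 - k) / (n + 1)!) •
      ∑ j ∈ Finset.range (k / 2 + 1), (gegenbauer (-(n : ℂ) - 1) k).coeff (k - 2 * j) •
        (pair n ^ (k - 2 * j) * (thX n * thY n) ^ j) := by
  rw [hH.reprKernel_eq k hk, Finset.smul_sum]
  refine Finset.sum_congr rfl fun j hj => ?_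
  have hj' : j ≤ k / 2 := Nat.lt_succ_iff.1 (Finset.mem_range.1 hj)
  have hf : ∀ m : ℕ, ((m ! : ℕ) : ℂ) ≠ 0 := fun m => by exact_mod_cast m.factorial_ne_zero
  rw [(thX_commute (thY n)).mul_pow, ← mul_assoc, gegenbauer_coeff _ hj', smul_smul]
  congr 1
  have h := ascPochhammer_eval_neg_mul_factorial n (k - j) (by omega)
  have e1 : n + 1 - (k - j) = n + 1 + j - k := by omega
  rw [e1] at h
  have h2 : (-1 : ℂ) ^ (k - j) * (-1) ^ j * (-1) ^ k = 1 := by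
    rw [← pow_add, Nat.sub_add_cancel (by omega), ← mul_pow]; simp
  have := hf j; have := hf (k - 2 * j); have := hf (n + 1); have := hf (n + 1 + j - k)
  field_simp
  linear_combination ((n : ℂ) + 1 - k) *
    ((-(-1 : ℂ) ^ k * (-1) ^ j) * h - (((n + 1)! : ℕ) : ℂ) * h2)

end ReproducingKernel

/-! ### The fermionic Fourier transform. -/

section FourierTransform

variable {n : ℕ}

/-- The fermionic Fourier transform, normalized such that `tilde ∘ fourier = hodge`. -/
def fourier (n : ℕ) : Module.End ℂ (Gr n) := tilde n ∘ₗ parity n ∘ₗ hodge n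

theorem fourier_apply (f : Gr n) : fourier n f = tilde n (parity n (hodge n f)) := rfl

theorem tilde_fourier (f : Gr n) : tilde n (fourier n f) = hodge n f := by
  rw [fourier_apply, tilde_tilde, parity_parity]

theorem tilde_injective : Function.Injective (tilde n) := fun f g h => by
  have := congrArg (fun u => tilde n u) h
  simp only [tilde_tilde] at this
  rw [← parity_parity f, this, parity_parity]

theorem form_fourier (f g : Gr n) : form n (fourier n f) (fourier n g) = form n f g := by
  rw [fourier_apply, fourier_apply, form_tilde, form_parity, parity_parity, form_hodge]

/-- The sign from the star cancels against the sign from `tilde`. -/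
theorem fourier_thetaOp (f : Gr n) : fourier n (thetaOp n f) = laplace n (fourier n f) := by
  have h := LinearMap.congr_fun (tilde_mul_laplace (n := n)) (fourier n f)
  simp only [Module.End.mul_apply, LinearMap.neg_apply, tilde_fourier] at h
  refine tilde_injective ?_
  rw [tilde_fourier, hodge_thetaOp, h]

theorem fourier_laplace (f : Gr n) : fourier n (laplace n f) = thetaOp n (fourier n f) := by
  have h := LinearMap.congr_fun (tilde_mul_thetaOp (n := n)) (fourier n f)
  simp only [Module.End.mul_apply, LinearMap.neg_apply, tilde_fourier] at h
  refine tilde_injective ?_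
  rw [tilde_fourier, hodge_laplace, h]

theorem fourier_weight (f : Gr n) : fourier n (weight n f) = -weight n (fourier n f) := by
  have h := LinearMap.congr_fun (tilde_mul_weight (n := n)) (fourier n f)
  simp only [Module.End.mul_apply, tilde_fourier] at h
  refine tilde_injective ?_
  rw [tilde_fourier, hodge_weight, map_neg, h]

theorem tilde_thetaSq_pow (i : ℕ) : tilde n (thetaSq n ^ i) = (-thetaSq n) ^ i := by
  induction i with
  | zero => rw [pow_zero, pow_zero, tilde_one]
  | succ i ih => rw [pow_succ, tilde_mul, ih, tilde_thetaSq, pow_succ']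

theorem tilde_exp_thetaSq (a : ℂ) : tilde n (IsNilpotent.exp (a • thetaSq n)) =
    IsNilpotent.exp (-a • thetaSq n) := by
  obtain ⟨m, hm⟩ := smul_isNilpotent (thetaSq_isNilpotent (n := n)) a
  have hm' : (-a • thetaSq n) ^ m = 0 := by
    rw [neg_smul, neg_pow, hm, mul_zero]
  rw [exp_eq_complex_sum hm, exp_eq_complex_sum hm', map_sum]
  refine Finset.sum_congr rfl fun i _ => ?_
  rw [map_smul, smul_pow, map_smul, tilde_thetaSq_pow, neg_smul, ← smul_neg, smul_pow]

theorem tilde_gaussOp (a : ℂ) (f : Gr n) :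
    tilde n (gaussOp n a f) = gaussOp n (-a) (tilde n f) := by
  rw [gaussOp_apply, tilde_mul, tilde_exp_thetaSq, gaussOp_apply, (exp_thetaSq_commute _ _).eq]

/-- The star gives `tilde f` times the Gaussian, and undoing `tilde` flips the sign of the exponent.
-/
theorem fourier_harmonic_mul_gauss {f : Gr n} (h : laplace n f = 0) :
    fourier n (gaussOp n (-1 / 2) f) = gaussOp n (1 / 2) f := by
  refine tilde_injective ?_
  rw [tilde_fourier, ← mul_gauss, hodge_harmonic_mul_gauss h, tilde_gaussOp, mul_gauss, neg_div]

end FourierTransform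

/-! ### Scaling of the variables. -/

section Scaling

variable {n : ℕ}

theorem scaling_thetaSq (s : ℂ) : scaling n s (thetaSq n) = s ^ 2 • thetaSq n := by
  rw [thetaSq, map_neg, map_sum, smul_neg, Finset.smul_sum]
  congr 1
  refine Finset.sum_congr rfl fun j _ => ?_
  rw [map_mul, scaling_gen, scaling_gen, smul_mul_smul_comm, sq]

theorem scaling_thetaOp (s : ℂ) (f : Gr n) :
    scaling n s (thetaOp n f) = s ^ 2 • thetaOp n (scaling n s f) := by
  rw [thetaOp_apply, map_mul, scaling_thetaSq, thetaOp_apply, smul_mul_assoc]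

theorem scaling_gaussOp (s a : ℂ) (f : Gr n) :
    scaling n s (gaussOp n a f) = gaussOp n (a * s ^ 2) (scaling n s f) := by
  obtain ⟨m, hm⟩ := smul_isNilpotent (thetaOp_isNilpotent (n := n)) a
  have hm' : ((a * s ^ 2) • thetaOp n) ^ m = 0 := by
    have := congrArg (fun T => (s ^ 2) ^ m • T) hm
    simpa only [← smul_pow, smul_smul, mul_comm (s ^ 2), smul_zero] using this
  have h : ∀ i, scaling n s ((thetaOp n ^ i) f) = (s ^ 2) ^ i • (thetaOp n ^ i) (scaling n s f) := by
    intro i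
    induction i with
    | zero => simp
    | succ i ih =>
      rw [pow_succ', Module.End.mul_apply, scaling_thetaOp, ih, map_smul, Module.End.mul_apply,
        smul_smul, ← pow_succ']
  rw [gaussOp_eq_exp, gaussOp_eq_exp, exp_eq_complex_sum hm, exp_eq_complex_sum hm',
    LinearMap.sum_apply, map_sum, LinearMap.sum_apply]
  refine Finset.sum_congr rfl fun i _ => ?_
  rw [LinearMap.smul_apply, smul_pow, LinearMap.smul_apply, map_smul, map_smul, h,
    LinearMap.smul_apply, smul_pow, LinearMap.smul_apply, mul_pow, mul_smul]

theorem scaling_parity (s : ℂ) (f : Gr n) :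
    scaling n s (parity n f) = parity n (scaling n s f) := by
  induction f using gr_induction with
  | one => rw [parity_one, map_one, parity_one]
  | add f g hf hg => simp only [map_add, hf, hg]
  | smul c f hf => simp only [map_smul, hf]
  | gen_mul i f hf =>
    rw [parity_gen_mul, map_neg, map_mul, map_mul, scaling_gen, hf, smul_mul_assoc,
      smul_mul_assoc, map_smul, parity_gen_mul, smul_neg]

theorem scaling_tilde (s : ℂ) (f : Gr n) :
    scaling n s (tilde n f) = tilde n (scaling n s f) := by
  induction f using gr_induction_pairs with
  | one => rw [tilde_one, map_one, tilde_one]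
  | add f g hf hg => simp only [map_add, hf, hg]
  | smul c f hf => simp only [map_smul, hf]
  | fst_mul j f hf =>
    rw [tilde_fst_mul, map_mul, map_mul, scaling_gen, scaling_gen, scaling_parity, hf,
      smul_mul_assoc, smul_mul_assoc, map_smul, tilde_fst_mul]
  | snd_mul j f hf =>
    rw [tilde_snd_mul, map_neg, map_mul, map_mul, scaling_gen, scaling_gen, scaling_parity, hf,
      smul_mul_assoc, smul_mul_assoc, map_smul, tilde_snd_mul, smul_neg]

/-- The star sends degree `d` to `2n - d`, so `s^d` becomes `s^{2n} s^{-(2n-d)}`. -/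
theorem fourier_scaling {s : ℂ} (hs : s ≠ 0) (f : Gr n) :
    fourier n (scaling n s f) = s ^ (2 * n) • scaling n s⁻¹ (fourier n f) := by
  rw [fourier_apply, fourier_apply, scaling_tilde, scaling_parity, ← map_smul, ← map_smul]
  congr 2
  have : hodge n ∘ₗ (scaling n s).toLinearMap =
      s ^ (2 * n) • ((scaling n s⁻¹).toLinearMap ∘ₗ hodge n) := by
    refine linearMap_ext_mono fun A => ?_
    simp only [LinearMap.comp_apply, AlgHom.toLinearMap_apply, LinearMap.smul_apply, scaling_mono,
      map_smul, hodge_mono, smul_smul]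
    congr 1
    have h1 : A.card + Aᶜ.card = 2 * n := by
      rw [Finset.card_add_card_compl, Fintype.card_fin]
    have h2 : s ^ (2 * n) = s ^ A.card * s ^ Aᶜ.card := by rw [← pow_add, h1]
    rw [h2, inv_pow]
    field_simp
  exact LinearMap.congr_fun this f

theorem scaling_weight (s : ℂ) (f : Gr n) :
    scaling n s (weight n f) = weight n (scaling n s f) := by
  have : (scaling n s).toLinearMap ∘ₗ weight n = weight n ∘ₗ (scaling n s).toLinearMap := by
    refine linearMap_ext_mono fun A => ?_
    simp only [LinearMap.comp_apply, AlgHom.toLinearMap_apply, weight_apply, euler_mono, map_sub,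
      map_smul, scaling_mono]
    module
  exact LinearMap.congr_fun this f

theorem smul_scaling_pderiv (s : ℂ) (i : Fin (2 * n)) (f : Gr n) :
    s • scaling n s (pderiv i f) = pderiv i (scaling n s f) := by
  induction f using gr_induction with
  | one => rw [pderiv_one, map_zero, smul_zero, map_one, pderiv_one]
  | add f g hf hg => simp only [map_add, smul_add, hf, hg]
  | smul c f hf => simp only [map_smul, ← hf, smul_comm s c]
  | gen_mul k f hf =>
    rw [pderiv_gen_mul, map_sub, map_mul, scaling_gen, map_mul, scaling_gen, smul_mul_assoc,
      smul_mul_assoc, map_smul, pderiv_gen_mul, ← hf, mul_smul_comm]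
    split_ifs
    · module
    · rw [map_zero]

theorem smul_scaling_laplace (s : ℂ) (f : Gr n) :
    s ^ 2 • scaling n s (laplace n f) = laplace n (scaling n s f) := by
  simp only [laplace_apply, map_smul, map_sum, ← smul_scaling_pderiv, Finset.smul_sum, smul_smul]
  refine Finset.sum_congr rfl fun j _ => ?_
  congr 1
  ring

end Scaling

/-! ### The oscillator evolution on the Hermite basis. -/

section Evolution

variable {n : ℕ}

theorem fourier_gaussOp {N : ℕ} (hN : N ≤ n) {h : Gr n} (h0 : laplace n h = 0)
    (h1 : euler n h = ((n - N : ℕ) : ℂ) • h) {s : ℂ} (hs : s ≠ 0) :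
    fourier n (gaussOp n s h) = (-2 * s) ^ N • gaussOp n (-1 / (4 * s)) h := by
  -- Scaling by `μ` carries `exp(-θ²/2)` to `exp(sθ²)`, which reduces the claim to
  -- `fourier_harmonic_mul_gauss`; the result contains only `μ²`.
  obtain ⟨μ, hμ⟩ := IsAlgClosed.exists_pow_nat_eq (-2 * s) (n := 2) two_pos
  have hμ0 : μ ≠ 0 := by
    rintro rfl
    simp [hs] at hμ
  have hsμ : s = -1 / 2 * μ ^ 2 := by rw [hμ]; ring
  have e1 := fourier_scaling hμ0 (gaussOp n (-1 / 2) h)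
  rw [fourier_harmonic_mul_gauss h0, scaling_gaussOp, scaling_gaussOp, scaling_of_euler _ h1,
    scaling_of_euler _ h1, map_smul, map_smul, map_smul, ← hsμ, smul_smul] at e1
  have e2 : μ ^ (n - N) ≠ 0 := pow_ne_zero _ hμ0
  refine smul_right_injective _ e2 (e1.trans ?_)
  simp only [smul_smul]
  congr 1
  · rw [← hμ, inv_pow, ← pow_mul]
    obtain ⟨k, rfl⟩ := Nat.exists_eq_add_of_le hN
    rw [Nat.add_sub_cancel_left, show 2 * (N + k) = k + 2 * N + k by ring, pow_add]
    rw [Nat.add_sub_cancel_left] at e2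
    field_simp
    ring
  · congr 2
    rw [hsμ]
    field_simp
    norm_num

/-- The time evolution of the oscillator, `z = exp(iα)`. -/
def evolution (n : ℕ) (z : ℂ) : Module.End ℂ (Gr n) :=
  ((1 - z ^ 2) / 2) ^ n • (gaussOp n (-(1 + z ^ 2) / (2 * (1 - z ^ 2))) ∘ₗ
    (scaling n (2 * z / (1 - z ^ 2))).toLinearMap ∘ₗ fourier n ∘ₗ
      gaussOp n (-(1 + z ^ 2) / (2 * (1 - z ^ 2))))

theorem evolution_apply (z : ℂ) (f : Gr n) : evolution n z f = ((1 - z ^ 2) / 2) ^ n •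
    gaussOp n (-(1 + z ^ 2) / (2 * (1 - z ^ 2))) (scaling n (2 * z / (1 - z ^ 2))
      (fourier n (gaussOp n (-(1 + z ^ 2) / (2 * (1 - z ^ 2))) f))) := rfl

/-- Each of the four factors of the evolution acts by conjugation on the span of `∇²`, weight and
`θ²`. Only the coefficients `c1`, `c2`, `c3` of these three operators have to be compared. -/
theorem evolution_raising {z : ℂ} (hz : z ≠ 0) (hz2 : 1 - z ^ 2 ≠ 0) (f : Gr n) :
    evolution n z (raising n f) = z ^ 2 • raising n (evolution n z f) := by
  rw [evolution_apply, evolution_apply, map_smul, smul_comm (z ^ 2)]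
  congr 1
  set a := -(1 + z ^ 2) / (2 * (1 - z ^ 2)) with ha
  set t := 2 * z / (1 - z ^ 2) with ht
  have ht0 : t ≠ 0 := div_ne_zero (mul_ne_zero two_ne_zero hz) hz2
  have hP : ∀ f, scaling n t (laplace n f) = (t ^ 2)⁻¹ • laplace n (scaling n t f) := fun f => by
    rw [← smul_scaling_laplace, inv_smul_smul₀ (pow_ne_zero _ ht0)]
  simp only [raising_apply, map_add, map_sub, map_neg, map_smul, gaussOp_laplace, gaussOp_thetaOp,
    gaussOp_weight, fourier_laplace, fourier_thetaOp, fourier_weight, scaling_thetaOp, hP,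
    scaling_weight]
  set u := gaussOp n a (scaling n t (fourier n (gaussOp n a f)))
  have e1 : 1 + 2 * a = -2 * z ^ 2 / (1 - z ^ 2) := by rw [ha]; field_simp; ring
  have c1 : (t ^ 2)⁻¹ * (1 + 2 * a) ^ 2 = z ^ 2 := by rw [e1, ht]; field_simp
  have c2 : -(1 + 2 * a) + 2 * a * z ^ 2 = z ^ 2 := by rw [ha]; field_simp; ring
  have c3 : -t ^ 2 + 4 * a * (1 + 2 * a) - 4 * a ^ 2 * z ^ 2 = -z ^ 2 := by
    rw [ha, ht]; field_simp; ring
  calc _ = -((t ^ 2)⁻¹ * (1 + 2 * a) ^ 2) • laplace n u +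
        (-(1 + 2 * a) + 2 * a * ((t ^ 2)⁻¹ * (1 + 2 * a) ^ 2)) • weight n u +
        (-t ^ 2 + 4 * a * (1 + 2 * a) - 4 * a ^ 2 * ((t ^ 2)⁻¹ * (1 + 2 * a) ^ 2)) •
          thetaOp n u := by module
    _ = _ := by rw [c1, c2, c3]; module

/-- The two inner Gaussians combine to `exp(-θ²/(1 - z²))`. The Fourier transform replaces this
exponent by `(1 - z²)θ²/4`, scaling by `z²θ²/(1 - z²)`, and the outer Gaussian restores `-θ²/2`. The
constants multiply to `z^k`. -/
theorem evolution_harmonic {z : ℂ} (hz2 : 1 - z ^ 2 ≠ 0) {k : ℕ} (hk : k ≤ n) {h : Gr n}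
    (h0 : laplace n h = 0) (h1 : euler n h = (k : ℂ) • h) :
    evolution n z (h * gauss n) = z ^ k • (h * gauss n) := by
  have hs : -1 / (1 - z ^ 2) ≠ 0 := div_ne_zero (by norm_num) hz2
  have h1' : euler n h = ((n - (n - k) : ℕ) : ℂ) • h := by rwa [Nat.sub_sub_self hk]
  have e : ∀ b c f, gaussOp n b (gaussOp n c f) = gaussOp n (b + c) f := fun b c f => by
    rw [← gaussOp_mul_gaussOp, Module.End.mul_apply]
  rw [evolution_apply, mul_gauss, e, show -(1 + z ^ 2) / (2 * (1 - z ^ 2)) + -1 / 2 =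
    -1 / (1 - z ^ 2) by field_simp; ring, fourier_gaussOp (Nat.sub_le n k) h0 h1' hs, map_smul,
    scaling_gaussOp, scaling_of_euler _ h1, map_smul, map_smul, map_smul, e, smul_smul, smul_smul]
  congr 1
  · obtain ⟨N, rfl⟩ := Nat.exists_eq_add_of_le hk
    rw [Nat.add_sub_cancel_left, pow_add]
    have e1 : (1 - z ^ 2) / 2 * (-2 * (-1 / (1 - z ^ 2))) = 1 := by field_simp
    have e2 : (1 - z ^ 2) / 2 * (2 * z / (1 - z ^ 2)) = z := by field_simp
    rw [mul_assoc, mul_assoc, ← mul_assoc (((1 - z ^ 2) / 2) ^ N), ← mul_pow, e1, one_pow, one_mul,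
      ← mul_pow, e2]
  · congr 2
    field_simp
    ring

theorem evolution_hermiteFn {z : ℂ} (hz : z ≠ 0) (hz2 : 1 - z ^ 2 ≠ 0) {k : ℕ} (hk : k ≤ n)
    {h : Gr n} (h0 : laplace n h = 0) (h1 : euler n h = (k : ℂ) • h) (j : ℕ) :
    evolution n z (hermiteFn n j h) = z ^ (2 * j + k) • hermiteFn n j h := by
  rw [hermiteFn_eq]
  induction j with
  | zero =>
    rw [pow_zero, Module.End.one_apply, evolution_harmonic hz2 hk h0 h1, mul_zero, zero_add]
  | succ j ih =>
    rw [pow_succ', Module.End.mul_apply, evolution_raising hz hz2, ih, map_smul, smul_smul,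
      ← pow_add]
    congr 2
    ring

end Evolution

/-! ### The Mehler formula. -/

section Mehler

variable {n : ℕ}

theorem casimir_map {M : Type*} [AddCommGroup M] [Module ℂ M] (L : M →ₗ[ℂ] M)
    {β β' : Gr n →ₗ[ℂ] Gr n →ₗ[ℂ] M} (h : ∀ f g, β f g = L (β' f g)) :
    casimir β = L (casimir β') := by
  simp only [casimir, map_sum, map_smul, h]

theorem inX_exp (a : ℂ) : inX n (IsNilpotent.exp (a • thetaSq n)) =
    IsNilpotent.exp (a • thX n) := by
  rw [IsNilpotent.map_exp (smul_isNilpotent thetaSq_isNilpotent a), map_smul, thX]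

theorem inY_exp (a : ℂ) : inY n (IsNilpotent.exp (a • thetaSq n)) =
    IsNilpotent.exp (a • thY n) := by
  rw [IsNilpotent.map_exp (smul_isNilpotent thetaSq_isNilpotent a), map_smul, thY]

theorem exp_add_gr2 {a b : Gr2 n} (hab : Commute a b) (ha : IsNilpotent a) (hb : IsNilpotent b)
    (s t : ℂ) : IsNilpotent.exp (s • a) * IsNilpotent.exp (t • b) =
      IsNilpotent.exp (s • a + t • b) :=
  (IsNilpotent.exp_add_of_commute ((hab.smul_left s).smul_right t) (smul_isNilpotent ha s)
    (smul_isNilpotent hb t)).symm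

theorem exp_thXY (s : ℂ) : IsNilpotent.exp (s • thX n) * IsNilpotent.exp (s • thY n) =
    IsNilpotent.exp (s • (thX n + thY n)) := by
  rw [exp_add_gr2 (thX_commute _) thX_isNilpotent thY_isNilpotent, smul_add]

theorem thX_add_thY_isNilpotent : IsNilpotent (thX n + thY n) :=
  (thX_commute (thY n)).isNilpotent_add thX_isNilpotent thY_isNilpotent

theorem thX_add_thY_commute (f : Gr2 n) : Commute (thX n + thY n) f :=
  (thX_commute f).add_left (thY_commute f)

theorem exp_commute {a : Gr2 n} (ha : ∀ f, Commute a f) (hn : IsNilpotent a) (s : ℂ) (f : Gr2 n) :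
    Commute (IsNilpotent.exp (s • a)) f := by
  obtain ⟨m, hm⟩ := smul_isNilpotent hn s
  rw [exp_eq_complex_sum hm]
  exact Commute.sum_left _ _ _ fun i _ => (((ha f).smul_left s).pow_left i).smul_left _

/-- The adjoint of `gaussOp`. -/
theorem exists_adjoint_gaussOp (a : ℂ) : ∃ X : Module.End ℂ (Gr n),
    (∀ f g, form n (X f) g = form n f (gaussOp n a g)) ∧
      ∀ f, hodge n (X f) = gaussOp n a (hodge n f) := by
  obtain ⟨m, hm⟩ := smul_isNilpotent (thetaOp_isNilpotent (n := n)) a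
  have h1 : ∀ i f g, form n (((-laplace n) ^ i) f) g = form n f ((thetaOp n ^ i) g) := by
    intro i
    induction i with
    | zero => intro f g; rfl
    | succ i ih =>
      intro f g
      rw [pow_succ', Module.End.mul_apply, LinearMap.neg_apply, map_neg, LinearMap.neg_apply,
        form_laplace, neg_neg, ih, ← Module.End.mul_apply, ← pow_succ]
  have h2 : ∀ i f, hodge n (((-laplace n) ^ i) f) = (thetaOp n ^ i) (hodge n f) := by
    intro i
    induction i with
    | zero => intro f; rfl
    | succ i ih =>
      intro f
      rw [pow_succ', Module.End.mul_apply, LinearMap.neg_apply, map_neg, hodge_laplace, neg_neg,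
        ih, ← Module.End.mul_apply, ← pow_succ']
  -- The witness is the truncated series of `exp(-a∇²)`, since `-∇²` is adjoint to `θ²` and the star
  -- carries it to `θ²`.
  refine ⟨∑ i ∈ Finset.range m, ((i ! : ℂ))⁻¹ • a ^ i • (-laplace n) ^ i, fun f g => ?_,
    fun f => ?_⟩
  · simp only [gaussOp_eq_exp, exp_eq_complex_sum hm, LinearMap.sum_apply, LinearMap.smul_apply,
      map_sum, map_smul, h1, smul_pow]
  · simp only [gaussOp_eq_exp, exp_eq_complex_sum hm, LinearMap.sum_apply, LinearMap.smul_apply,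
      map_sum, map_smul, h2, smul_pow]

/-- The outer Gaussian of the evolution becomes a Gaussian in `y` (`e1`). The inner one passes by
adjointness to the first slot, where the star turns it into a Gaussian in `x` (`e2`). Since the star
is `tilde` after the Fourier transform, that isometry acts in both remaining slots and drops out,
leaving `casimir_tilde_scaling`. -/
theorem casimir_hodge_evolution (z : ℂ) :
    casimir ((kap n).compl₁₂ (hodge n) (evolution n z)) =
      (Real.pi * (1 - z ^ 2) : ℂ) ^ n •
        IsNilpotent.exp ((-(1 + z ^ 2) / (2 * (1 - z ^ 2))) • (thX n + thY n) +
          (2 * z / (1 - z ^ 2)) • pair n) := by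
  set a := -(1 + z ^ 2) / (2 * (1 - z ^ 2)) with ha
  set t := 2 * z / (1 - z ^ 2) with ht
  obtain ⟨X, hX1, hX2⟩ := exists_adjoint_gaussOp (n := n) a
  have e1 := casimir_map (n := n)
    (((1 - z ^ 2) / 2) ^ n • LinearMap.mulLeft ℂ (IsNilpotent.exp (a • thY n)))
    (β := (kap n).compl₁₂ (hodge n) (evolution n z))
    (β' := ((kap n).compl₁₂ (hodge n) ((scaling n t).toLinearMap ∘ₗ fourier n)).compl₂
      (gaussOp n a)) fun f g => by
    rw [LinearMap.compl₁₂_apply, evolution_apply, map_smul, gaussOp_apply, kap_apply, map_mul,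
      inY_exp, ← mul_assoc, ← (exp_commute thY_commute thY_isNilpotent a _).eq, mul_assoc]
    rfl
  have e2 := casimir_map (n := n) (LinearMap.mulLeft ℂ (IsNilpotent.exp (a • thX n)))
    (β := ((kap n).compl₁₂ (hodge n) ((scaling n t).toLinearMap ∘ₗ fourier n)) ∘ₗ X)
    (β' := ((kap n).compl₁₂ (tilde n) (scaling n t).toLinearMap).compl₁₂ (fourier n) (fourier n))
    fun f g => by
    rw [LinearMap.comp_apply, LinearMap.compl₁₂_apply, hX2, kap_apply, gaussOp_apply, map_mul,
      inX_exp, mul_assoc, LinearMap.compl₁₂_apply, LinearMap.compl₁₂_apply, tilde_fourier]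
    rfl
  rw [e1, ← casimir_adjoint hX1, e2, casimir_isometry form_fourier, casimir_tilde_scaling,
    LinearMap.smul_apply, LinearMap.mulLeft_apply, LinearMap.mulLeft_apply, mul_smul_comm,
    mul_smul_comm, smul_smul, ← mul_assoc, (exp_commute thY_commute thY_isNilpotent a _).eq,
    exp_thXY, exp_add_gr2 (thX_add_thY_commute _) thX_add_thY_isNilpotent pair_isNilpotent,
    ← mul_pow]
  congr 2
  ring

theorem exp_mul_index (α : ℝ) (j k : ℕ) :
    Complex.exp (Complex.I * α * (2 * j + k)) = Complex.exp (Complex.I * α) ^ (2 * j + k) := by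
  rw [← Complex.exp_nat_mul]
  congr 1
  push_cast
  ring

theorem exp_two_mul_I (α : ℝ) :
    Complex.exp (2 * Complex.I * α) = Complex.exp (Complex.I * α) ^ 2 := by
  rw [← Complex.exp_nat_mul]
  congr 1
  push_cast
  ring

theorem inX_hodge_hermiteUnit_mul (j k : ℕ) (h : Gr n) :
    inX n (hodge n (hermiteUnit n j k h)) * inY n (hermiteUnit n j k h) =
      (gam n j k : ℂ)⁻¹ • (inX n (hodge n (hermiteFn n j h)) * inY n (hermiteFn n j h)) := by
  simp only [hermiteUnit, map_smul]
  rw [smul_mul_smul_comm, ← mul_inv, ← Complex.ofReal_mul,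
    Real.mul_self_sqrt (gam_pos j k).le]

variable {H : HarmonicFamily n}

/-- Mehler's formula. -/
theorem IsOrthonormalFamily.hermiteSum_eq (hH : IsOrthonormalFamily H) {α : ℝ}
    (hα : Complex.exp (2 * Complex.I * α) ≠ 1) : hermiteSum n H α = mehlerKernel n α := by
  set z := Complex.exp (Complex.I * α) with hz
  have hz0 : z ≠ 0 := Complex.exp_ne_zero _
  have hz2 : 1 - z ^ 2 ≠ 0 := by
    rw [hz, ← exp_two_mul_I]
    exact sub_ne_zero.2 hα.symm
  -- In the orthogonal Hermite basis the evolution supplies the phases `z^{2j+k}` and the norms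
  -- supply `1 / γ_{j,k}`.
  have h1 : hermiteSum n H α = casimir ((kap n).compl₁₂ (hodge n) (evolution n z)) := by
    rw [← sum_orthogonal_eq_casimir (fun a : HermiteIndex n => gam_ne_zero _ _)
      hH.form_hermiteIndex hH.span_hermiteFn,
      sum_hermiteIndex (fun k j l => (gam n j k : ℂ)⁻¹ •
        (kap n).compl₁₂ (hodge n) (evolution n z) (hermiteFn n j (H k l)) (hermiteFn n j (H k l)))]
    refine Finset.sum_congr rfl fun k hk => Finset.sum_congr rfl fun j _ =>
      Finset.sum_congr rfl fun l _ => ?_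
    have hk' : k ≤ n := Nat.lt_succ_iff.1 (Finset.mem_range.1 hk)
    have hm := mem_harmonics_iff.1 (hH.mem k hk' l)
    rw [exp_mul_index, inX_hodge_hermiteUnit_mul, LinearMap.compl₁₂_apply,
      evolution_hermiteFn hz0 hz2 hk' hm.1 hm.2, map_smul, kap_apply, smul_comm]
  rw [h1, casimir_hodge_evolution, mehlerKernel, exp_two_mul_I, ← hz]
  congr 2
  have hz3 : 2 - 2 * z ^ 2 ≠ 0 := by
    rw [← mul_one_sub]
    exact mul_ne_zero two_ne_zero hz2
  have c1 : -(1 + z ^ 2) / (2 * (1 - z ^ 2)) = -(1 / (2 - 2 * z ^ 2) * (1 + z ^ 2)) := by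
    rw [mul_one_sub]
    ring
  have c2 : 2 * z / (1 - z ^ 2) = 1 / (2 - 2 * z ^ 2) * (4 * z) := by
    rw [← mul_one_sub] at hz3 ⊢
    field_simp
    norm_num
  rw [c1, c2]
  module

theorem IsOrthonormalFamily.hermiteSum_eq_laguerre (hH : IsOrthonormalFamily H) (α : ℝ) :
    hermiteSum n H α =
      ∑ k ∈ Finset.range (n + 1), ∑ j ∈ Finset.range (n - k + 1), ∑ l,
        ((-1) ^ j / (gam n j k : ℂ) * 4 ^ (2 * j) * (j ! : ℂ) ^ 2 *
          Complex.exp (Complex.I * α * (2 * j + k))) •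
        (laguerrePair n j k * inX n (tilde n (H k l)) * inY n (H k l) *
          IsNilpotent.exp ((-1 / 2 : ℂ) • (thX n + thY n))) := by
  refine Finset.sum_congr rfl fun k hk => Finset.sum_congr rfl fun j _ =>
    Finset.sum_congr rfl fun l _ => ?_
  have hk' : k ≤ n := Nat.lt_succ_iff.1 (Finset.mem_range.1 hk)
  have hm := isLowestWeight_of_mem_harmonics (hH.mem k hk' l)
  have hX : ∀ p : Polynomial ℂ, inX n (Polynomial.aeval (thetaSq n) p) =
      Polynomial.aeval (thX n) p := fun p => (Polynomial.aeval_algHom_apply (inX n) _ p).symm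
  have hY : ∀ p : Polynomial ℂ, inY n (Polynomial.aeval (thetaSq n) p) =
      Polynomial.aeval (thY n) p := fun p => (Polynomial.aeval_algHom_apply (inY n) _ p).symm
  have hgX : inX n (gauss n) = IsNilpotent.exp ((-1 / 2 : ℂ) • thX n) := inX_exp _
  have hgY : inY n (gauss n) = IsNilpotent.exp ((-1 / 2 : ℂ) • thY n) := inY_exp _
  have hc : ∀ p : Polynomial ℂ, ∀ f, Commute (Polynomial.aeval (thY n) p) f := fun p f =>
    Polynomial.induction_on p (fun c => by
      rw [Polynomial.aeval_C]; exact Algebra.commutes c f) (fun p q hp hq => by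
      rw [map_add]; exact hp.add_left hq) fun i c _ => by
      rw [map_mul, Polynomial.aeval_C, map_pow, Polynomial.aeval_X]
      exact Commute.mul_left (Algebra.commutes c f) ((thY_commute f).pow_left _)
  rw [inX_hodge_hermiteUnit_mul, hermiteFn_eq, hm.raising_pow, map_smul, hm.hodge_laguerre]
  simp only [map_smul, map_mul, hX, hY, hgX, hgY, smul_mul_smul_comm, smul_smul, laguerrePair]
  congr 1
  · rw [show (4 : ℂ) = 2 * 2 by norm_num, mul_pow]
    ring
  · have e : ∀ a t x b u y : Gr2 n, (∀ f, Commute b f) → (∀ f, Commute x f) →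
        a * t * x * (b * u * y) = a * b * t * u * (x * y) := fun a t x b u y hb hx => by
      simp only [mul_assoc]
      rw [(hx b).left_comm (u * y), (hx u).left_comm y, (hb t).symm.left_comm (u * (x * y))]
    rw [← exp_thXY]
    exact e _ _ _ _ _ _ (hc _) (exp_commute thX_commute thX_isNilpotent _)

end Mehler

/-! ### The Laguerre form and the Fourier kernel. -/

section LaguerreSum

variable {n : ℕ} {H : HarmonicFamily n}

theorem IsOrthonormalFamily.hermiteSum_eq_reprKernel (hH : IsOrthonormalFamily H) (α : ℝ) :
    hermiteSum n H α = ∑ k ∈ Finset.range (n + 1), ∑ j ∈ Finset.range (n - k + 1),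
      ((-1) ^ j * j ! * (n - k - j)! * Complex.exp (Complex.I * α * (2 * j + k))) •
        (laguerrePair n j k * reprKernel n H k *
          IsNilpotent.exp ((-1 / 2 : ℂ) • (thX n + thY n))) := by
  rw [hH.hermiteSum_eq_laguerre]
  refine Finset.sum_congr rfl fun k _ => Finset.sum_congr rfl fun j _ => ?_
  rw [reprKernel, Finset.mul_sum, Finset.sum_mul, Finset.smul_sum]
  refine Finset.sum_congr rfl fun l _ => ?_
  rw [mul_assoc (laguerrePair n j k)]
  congr 1
  have hf : ∀ m : ℕ, ((m ! : ℕ) : ℂ) ≠ 0 := fun m => by exact_mod_cast m.factorial_ne_zero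
  have := hf j
  have := hf (n - k - j)
  rw [gam]
  push_cast
  field_simp

theorem laguerreSum_mul_exp (hH : IsOrthonormalFamily H) (α : ℝ) :
    laguerreSum n H α * IsNilpotent.exp ((-1 / 2 : ℂ) • (thX n + thY n)) = hermiteSum n H α := by
  simp only [hH.hermiteSum_eq_reprKernel, laguerreSum, Finset.sum_mul, smul_mul_assoc]

theorem mehlerKernel'_mul_exp {α : ℝ} (hα : Complex.exp (2 * Complex.I * α) ≠ 1) :
    mehlerKernel' n α * IsNilpotent.exp ((-1 / 2 : ℂ) • (thX n + thY n)) = mehlerKernel n α := by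
  have hz2 : 1 - Complex.exp (2 * Complex.I * α) ≠ 0 := sub_ne_zero.2 hα.symm
  rw [mehlerKernel', mehlerKernel]
  generalize Complex.exp (2 * Complex.I * α) = w at hz2 ⊢
  generalize Complex.exp (Complex.I * α) = z
  have e : ∀ s : ℂ, (1 / s) • ((2 * z) • pair n - w • (thX n + thY n)) =
      (1 / s * (2 * z)) • pair n + (-(1 / s * w)) • (thX n + thY n) := fun s => by module
  rw [smul_mul_assoc, e, ← exp_add_gr2 (pair_commute _) pair_isNilpotent thX_add_thY_isNilpotent,
    mul_assoc, exp_add_gr2 (Commute.refl _) thX_add_thY_isNilpotent thX_add_thY_isNilpotent,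
    ← add_smul, exp_add_gr2 (pair_commute _) pair_isNilpotent thX_add_thY_isNilpotent]
  congr 2
  have c0 : 2 - 2 * w = 2 * (1 - w) := by ring
  have c1 : -(1 / (1 - w) * w) + -1 / 2 = -(1 / (2 - 2 * w) * (1 + w)) := by
    rw [c0]; field_simp; ring
  have c2 : 1 / (1 - w) * (2 * z) = 1 / (2 - 2 * w) * (4 * z) := by
    rw [c0]; field_simp; ring
  rw [c1, c2]
  module

/-- Both sides become those of Mehler's formula after multiplication by a Gaussian, which is a unit.
-/
theorem IsOrthonormalFamily.laguerreSum_eq (hH : IsOrthonormalFamily H) {α : ℝ}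
    (hα : Complex.exp (2 * Complex.I * α) ≠ 1) : laguerreSum n H α = mehlerKernel' n α := by
  refine (IsNilpotent.isUnit_exp
    (smul_isNilpotent thX_add_thY_isNilpotent (-1 / 2))).mul_right_cancel ?_
  rw [laguerreSum_mul_exp hH, mehlerKernel'_mul_exp hα, hH.hermiteSum_eq hα]

theorem exp_half_pi {σ : ℝ} (hσ : σ = 1 ∨ σ = -1) :
    Complex.exp (Complex.I * ((σ * (Real.pi / 2) : ℝ) : ℂ)) = σ * Complex.I := by
  rcases hσ with rfl | rfl
  · rw [mul_comm]
    push_cast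
    rw [one_mul, Complex.exp_pi_div_two_mul_I, one_mul]
  · rw [mul_comm]
    push_cast
    rw [neg_one_mul, neg_mul, Complex.exp_neg, Complex.exp_pi_div_two_mul_I, Complex.inv_I]
    ring

theorem exp_two_half_pi {σ : ℝ} (hσ : σ = 1 ∨ σ = -1) :
    Complex.exp (2 * Complex.I * ((σ * (Real.pi / 2) : ℝ) : ℂ)) = -1 := by
  rw [exp_two_mul_I, exp_half_pi hσ, mul_pow, Complex.I_sq]
  rcases hσ with rfl | rfl <;> norm_num

/-- Here `z² = -1`, so the coefficient `1 + z²` of `θ² + θ_y²` vanishes. -/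
theorem IsOrthonormalFamily.hermiteSum_half_pi (hH : IsOrthonormalFamily H) {σ : ℝ}
    (hσ : σ = 1 ∨ σ = -1) : hermiteSum n H (σ * (Real.pi / 2)) =
      ((2 * Real.pi) ^ n : ℂ) • IsNilpotent.exp ((σ * Complex.I) • pair n) := by
  rw [hH.hermiteSum_eq (by rw [exp_two_half_pi hσ]; norm_num), mehlerKernel, exp_two_half_pi hσ,
    exp_half_pi hσ]
  congr 2
  · ring
  · rw [add_neg_cancel, zero_smul, sub_zero, smul_smul]
    congr 1
    ring

theorem IsOrthonormalFamily.laguerreSum_half_pi (hH : IsOrthonormalFamily H) {σ : ℝ}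
    (hσ : σ = 1 ∨ σ = -1) :
    ∑ k ∈ Finset.range (n + 1), ∑ j ∈ Finset.range (n - k + 1),
      ((j ! : ℂ) * (n - k - j)! * (σ * Complex.I) ^ k) •
        (laguerrePair n j k * reprKernel n H k *
          IsNilpotent.exp ((-1 / 2 : ℂ) • (thX n + thY n))) =
      ((2 * Real.pi) ^ n : ℂ) • IsNilpotent.exp ((σ * Complex.I) • pair n) := by
  rw [← hH.hermiteSum_half_pi hσ, hH.hermiteSum_eq_reprKernel]
  refine Finset.sum_congr rfl fun k _ => Finset.sum_congr rfl fun j _ => ?_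
  -- The phase `z^{2j} = (-1)^j` cancels the sign of the star map.
  have h1 : (-1 : ℂ) ^ j * (-1) ^ j = 1 := by rw [← mul_pow]; simp
  rw [exp_mul_index, pow_add, pow_mul, ← exp_two_mul_I, exp_two_half_pi hσ, exp_half_pi hσ]
  congr 1
  linear_combination (-(j ! : ℂ) * (n - k - j)! * (σ * Complex.I) ^ k) * h1

end LaguerreSum

/-! ### Symplectic invariance. -/

section SymplecticInvariance

variable {n : ℕ}

theorem symp_mul_symp (R : Type) [Ring R] : symp R n * symp R n = -1 := by
  have h : ∀ i k : Fin n,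
      (Matrix.single (fstIdx i) (sndIdx i) (1 : R) - Matrix.single (sndIdx i) (fstIdx i) 1) *
        (Matrix.single (fstIdx k) (sndIdx k) 1 - Matrix.single (sndIdx k) (fstIdx k) 1) =
      if i = k then -(Matrix.single (fstIdx i) (fstIdx i) 1 + Matrix.single (sndIdx i) (sndIdx i) 1)
        else 0 := by
    intro i k
    rw [sub_mul, mul_sub, mul_sub, Matrix.single_mul_single_of_ne (h := sndIdx_ne_fstIdx i k),
      Matrix.single_mul_single_of_ne (h := fstIdx_ne_sndIdx i k)]
    split_ifs with hik
    · subst hik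
      rw [Matrix.single_mul_single_same, Matrix.single_mul_single_same, mul_one]
      abel
    · rw [Matrix.single_mul_single_of_ne (h := fun e => hik (sndIdx_inj.1 e)),
        Matrix.single_mul_single_of_ne (h := fun e => hik (fstIdx_inj.1 e))]
      abel
  rw [symp, Finset.sum_mul_sum]
  simp only [h, Finset.sum_ite_eq, Finset.mem_univ, if_true, Finset.sum_neg_distrib]
  rw [← sum_fstIdx_add_sndIdx (fun i => Matrix.single i i (1 : R)), Matrix.sum_single_one]

/-- From `J² = -1`, the matrix `-J Aᵀ J` is a left inverse of `A`, hence also a right inverse. -/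
theorem mul_symp_mul_transpose {R : Type} [CommRing R] {A : Matrix (Fin (2 * n)) (Fin (2 * n)) R}
    (hA : A.transpose * symp R n * A = symp R n) : A * symp R n * A.transpose = symp R n := by
  have h1 : (-(symp R n * A.transpose * symp R n)) * A = 1 := by
    rw [neg_mul, mul_assoc (symp R n), mul_assoc (symp R n), hA, symp_mul_symp, neg_neg]
  have h2 := mul_eq_one_comm.1 h1
  have h3 := congrArg (fun M => M * symp R n) h2
  simp only [mul_neg, neg_mul, one_mul] at h3
  rw [mul_assoc, mul_assoc, mul_assoc, symp_mul_symp, mul_neg, mul_neg, mul_neg, neg_neg,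
    mul_one, ← mul_assoc] at h3
  exact h3

theorem sum_symp_smul {M : Type*} [AddCommGroup M] [Module ℂ M]
    (g : Fin (2 * n) → Fin (2 * n) → M) : ∑ a, ∑ b, symp ℂ n a b • g a b =
      ∑ j, (g (fstIdx j) (sndIdx j) - g (sndIdx j) (fstIdx j)) := by
  have h : ∀ a b, symp ℂ n a b • g a b = ∑ j : Fin n,
      ((if fstIdx j = a then if sndIdx j = b then g a b else 0 else 0) -
        (if sndIdx j = a then if fstIdx j = b then g a b else 0 else 0)) := by
    intro a b
    rw [symp, Matrix.sum_apply, Finset.sum_smul]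
    refine Finset.sum_congr rfl fun j _ => ?_
    rw [Matrix.sub_apply, Matrix.single_apply, Matrix.single_apply, sub_smul]
    simp only [ite_smul, one_smul, zero_smul, ite_and]
  simp only [h]
  rw [Finset.sum_congr rfl fun a _ => Finset.sum_comm, Finset.sum_comm]
  refine Finset.sum_congr rfl fun j _ => ?_
  simp only [Finset.sum_sub_distrib]
  congr 1
  · rw [Finset.sum_eq_single (fstIdx j), Finset.sum_eq_single (sndIdx j)] <;>
      simp +contextual [eq_comm]
  · rw [Finset.sum_eq_single (sndIdx j), Finset.sum_eq_single (fstIdx j)] <;>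
      simp +contextual [eq_comm]

/-- `∑_j (u_{2j-1} v_{2j} - u_{2j} v_{2j-1})` for the images `u_i`, `v_i` of the generators. -/
def sympForm (u v : (Fin (2 * n) → ℂ) →ₗ[ℂ] (Fin (2 * n) → ℂ) × (Fin (2 * n) → ℂ)) : Gr2 n :=
  ∑ j : Fin n,
    (ExteriorAlgebra.ι ℂ (u (Pi.single (fstIdx j) 1)) *
        ExteriorAlgebra.ι ℂ (v (Pi.single (sndIdx j) 1)) -
      ExteriorAlgebra.ι ℂ (u (Pi.single (sndIdx j) 1)) *
        ExteriorAlgebra.ι ℂ (v (Pi.single (fstIdx j) 1)))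

/-- `sympForm` contracts products of generators with `J`; substituting `A` replaces `J` by `A J Aᵀ`.
-/
theorem sympForm_comp {A : Matrix (Fin (2 * n)) (Fin (2 * n)) ℂ}
    (hA : A * symp ℂ n * A.transpose = symp ℂ n)
    (u v : (Fin (2 * n) → ℂ) →ₗ[ℂ] (Fin (2 * n) → ℂ) × (Fin (2 * n) → ℂ)) :
    sympForm (u ∘ₗ Matrix.toLin' A) (v ∘ₗ Matrix.toLin' A) = sympForm u v := by
  have hA' : ∀ a, Matrix.toLin' A (Pi.single a 1) = ∑ c, A c a • Pi.single c (1 : ℂ) := by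
    intro a
    ext b
    simp [Pi.single_apply]
  have h : ∀ u v : (Fin (2 * n) → ℂ) →ₗ[ℂ] (Fin (2 * n) → ℂ) × (Fin (2 * n) → ℂ),
      sympForm u v = ∑ a, ∑ b, symp ℂ n a b • (ExteriorAlgebra.ι ℂ (u (Pi.single a 1)) *
        ExteriorAlgebra.ι ℂ (v (Pi.single b 1))) := fun u v =>
    (sum_symp_smul fun a b => ExteriorAlgebra.ι ℂ (u (Pi.single a 1)) *
        ExteriorAlgebra.ι ℂ (v (Pi.single b 1))).symm
  rw [h, h]
  set g : Fin (2 * n) → Fin (2 * n) → Gr2 n := fun c d =>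
    ExteriorAlgebra.ι ℂ (u (Pi.single c 1)) * ExteriorAlgebra.ι ℂ (v (Pi.single d 1)) with hg
  have h1 : ∀ a b, symp ℂ n a b •
      (ExteriorAlgebra.ι ℂ ((u ∘ₗ Matrix.toLin' A) (Pi.single a 1)) *
        ExteriorAlgebra.ι ℂ ((v ∘ₗ Matrix.toLin' A) (Pi.single b 1))) =
      ∑ c, ∑ d, (A c a * symp ℂ n a b * A d b) • g c d := by
    intro a b
    simp only [LinearMap.comp_apply, hA', map_sum, map_smul, Finset.sum_mul_sum,
      smul_mul_smul_comm, Finset.smul_sum, smul_smul, hg]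
    refine Finset.sum_congr rfl fun c _ => Finset.sum_congr rfl fun d _ => ?_
    congr 1
    ring
  have h2 : ∀ c d, symp ℂ n c d = ∑ a, ∑ b, A c a * symp ℂ n a b * A d b := by
    intro c d
    have := congrArg (fun M => M c d) hA
    simp only [Matrix.mul_apply, Matrix.transpose_apply, Finset.sum_mul] at this
    rw [← this]
    exact Finset.sum_comm
  calc _ = ∑ a, ∑ b, ∑ c, ∑ d, (A c a * symp ℂ n a b * A d b) • g c d :=
        Finset.sum_congr rfl fun a _ => Finset.sum_congr rfl fun b _ => h1 a b
    _ = ∑ a, ∑ c, ∑ d, ∑ b, (A c a * symp ℂ n a b * A d b) • g c d := by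
        refine Finset.sum_congr rfl fun a _ => ?_
        rw [Finset.sum_comm]
        exact Finset.sum_congr rfl fun c _ => Finset.sum_comm
    _ = ∑ c, ∑ d, ∑ a, ∑ b, (A c a * symp ℂ n a b * A d b) • g c d := by
        rw [Finset.sum_comm]
        exact Finset.sum_congr rfl fun c _ => Finset.sum_comm
    _ = _ := by
        refine Finset.sum_congr rfl fun c _ => Finset.sum_congr rfl fun d _ => ?_
        rw [h2 c d, Finset.sum_smul]
        exact Finset.sum_congr rfl fun a _ => Finset.sum_smul.symm

theorem pair_eq_sympForm :
    pair n = (-1 / 2 : ℂ) • sympForm (LinearMap.inl ℂ _ _) (LinearMap.inr ℂ _ _) := by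
  rw [pair, sympForm]
  simp only [inX_gen, inY_gen, LinearMap.inl_apply, LinearMap.inr_apply]

theorem ι_mul_ι_swap {V : Type*} [AddCommGroup V] [Module ℂ V] (v w : V) :
    ExteriorAlgebra.ι ℂ v * ExteriorAlgebra.ι ℂ w =
      -(ExteriorAlgebra.ι ℂ w * ExteriorAlgebra.ι ℂ v) := by
  rw [eq_neg_iff_add_eq_zero]
  exact ExteriorAlgebra.ι_add_mul_swap v w

/-- Each product of a pair occurs in `sympForm` in both orders, which accounts for the `1/2`. -/
theorem thX_eq_sympForm :
    thX n = (-1 / 2 : ℂ) • sympForm (LinearMap.inl ℂ _ _) (LinearMap.inl ℂ _ _) := by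
  rw [thX, sympForm, thetaSq, map_neg, map_sum, Finset.smul_sum, ← Finset.sum_neg_distrib]
  refine Finset.sum_congr rfl fun j _ => ?_
  rw [map_mul, inX_gen, inX_gen, LinearMap.inl_apply, LinearMap.inl_apply]
  have e := ι_mul_ι_swap (V := (Fin (2 * n) → ℂ) × (Fin (2 * n) → ℂ))
    (Pi.single (sndIdx j) 1, 0) (Pi.single (fstIdx j) 1, 0)
  rw [e]
  module

theorem thY_eq_sympForm :
    thY n = (-1 / 2 : ℂ) • sympForm (LinearMap.inr ℂ _ _) (LinearMap.inr ℂ _ _) := by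
  rw [thY, sympForm, thetaSq, map_neg, map_sum, Finset.smul_sum, ← Finset.sum_neg_distrib]
  refine Finset.sum_congr rfl fun j _ => ?_
  rw [map_mul, inY_gen, inY_gen, LinearMap.inr_apply, LinearMap.inr_apply]
  have e := ι_mul_ι_swap (V := (Fin (2 * n) → ℂ) × (Fin (2 * n) → ℂ))
    (0, Pi.single (sndIdx j) 1) (0, Pi.single (fstIdx j) 1)
  rw [e]
  module

variable {A : Matrix (Fin (2 * n)) (Fin (2 * n)) ℝ}

theorem prodMap_comp_inl {V : Type*} [AddCommGroup V] [Module ℂ V] (f : V →ₗ[ℂ] V) :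
    LinearMap.prodMap f f ∘ₗ LinearMap.inl ℂ V V = LinearMap.inl ℂ V V ∘ₗ f :=
  LinearMap.ext fun v => by simp

theorem prodMap_comp_inr {V : Type*} [AddCommGroup V] [Module ℂ V] (f : V →ₗ[ℂ] V) :
    LinearMap.prodMap f f ∘ₗ LinearMap.inr ℂ V V = LinearMap.inr ℂ V V ∘ₗ f :=
  LinearMap.ext fun v => by simp

theorem act_sympForm (u v : (Fin (2 * n) → ℂ) →ₗ[ℂ] (Fin (2 * n) → ℂ) × (Fin (2 * n) → ℂ)) :
    act A (sympForm u v) = sympForm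
      (LinearMap.prodMap (Matrix.toLin' (A.map Complex.ofReal))
        (Matrix.toLin' (A.map Complex.ofReal)) ∘ₗ u)
      (LinearMap.prodMap (Matrix.toLin' (A.map Complex.ofReal))
        (Matrix.toLin' (A.map Complex.ofReal)) ∘ₗ v) := by
  simp only [act, sympForm, map_sum, map_sub, map_mul, ExteriorAlgebra.map_apply_ι,
    LinearMap.comp_apply]

theorem map_symp : (symp ℝ n).map Complex.ofReal = symp ℂ n := by
  ext a b
  simp only [symp, Matrix.map_apply, Matrix.sum_apply, Matrix.sub_apply, Matrix.single_apply,
    Complex.ofReal_sum, Complex.ofReal_sub]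
  refine Finset.sum_congr rfl fun j _ => ?_
  split_ifs <;> simp

theorem map_mul_symp_mul_transpose (hA : A.transpose * symp ℝ n * A = symp ℝ n) :
    A.map Complex.ofReal * symp ℂ n * (A.map Complex.ofReal).transpose = symp ℂ n := by
  have h := congrArg (fun M => M.map Complex.ofRealHom) (mul_symp_mul_transpose hA)
  simp only [Matrix.map_mul] at h
  have h1 := map_symp (n := n)
  rw [← h1]
  exact h

theorem act_pair (hA : A.transpose * symp ℝ n * A = symp ℝ n) : act A (pair n) = pair n := by
  rw [pair_eq_sympForm, map_smul, act_sympForm, prodMap_comp_inl,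
    prodMap_comp_inr, sympForm_comp (map_mul_symp_mul_transpose hA)]

theorem act_thX (hA : A.transpose * symp ℝ n * A = symp ℝ n) : act A (thX n) = thX n := by
  rw [thX_eq_sympForm, map_smul, act_sympForm, prodMap_comp_inl,
    sympForm_comp (map_mul_symp_mul_transpose hA)]

theorem act_thY (hA : A.transpose * symp ℝ n * A = symp ℝ n) : act A (thY n) = thY n := by
  rw [thY_eq_sympForm, map_smul, act_sympForm, prodMap_comp_inr,
    sympForm_comp (map_mul_symp_mul_transpose hA)]

theorem act_laguerrePair (hA : A.transpose * symp ℝ n * A = symp ℝ n) (j k : ℕ) :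
    act A (laguerrePair n j k) = laguerrePair n j k := by
  rw [laguerrePair, map_mul, ← Polynomial.aeval_algHom_apply, ← Polynomial.aeval_algHom_apply,
    act_thX hA, act_thY hA]

/-- Invariance is read off from the closed formula in `⟨x,y⟩`, `θ²` and `θ_y²`; the individual
harmonics are not invariant. -/
theorem IsOrthonormalFamily.act_reprKernel {H : HarmonicFamily n} (hH : IsOrthonormalFamily H)
    (hA : A.transpose * symp ℝ n * A = symp ℝ n) {k : ℕ} (hk : k ≤ n) :
    act A (reprKernel n H k) = reprKernel n H k := by
  rw [hH.reprKernel_eq k hk, map_sum]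
  simp only [map_smul, map_mul, map_pow, act_pair hA, act_thX hA, act_thY hA]

theorem act_mehlerKernel (hA : A.transpose * symp ℝ n * A = symp ℝ n) (α : ℝ) :
    act A (mehlerKernel n α) = mehlerKernel n α := by
  rw [mehlerKernel, map_smul, IsNilpotent.map_exp]
  · simp only [map_smul, map_sub, map_add, act_pair hA, act_thX hA, act_thY hA]
  · exact smul_isNilpotent (((pair_commute _).smul_left _).isNilpotent_sub
      (smul_isNilpotent pair_isNilpotent _) (smul_isNilpotent thX_add_thY_isNilpotent _)) _

theorem act_mehlerKernel' (hA : A.transpose * symp ℝ n * A = symp ℝ n) (α : ℝ) :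
    act A (mehlerKernel' n α) = mehlerKernel' n α := by
  rw [mehlerKernel', map_smul, IsNilpotent.map_exp]
  · simp only [map_smul, map_sub, map_add, act_pair hA, act_thX hA, act_thY hA]
  · exact smul_isNilpotent (((pair_commute _).smul_left _).isNilpotent_sub
      (smul_isNilpotent pair_isNilpotent _) (smul_isNilpotent thX_add_thY_isNilpotent _)) _

end SymplecticInvariance

end

end GrassmannMehler

theorem mainTheorem5 (n : ℕ) (H : HarmonicFamily n)
    (hmem : ∀ k ≤ n, ∀ l, H k l ∈ harmonics n k)
    (hreal : ∀ k ≤ n, ∀ l, conj (H k l) = H k l)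
    (horth : ∀ k ≤ n, ∀ p q,
      ip (H k p * gauss n) (H k q * gauss n) = if p = q then 1 / ((n - k)! : ℂ) else 0) :
    -- the functions `φ_{j,k,l}` are orthonormal
    (∀ k ≤ n, ∀ j ≤ n - k, ∀ l, ∀ k' ≤ n, ∀ j' ≤ n - k', ∀ l',
      ip (hermiteUnit n j k (H k l)) (hermiteUnit n j' k' (H k' l')) =
        if j = j' ∧ (⟨k, l⟩ : Σ k, Fin (Module.finrank ℂ (harmonics n k))) = ⟨k', l'⟩
        then 1 else 0) ∧
    -- Laguerre form of the Hermite functions, and the star map on them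
    (∀ k ≤ n, ∀ j ≤ n - k, ∀ l,
      hermiteFn n j (H k l) = ((2 : ℂ) ^ (2 * j) * j !) •
        (Polynomial.aeval (thetaSq n) (laguerre ((k : ℂ) - n - 1) j) * H k l * gauss n) ∧
      hodge n (Polynomial.aeval (thetaSq n) (laguerre ((k : ℂ) - n - 1) j) * H k l * gauss n) =
        (-1 : ℂ) ^ j •
          (Polynomial.aeval (thetaSq n) (laguerre ((k : ℂ) - n - 1) j) * tilde n (H k l) *
            gauss n)) ∧
    -- the reproducing kernel, explicitly and through the homogenized Gegenbauer polynomial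
    (∀ k ≤ n,
      reprKernel n H k = ∑ j ∈ Finset.range (k / 2 + 1),
        ((2 : ℂ) ^ (k - 2 * j) * Real.pi ^ n * (n + 1 - k) /
          ((k - 2 * j)! * j ! * (n + 1 + j - k)!)) •
          (pair n ^ (k - 2 * j) * thX n ^ j * thY n ^ j) ∧
      reprKernel n H k = ((Real.pi : ℂ) ^ n * (-1) ^ k * (n + 1 - k) / (n + 1)!) •
        ∑ j ∈ Finset.range (k / 2 + 1),
          (gegenbauer (-(n : ℂ) - 1) k).coeff (k - 2 * j) •
            (pair n ^ (k - 2 * j) * (thX n * thY n) ^ j)) ∧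
    -- the Mehler formula, the rewritten left-hand side, and the symplectic form
    (∀ α : ℝ, Complex.exp (2 * Complex.I * α) ≠ 1 →
      hermiteSum n H α = mehlerKernel n α ∧
      hermiteSum n H α =
        ∑ k ∈ Finset.range (n + 1), ∑ j ∈ Finset.range (n - k + 1), ∑ l,
          ((-1) ^ j / (gam n j k : ℂ) * 4 ^ (2 * j) * (j ! : ℂ) ^ 2 *
            Complex.exp (Complex.I * α * (2 * j + k))) •
          (laguerrePair n j k * inX n (tilde n (H k l)) * inY n (H k l) *
            IsNilpotent.exp ((-1 / 2 : ℂ) • (thX n + thY n))) ∧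
      laguerreSum n H α = mehlerKernel' n α) ∧
    -- the fermionic Fourier kernel, at `α = ± π / 2`
    (∀ σ : ℝ, σ = 1 ∨ σ = -1 →
      hermiteSum n H (σ * (Real.pi / 2)) =
        ((2 * Real.pi) ^ n : ℂ) • IsNilpotent.exp ((σ * Complex.I) • pair n) ∧
      (∑ k ∈ Finset.range (n + 1), ∑ j ∈ Finset.range (n - k + 1),
        ((j ! : ℂ) * (n - k - j)! * (σ * Complex.I) ^ k) •
          (laguerrePair n j k * reprKernel n H k *
            IsNilpotent.exp ((-1 / 2 : ℂ) • (thX n + thY n)))) =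
        ((2 * Real.pi) ^ n : ℂ) • IsNilpotent.exp ((σ * Complex.I) • pair n)) ∧
    -- invariance under the simultaneous action of `Sp(2n)`
    (∀ A : Matrix (Fin (2 * n)) (Fin (2 * n)) ℝ,
      A.transpose * symp ℝ n * A = symp ℝ n →
      (∀ k ≤ n, ∀ j ≤ n - k,
        act A (laguerrePair n j k * reprKernel n H k) = laguerrePair n j k * reprKernel n H k) ∧
      (∀ α : ℝ, Complex.exp (2 * Complex.I * α) ≠ 1 →
        act A (hermiteSum n H α) = hermiteSum n H α ∧
        act A (laguerreSum n H α) = laguerreSum n H α ∧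
        act A (mehlerKernel n α) = mehlerKernel n α ∧
        act A (mehlerKernel' n α) = mehlerKernel' n α)) := by
  -- Real coefficients make `H k q * gauss n` invariant under conjugation, so the Hermitian product
  -- agrees with the bilinear form.
  have hH : IsOrthonormalFamily H := by
    refine ⟨hmem, fun k hk p q => ?_⟩
    rw [← horth k hk p q, ip_eq_form, conj_gauss_mul (hreal k hk q)]
  refine ⟨fun k hk j hj l k' hk' j' _ l' => ?_, fun k hk j _ l => ?_,
    fun k hk => ⟨hH.reprKernel_eq k hk, hH.reprKernel_eq_gegenbauer k hk⟩,
    fun α hα => ⟨hH.hermiteSum_eq hα, hH.hermiteSum_eq_laguerre α, hH.laguerreSum_eq hα⟩,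
    fun σ hσ => ⟨hH.hermiteSum_half_pi hσ, hH.laguerreSum_half_pi hσ⟩,
    fun A hA => ⟨fun k hk j _ => ?_, fun α hα => ⟨?_, ?_, act_mehlerKernel hA α,
      act_mehlerKernel' hA α⟩⟩⟩
  · rw [ip_eq_form, conj_hermiteUnit (hreal k' hk' l')]
    simp only [hermiteUnit, map_smul, LinearMap.smul_apply]
    rw [hH.form_hermiteFn hk hk' hj, smul_eq_mul, smul_eq_mul]
    split_ifs with h
    · obtain ⟨rfl, h⟩ := h
      obtain rfl : k = k' := congrArg Sigma.fst h
      rw [← mul_assoc, ← mul_inv, ← Complex.ofReal_mul, Real.mul_self_sqrt (gam_pos j k).le,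
        inv_mul_cancel₀ (gam_ne_zero j k)]
    · rw [mul_zero, mul_zero]
  · have h := isLowestWeight_of_mem_harmonics (hmem k hk l)
    exact ⟨(hermiteFn_eq j _).trans (h.raising_pow j), h.hodge_laguerre j⟩
  · rw [map_mul, act_laguerrePair hA, hH.act_reprKernel hA hk]
  · rw [hH.hermiteSum_eq hα, act_mehlerKernel hA]
  · rw [hH.laguerreSum_eq hα, act_mehlerKernel' hA]
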